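/- Let $H$ be a fixed finite simple graph (without loops). An instance of Max Partial $H$-Coloring is a finite simple graph $G$ with a function $\mathrm{rev}\colon V(G)\times V(H)\to\mathbb{R}$. A partial $H$-coloring of $G$ is a partial function $\phi\colon V(G)\rightharpoonup V(H)$ with $\phi(u)\phi(v)\in E(H)$ for every edge $uv$ of $G$ with both ends in $\mathrm{dom}\,\phi$; the task is to find one that maximizes $\sum_{u\in\mathrm{dom}\,\phi}\mathrm{rev}(u,\phi(u))$. For $t\ge 1$, let $S_t$ be the star $K_{1,t}$ with every edge subdivided once, and for $s\ge 1$ let $L_s$ be $S_s$ with its leaves made pairwise adjacent (so $L_1=P_3$). Let $\mathsf{Ramsey}(s,t)=\binom{s+t-2}{s-1}$ and let $\omega(G)$ be the clique number of $G$. Theorem. For every such $H$ there are a constant $C$ and a recursive algorithm that, given integers $s,t\ge 1$ and an instance $(G,\mathrm{rev})$ of Max Partial $H$-Coloring in which $G$ has $n$ vertices and no induced subgraph isomorphic to $P_6$, $L_s$ or $S_t$, outputs an optimum solution of the instance, such that: 1. the total running time is at most $C\cdot\max(n,1)^{C\cdot\mathsf{Ramsey}(s,t)\cdot\omega(G)}$,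 that is, $n^{\mathcal{O}(\mathsf{Ramsey}(s,t)\cdot\omega(G))}$; 2. the recursion depth (the maximum nesting of recursive calls) is at most $2\omega(G)$, while every single invocation in the recursion, not counting its own recursive calls, takes at most $C\cdot\max(n,1)^{C\cdot\mathsf{Ramsey}(s,t)}$ steps. Here time is measured on a random access machine that stores natural numbers and real numbers in separate arrays, performs additions, subtractions and comparisons of numbers of the same kind, reads and writes in unit time, and whose program is a procedure that may call itself; each call receives $s,t$ and an instance by value, and is charged for every number passed or returned. -/

import Mathlib

/-! Induced-subgraph-free graphs, `Max Partial H-Coloring`, and a recursive machine model with a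
step count. -/

namespace MPHC

/-! ### Forbidden graphs -/

/-- The graph `S_t`: the star `K_{1,t}` with every edge subdivided once.
`inl ()` is the centre, `inr (inl i)` the `i`-th subdivision vertex, `inr (inr i)` the `i`-th leaf. -/
def graphS (t : ℕ) : SimpleGraph (Unit ⊕ Fin t ⊕ Fin t) :=
  SimpleGraph.fromRel fun a b =>
    match a, b with
    | Sum.inl _, Sum.inr (Sum.inl _) => True
    | Sum.inr (Sum.inl i), Sum.inr (Sum.inr j) => i = j
    | _, _ => False

/-- The graph `L_s`: the graph `S_s` with all its leaves made pairwise adjacent.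
For `s = 1` this is the path on three vertices. -/
def graphL (s : ℕ) : SimpleGraph (Unit ⊕ Fin s ⊕ Fin s) :=
  graphS s ⊔ SimpleGraph.fromRel fun a b =>
    match a, b with
    | Sum.inr (Sum.inr _), Sum.inr (Sum.inr _) => True
    | _, _ => False

/-- `G` has no induced subgraph isomorphic to `F`. -/
def IndFree {V W : Type*} (F : SimpleGraph W) (G : SimpleGraph V) : Prop :=
  ¬ F.IsIndContained G

/-- `Ramsey(s,t)`, understood as the binomial coefficient `binom(s+t-2, s-1)` (for `s, t ≥ 1`). -/
def ramsey (s t : ℕ) : ℕ := (s + t - 2).choose (s - 1)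

/-! ### The problem -/

/-- An instance of the problem for a pattern graph on `h` vertices, together with the
numbers `s`, `t` that are part of the input. -/
structure Instance (h : ℕ) where
  s : ℕ
  t : ℕ
  n : ℕ
  graph : SimpleGraph (Fin n)
  rev : Fin n → Fin h → ℝ

/-- `φ` is a partial homomorphism from `G` to `H`; `φ u = none` means `u ∉ dom φ`. -/
def IsPartialColoring {n h : ℕ} (G : SimpleGraph (Fin n)) (H : SimpleGraph (Fin h))
    (φ : Fin n → Option (Fin h)) : Prop :=
  ∀ u v, G.Adj u v → ∀ x y, φ u = some x → φ v = some y → H.Adj x y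

/-- The revenue of a partial colouring. -/
def revenue {n h : ℕ} (rev : Fin n → Fin h → ℝ) (φ : Fin n → Option (Fin h)) : ℝ :=
  ∑ u, (φ u).elim 0 (rev u)

/-- `φ` is an optimum solution. -/
def IsOptimum {h : ℕ} (H : SimpleGraph (Fin h)) (I : Instance h)
    (φ : Fin I.n → Option (Fin h)) : Prop :=
  IsPartialColoring I.graph H φ ∧
    ∀ ψ, IsPartialColoring I.graph H ψ → revenue I.rev ψ ≤ revenue I.rev φ

/-! ### The machine model

A random access machine whose memory consists of two-dimensional arrays, addressed by an array
name and two indices, that hold natural numbers or real numbers.  The only arithmetic operations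
are addition and subtraction (truncated on natural numbers), and the only tests are comparisons;
reals are never converted to naturals.  A program is a single procedure which may call itself.
Every invocation has a memory of its own, initially holding an instance. -/

/-- The memory of one invocation. -/
structure Store where
  nat : ℕ → ℕ → ℕ → ℕ
  real : ℕ → ℕ → ℕ → ℝ

/-- Expressions for natural numbers; `get a i j` reads entry `(i, j)` of the `a`-th array. -/
inductive NExp where
  | const (k : ℕ)
  | get (a : ℕ) (i j : NExp)
  | add (e f : NExp)
  | sub (e f : NExp)

/-- Expressions for real numbers. -/
inductive RExp where
  | const (k : ℤ)
  | get (a : ℕ) (i j : NExp)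
  | add (e f : RExp)
  | sub (e f : RExp)

/-- Tests. -/
inductive BExp where
  | leN (e f : NExp)
  | leR (e f : RExp)
  | not (b : BExp)
  | and (b c : BExp)

/-- Commands.  `call n s t A W O` is the recursive self-call: it passes the instance with
parameters `s`, `t` whose graph has `n` vertices, adjacency matrix in the natural array `A` and
revenues in the real array `W`, and receives the answer in column `0` of the natural array `O`. -/
inductive Cmd where
  | skip
  | setN (a : ℕ) (i j e : NExp)
  | setR (a : ℕ) (i j : NExp) (e : RExp)
  | seq (c d : Cmd)
  | ite (b : BExp) (c d : Cmd)
  | loop (b : BExp) (c : Cmd)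
  | call (n s t : NExp) (A W O : ℕ)

def NExp.eval (σ : Store) : NExp → ℕ
  | .const k => k
  | .get a i j => σ.nat a (i.eval σ) (j.eval σ)
  | .add e f => e.eval σ + f.eval σ
  | .sub e f => e.eval σ - f.eval σ

/-- The number of steps needed to evaluate the expression. -/
def NExp.cost : NExp → ℕ
  | .const _ => 1
  | .get _ i j => i.cost + j.cost + 1
  | .add e f => e.cost + f.cost + 1
  | .sub e f => e.cost + f.cost + 1

noncomputable def RExp.eval (σ : Store) : RExp → ℝ
  | .const k => (k : ℝ)
  | .get a i j => σ.real a (i.eval σ) (j.eval σ)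
  | .add e f => e.eval σ + f.eval σ
  | .sub e f => e.eval σ - f.eval σ

def RExp.cost : RExp → ℕ
  | .const _ => 1
  | .get _ i j => i.cost + j.cost + 1
  | .add e f => e.cost + f.cost + 1
  | .sub e f => e.cost + f.cost + 1

def BExp.holds (σ : Store) : BExp → Prop
  | .leN e f => e.eval σ ≤ f.eval σ
  | .leR e f => e.eval σ ≤ f.eval σ
  | .not b => ¬ b.holds σ
  | .and b c => b.holds σ ∧ c.holds σ

def BExp.cost : BExp → ℕ
  | .leN e f => e.cost + f.cost + 1
  | .leR e f => e.cost + f.cost + 1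
  | .not b => b.cost + 1
  | .and b c => b.cost + c.cost + 1

def Store.updN (σ : Store) (a i j v : ℕ) : Store where
  nat := fun a' i' j' => if a' = a ∧ i' = i ∧ j' = j then v else σ.nat a' i' j'
  real := σ.real

noncomputable def Store.updR (σ : Store) (a i j : ℕ) (v : ℝ) : Store where
  nat := σ.nat
  real := fun a' i' j' => if a' = a ∧ i' = i ∧ j' = j then v else σ.real a' i' j'

open Classical in
/-- The initial memory of an invocation on the instance `I`: the natural array `0` holds
`n, s, t` in row `0`, the natural array `1` the adjacency matrix, the real array `0` the revenues,
and all other entries are `0`. -/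
noncomputable def Store.load {h : ℕ} (I : Instance h) : Store where
  nat := fun a i j =>
    if a = 0 ∧ i = 0 ∧ j = 0 then I.n
    else if a = 0 ∧ i = 0 ∧ j = 1 then I.s
    else if a = 0 ∧ i = 0 ∧ j = 2 then I.t
    else if a = 1 ∧ ∃ (hi : i < I.n) (hj : j < I.n), I.graph.Adj ⟨i, hi⟩ ⟨j, hj⟩ then 1
    else 0
  real := fun a i j =>
    if hij : a = 0 ∧ i < I.n ∧ j < h then I.rev ⟨i, hij.2.1⟩ ⟨j, hij.2.2⟩ else 0

/-- The instance passed by a call: a nonzero entry of the array `A` (off the diagonal) stands for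
an edge. -/
def Store.arg (h : ℕ) (σ : Store) (n s t A W : ℕ) : Instance h where
  s := s
  t := t
  n := n
  graph := SimpleGraph.fromRel fun u v => σ.nat A u v ≠ 0
  rev := fun u x => σ.real W u x

/-- Memory of the caller after a call on `n` vertices that ended with the callee's memory `τ`:
the answer, held by the callee in column `0` of its natural array `2`, is copied. -/
def Store.receive (σ τ : Store) (n O : ℕ) : Store where
  nat := fun a i j => if a = O ∧ i < n ∧ j = 0 then τ.nat 2 i 0 else σ.nat a i j
  real := σ.real

/-- The answer held in the final memory of an invocation on a graph with `n` vertices: entry `0`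
means that the vertex is not coloured, entry `x + 1` that it gets colour `x`. -/
def Store.answer (σ : Store) (n h : ℕ) : Fin n → Option (Fin h) := fun u =>
  match σ.nat 2 u 0 with
  | 0 => none
  | k + 1 => if hk : k < h then some ⟨k, hk⟩ else none

/-- Resources used by an execution: `own` is the number of steps of the current invocation itself,
not counting the steps made inside recursive calls; `total` is the number of all steps; `depth`
is the maximum nesting of recursive calls; `peak` is the maximum, over all recursive calls (at all
levels below the current invocation), of the number of own steps of that call. -/
structure Cost where
  own : ℕ
  total : ℕ
  depth : ℕ
  peak : ℕ

/-- `k` elementary steps. -/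
def Cost.steps (k : ℕ) : Cost := ⟨k, k, 0, 0⟩

def Cost.seq (c d : Cost) : Cost :=
  ⟨c.own + d.own, c.total + d.total, max c.depth d.depth, max c.peak d.peak⟩

/-- Cost of a recursive call with `k` steps of overhead whose callee used `c`. -/
def Cost.call (k : ℕ) (c : Cost) : Cost :=
  ⟨k, k + c.total, c.depth + 1, max c.own c.peak⟩

/-- `Exec h p c σ σ' k`: the command `c`, in which self-calls invoke the procedure body `p`,
turns the memory `σ` into `σ'` and uses the resources `k`.  A call is charged for every number
that is passed or returned. -/
inductive Exec (h : ℕ) (p : Cmd) : Cmd → Store → Store → Cost → Prop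
  | skip (σ : Store) : Exec h p .skip σ σ (.steps 1)
  | setN (σ : Store) (a : ℕ) (i j e : NExp) :
      Exec h p (.setN a i j e) σ (σ.updN a (i.eval σ) (j.eval σ) (e.eval σ))
        (.steps (i.cost + j.cost + e.cost + 1))
  | setR (σ : Store) (a : ℕ) (i j : NExp) (e : RExp) :
      Exec h p (.setR a i j e) σ (σ.updR a (i.eval σ) (j.eval σ) (e.eval σ))
        (.steps (i.cost + j.cost + e.cost + 1))
  | seq {c d : Cmd} {σ₁ σ₂ σ₃ : Store} {k l : Cost} :
      Exec h p c σ₁ σ₂ k → Exec h p d σ₂ σ₃ l → Exec h p (.seq c d) σ₁ σ₃ (k.seq l)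
  | iteTrue {b : BExp} {c d : Cmd} {σ σ' : Store} {k : Cost} :
      b.holds σ → Exec h p c σ σ' k → Exec h p (.ite b c d) σ σ' ((Cost.steps b.cost).seq k)
  | iteFalse {b : BExp} {c d : Cmd} {σ σ' : Store} {k : Cost} :
      ¬ b.holds σ → Exec h p d σ σ' k → Exec h p (.ite b c d) σ σ' ((Cost.steps b.cost).seq k)
  | loopStop {b : BExp} {c : Cmd} {σ : Store} :
      ¬ b.holds σ → Exec h p (.loop b c) σ σ (.steps b.cost)
  | loopStep {b : BExp} {c : Cmd} {σ₁ σ₂ σ₃ : Store} {k l : Cost} :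
      b.holds σ₁ → Exec h p c σ₁ σ₂ k → Exec h p (.loop b c) σ₂ σ₃ l →
      Exec h p (.loop b c) σ₁ σ₃ (((Cost.steps b.cost).seq k).seq l)
  | call {σ τ : Store} {n s t : NExp} {A W O : ℕ} {k : Cost} :
      Exec h p p (Store.load (σ.arg h (n.eval σ) (s.eval σ) (t.eval σ) A W)) τ k →
      Exec h p (.call n s t A W O) σ (σ.receive τ (n.eval σ) O)
        (.call (n.cost + s.cost + t.cost + n.eval σ * n.eval σ + n.eval σ * h + n.eval σ + 1) k)

/-- The program `p`, started on the instance `I`, halts with answer `φ` using the resources `k`. -/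
def Runs {h : ℕ} (p : Cmd) (I : Instance h) (φ : Fin I.n → Option (Fin h)) (k : Cost) : Prop :=
  ∃ σ, Exec h p p (Store.load I) σ k ∧ φ = σ.answer I.n h

end MPHC

/-! Take a component of `G` and a vertex `r` in it. Because `G` is `P_6`-free, there are `y`, `z`
(`exists_dominating_triple`) with the following effect. Label each vertex of the component by the
first of `r`, `y`, `z` adjacent to it, or by 3 if there is none, and delete all edges between
different labels. Then a vertex and its remaining neighbours always have a common neighbour in `G`:
one of `r`, `y`, `z` for labels 0, 1, 2, and a vertex supplied by the lemma for label 3. So every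
clique on at least two vertices that survives extends in `G`, and the clique number drops. The three
forbidden graphs are connected, hence stay excluded.

The deleted edges are replaced by guessing. Let `ψ` be any solution. For a label below 3 and a
colour `a`, the vertices with this label and colour form an independent set of neighbours of one
vertex `u`, since `H` has no loops. Take a minimal subset with the same neighbours outside the
neighbourhood of `u`. Its members have private neighbours; if it were larger than `ramsey s t`, the
private neighbours would contain a clique on `s` or an independent set on `t` vertices, and so yield
an `L_s` or `S_t` (`exists_small_cover`). A guess lists these small covers with their colours.
Colour `a` is allowed at `v` if every neighbour of `v` with a larger label has a guessed neighbour
of colour `a`, and `a` is adjacent in `H` to all colours guessed in the neighbourhood of `v`. For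
the right guess `ψ` obeys these rules (`exists_guess`). Conversely, obeying them makes all deleted
edges correct (`IsOptimum.of_restricted`). Forbidden colours get revenue -1, so the restricted
problem is an instance of the same kind.

A guess consists of `2m` numbers below `n + h + 1` with `m = 3h * ramsey s t`, where `s` and `t` are
first capped at `n + 1`. Each guess needs one recursive call on a graph with smaller clique number.
If `Q` bounds the steps of one invocation, the depth is at most the clique number `c` and the total
time at most `(2Q)^c` (`exec_main`).

The remaining work is to write this as a program and verify it. `Ok` is a total-correctness
judgement that carries resource limits, with frame conditions read off the program text; tests are
written as formulas with bounded quantifiers and compiled by `Fm.compile`. -/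

namespace MPHC

/-! ### A logic for total correctness with resource bounds -/

/-- The natural arrays that a command may change. -/
def Cmd.modN : Cmd → List ℕ
  | .skip => []
  | .setN a _ _ _ => [a]
  | .setR _ _ _ _ => []
  | .seq c d => c.modN ++ d.modN
  | .ite _ c d => c.modN ++ d.modN
  | .loop _ c => c.modN
  | .call _ _ _ _ _ O => [O]

/-- The real arrays that a command may change. -/
def Cmd.modR : Cmd → List ℕ
  | .skip => []
  | .setN _ _ _ _ => []
  | .setR a _ _ _ => [a]
  | .seq c d => c.modR ++ d.modR
  | .ite _ c d => c.modR ++ d.modR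
  | .loop _ c => c.modR
  | .call _ _ _ _ _ _ => []

/-- `σ'` agrees with `σ` on all arrays that `c` does not write to. -/
def Frame (c : Cmd) (σ σ' : Store) : Prop :=
  (∀ a ∉ c.modN, σ'.nat a = σ.nat a) ∧ ∀ a ∉ c.modR, σ'.real a = σ.real a

/-- The names of written arrays are fixed in the program text, since only indices are computed at
run time. Hence non-interference can be decided by evaluating lists, and is proved by `rfl` below.
-/
theorem Exec.frame {h : ℕ} {p c : Cmd} {σ σ' : Store} {k : Cost} (e : Exec h p c σ σ' k) :
    Frame c σ σ' := by
  induction e with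
  | skip => exact ⟨fun _ _ => rfl, fun _ _ => rfl⟩
  | setN σ a i j e =>
    refine ⟨fun b hb => ?_, fun _ _ => rfl⟩
    have : b ≠ a := by simpa [Cmd.modN] using hb
    funext x y
    simp [Store.updN, this]
  | setR σ a i j e =>
    refine ⟨fun _ _ => rfl, fun b hb => ?_⟩
    have : b ≠ a := by simpa [Cmd.modR] using hb
    funext x y
    simp [Store.updR, this]
  | seq _ _ h1 h2 =>
    refine ⟨fun a ha => ?_, fun a ha => ?_⟩
    · simp only [Cmd.modN, List.mem_append, not_or] at ha
      rw [h2.1 a ha.2, h1.1 a ha.1]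
    · simp only [Cmd.modR, List.mem_append, not_or] at ha
      rw [h2.2 a ha.2, h1.2 a ha.1]
  | iteTrue _ _ h1 =>
    refine ⟨fun a ha => ?_, fun a ha => ?_⟩
    · simp only [Cmd.modN, List.mem_append, not_or] at ha
      exact h1.1 a ha.1
    · simp only [Cmd.modR, List.mem_append, not_or] at ha
      exact h1.2 a ha.1
  | iteFalse _ _ h1 =>
    refine ⟨fun a ha => ?_, fun a ha => ?_⟩
    · simp only [Cmd.modN, List.mem_append, not_or] at ha
      exact h1.1 a ha.2
    · simp only [Cmd.modR, List.mem_append, not_or] at ha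
      exact h1.2 a ha.2
  | loopStop => exact ⟨fun _ _ => rfl, fun _ _ => rfl⟩
  | loopStep _ _ _ h1 h2 =>
    refine ⟨fun a ha => ?_, fun a ha => ?_⟩
    · rw [h2.1 a ha, h1.1 a ha]
    · rw [h2.2 a ha, h1.2 a ha]
  | call _ _ =>
    refine ⟨fun a ha => ?_, fun _ _ => rfl⟩
    simp only [Cmd.modN, List.mem_singleton] at ha
    funext x y
    simp [Store.receive, ha]

/-- A bound on the number of steps of a command whose loops make at most `M` iterations each, and
in which every recursive call, on at most `M` vertices, takes at most `T` steps. -/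
def Cmd.bound (h M T : ℕ) : Cmd → ℕ
  | .skip => 1
  | .setN _ i j e => i.cost + j.cost + e.cost + 1
  | .setR _ i j e => i.cost + j.cost + e.cost + 1
  | .seq c d => c.bound h M T + d.bound h M T
  | .ite b c d => b.cost + (c.bound h M T + d.bound h M T)
  | .loop b c => M * (b.cost + c.bound h M T) + b.cost
  | .call n s t _ _ _ => n.cost + s.cost + t.cost + M * M + M * h + M + 1 + T

/-- The setting of an execution: the program, and limits for the number of iterations of loops,
for the total time of a recursive call, for the nesting of calls and for the time a single call
takes. -/
structure Env where
  h : ℕ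
  prog : Cmd
  iter : ℕ
  total : ℕ
  depth : ℕ
  peak : ℕ

/-- The resources `k` are within the limits that `E` sets to the command `c`. -/
structure Within (E : Env) (c : Cmd) (k : Cost) : Prop where
  own : k.own ≤ c.bound E.h E.iter 0
  total : k.total ≤ c.bound E.h E.iter E.total
  depth : k.depth ≤ E.depth
  peak : k.peak ≤ E.peak

/-- The command `c`, started in `σ`, halts within the limits in a memory that satisfies `Q`. -/
def Ok (E : Env) (c : Cmd) (σ : Store) (Q : Store → Prop) : Prop :=
  ∃ σ' k, Exec E.h E.prog c σ σ' k ∧ Within E c k ∧ Q σ'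

section rules

variable {E : Env} {c d : Cmd} {σ : Store} {Q Q' : Store → Prop}

theorem Ok.mono (hc : Ok E c σ Q) (hQ : ∀ σ', Q σ' → Q' σ') : Ok E c σ Q' := by
  obtain ⟨σ', k, h1, h2, h3⟩ := hc
  exact ⟨σ', k, h1, h2, hQ _ h3⟩

theorem Ok.frame (hc : Ok E c σ Q) : Ok E c σ fun σ' => Frame c σ σ' ∧ Q σ' := by
  obtain ⟨σ', k, h1, h2, h3⟩ := hc
  exact ⟨σ', k, h1, h2, h1.frame, h3⟩

theorem Ok.skip (hQ : Q σ) : Ok E .skip σ Q :=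
  ⟨σ, _, .skip σ, ⟨by simp [Cost.steps, Cmd.bound], by simp [Cost.steps, Cmd.bound],
    by simp [Cost.steps], by simp [Cost.steps]⟩, hQ⟩

theorem Ok.setN {a : ℕ} {i j e : NExp} (hQ : Q (σ.updN a (i.eval σ) (j.eval σ) (e.eval σ))) :
    Ok E (.setN a i j e) σ Q :=
  ⟨_, _, .setN σ a i j e, ⟨by simp [Cost.steps, Cmd.bound], by simp [Cost.steps, Cmd.bound],
    by simp [Cost.steps], by simp [Cost.steps]⟩, hQ⟩

theorem Ok.setR {a : ℕ} {i j : NExp} {e : RExp}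
    (hQ : Q (σ.updR a (i.eval σ) (j.eval σ) (e.eval σ))) : Ok E (.setR a i j e) σ Q :=
  ⟨_, _, .setR σ a i j e, ⟨by simp [Cost.steps, Cmd.bound], by simp [Cost.steps, Cmd.bound],
    by simp [Cost.steps], by simp [Cost.steps]⟩, hQ⟩

theorem Ok.seq (hc : Ok E c σ fun τ => Ok E d τ Q) : Ok E (.seq c d) σ Q := by
  obtain ⟨τ, k, h1, h2, τ', l, h3, h4, h5⟩ := hc
  exact ⟨τ', _, .seq h1 h3, ⟨Nat.add_le_add h2.own h4.own, Nat.add_le_add h2.total h4.total,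
    max_le h2.depth h4.depth, max_le h2.peak h4.peak⟩, h5⟩

theorem Ok.ite {b : BExp} (hc : b.holds σ → Ok E c σ Q) (hd : ¬ b.holds σ → Ok E d σ Q) :
    Ok E (.ite b c d) σ Q := by
  by_cases hb : b.holds σ
  · obtain ⟨σ', k, h1, h2, h3⟩ := hc hb
    refine ⟨σ', _, .iteTrue hb h1, ⟨?_, ?_, ?_, ?_⟩, h3⟩
    · have := h2.own
      simp only [Cost.seq, Cost.steps, Cmd.bound]; omega
    · have := h2.total
      simp only [Cost.seq, Cost.steps, Cmd.bound]; omega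
    · simpa [Cost.seq, Cost.steps] using h2.depth
    · simpa [Cost.seq, Cost.steps] using h2.peak
  · obtain ⟨σ', k, h1, h2, h3⟩ := hd hb
    refine ⟨σ', _, .iteFalse hb h1, ⟨?_, ?_, ?_, ?_⟩, h3⟩
    · have := h2.own
      simp only [Cost.seq, Cost.steps, Cmd.bound]; omega
    · have := h2.total
      simp only [Cost.seq, Cost.steps, Cmd.bound]; omega
    · simpa [Cost.seq, Cost.steps] using h2.depth
    · simpa [Cost.seq, Cost.steps] using h2.peak

/-- A loop that makes exactly `N` iterations. -/
theorem Ok.loop {b : BExp} {N : ℕ} (hN : N ≤ E.iter) (I : ℕ → Store → Prop) (h0 : I 0 σ)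
    (hstep : ∀ i τ, i < N → Frame c σ τ → I i τ → b.holds τ ∧ Ok E c τ (I (i + 1)))
    (hexit : ∀ τ, Frame c σ τ → I N τ → ¬ b.holds τ) : Ok E (.loop b c) σ (I N) := by
  -- Induction on the number `j` of iterations still to come, so that the cost of the tail is
  -- available when one iteration is put in front of it.
  have key : ∀ j τ, j ≤ N → Frame c σ τ → I (N - j) τ → ∃ τ' k,
      Exec E.h E.prog (.loop b c) τ τ' k ∧ I N τ' ∧
      k.own ≤ j * (b.cost + c.bound E.h E.iter 0) + b.cost ∧
      k.total ≤ j * (b.cost + c.bound E.h E.iter E.total) + b.cost ∧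
      k.depth ≤ E.depth ∧ k.peak ≤ E.peak := by
    intro j
    induction j with
    | zero =>
      intro τ _ hf hI
      exact ⟨τ, _, .loopStop (hexit τ hf hI), hI, by simp [Cost.steps], by simp [Cost.steps],
        by simp [Cost.steps], by simp [Cost.steps]⟩
    | succ j ih =>
      intro τ hj hf hI
      obtain ⟨hb, τ₁, k, h1, h2, h3⟩ := hstep (N - (j + 1)) τ (by omega) hf hI
      have hf' : Frame c σ τ₁ :=
        ⟨fun a ha => (h1.frame.1 a ha).trans (hf.1 a ha),
          fun a ha => (h1.frame.2 a ha).trans (hf.2 a ha)⟩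
      rw [show N - (j + 1) + 1 = N - j by omega] at h3
      obtain ⟨τ₂, l, h4, h5, h6, h7, h8, h9⟩ := ih τ₁ (by omega) hf' h3
      refine ⟨τ₂, _, .loopStep hb h1 h4, h5, ?_, ?_, ?_, ?_⟩
      · have := h2.own
        simp only [Cost.seq, Cost.steps, Nat.add_mul]; omega
      · have := h2.total
        simp only [Cost.seq, Cost.steps, Nat.add_mul]; omega
      · simpa [Cost.seq, Cost.steps] using ⟨h2.depth, h8⟩
      · simpa [Cost.seq, Cost.steps] using ⟨h2.peak, h9⟩
  obtain ⟨τ, k, h1, h2, h3, h4, h5, h6⟩ :=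
    key N σ le_rfl ⟨fun _ _ => rfl, fun _ _ => rfl⟩ (by simpa using h0)
  exact ⟨τ, k, h1, ⟨h3.trans (Nat.add_le_add_right (Nat.mul_le_mul_right _ hN) _),
    h4.trans (Nat.add_le_add_right (Nat.mul_le_mul_right _ hN) _), h5, h6⟩, h2⟩

/-- The own steps of the callee are charged to `peak` and `total`, while the caller pays only for
the transfer; `E.iter` also limits the size of the instance passed. -/
theorem Ok.call {n s t : NExp} {A W O : ℕ} {τ : Store} {k : Cost} (hn : n.eval σ ≤ E.iter)
    (he : Exec E.h E.prog E.prog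
      (Store.load (σ.arg E.h (n.eval σ) (s.eval σ) (t.eval σ) A W)) τ k)
    (h1 : k.own ≤ E.peak) (h2 : k.total ≤ E.total) (h3 : k.depth + 1 ≤ E.depth)
    (h4 : k.peak ≤ E.peak) (hQ : Q (σ.receive τ (n.eval σ) O)) :
    Ok E (.call n s t A W O) σ Q := by
  have a1 := Nat.mul_le_mul hn hn
  have a2 := Nat.mul_le_mul_right E.h hn
  refine ⟨_, _, .call he, ⟨?_, ?_, h3, max_le h1 h4⟩, hQ⟩
  · simp only [Cost.call, Cmd.bound]; omega
  · simp only [Cost.call, Cmd.bound]; omega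

end rules

/-! ### Variables, counting loops, and the arrays an expression depends on -/

/-- A scalar variable. -/
abbrev NExp.var (x : ℕ) : NExp := .get x (.const 0) (.const 0)

/-- An entry of a one-dimensional array. -/
abbrev NExp.arr (x : ℕ) (e : NExp) : NExp := .get x e (.const 0)

/-- Assignment to a scalar variable. -/
abbrev Cmd.setV (x : ℕ) (e : NExp) : Cmd := .setN x (.const 0) (.const 0) e

/-- `for x < e do c` -/
def Cmd.forC (x : ℕ) (e : NExp) (c : Cmd) : Cmd :=
  .seq (.setV x (.const 0)) (.loop (.leN (.add (.var x) (.const 1)) e)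
    (.seq c (.setV x (.add (.var x) (.const 1)))))

/-- The natural arrays that an expression reads. -/
def NExp.reads : NExp → List ℕ
  | .const _ => []
  | .get a i j => a :: (i.reads ++ j.reads)
  | .add e f => e.reads ++ f.reads
  | .sub e f => e.reads ++ f.reads

def RExp.reads : RExp → List ℕ
  | .const _ => []
  | .get _ i j => i.reads ++ j.reads
  | .add e f => e.reads ++ f.reads
  | .sub e f => e.reads ++ f.reads

def BExp.reads : BExp → List ℕ
  | .leN e f => e.reads ++ f.reads
  | .leR e f => e.reads ++ f.reads
  | .not b => b.reads
  | .and b c => b.reads ++ c.reads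

theorem NExp.eval_congr {σ τ : Store} {e : NExp} (h : ∀ a ∈ e.reads, σ.nat a = τ.nat a) :
    e.eval σ = e.eval τ := by
  induction e with
  | const => rfl
  | get a i j hi hj =>
    simp only [reads, List.mem_cons, List.mem_append] at h
    simp only [eval, hi fun a ha => h a (.inr (.inl ha)), hj fun a ha => h a (.inr (.inr ha)),
      h a (.inl rfl)]
  | add e f he hf =>
    simp only [reads, List.mem_append] at h
    simp only [eval, he fun a ha => h a (.inl ha), hf fun a ha => h a (.inr ha)]
  | sub e f he hf =>
    simp only [reads, List.mem_append] at h
    simp only [eval, he fun a ha => h a (.inl ha), hf fun a ha => h a (.inr ha)]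

theorem RExp.eval_congr {σ τ : Store} {e : RExp} (h : ∀ a ∈ e.reads, σ.nat a = τ.nat a)
    (hr : σ.real = τ.real) : e.eval σ = e.eval τ := by
  induction e with
  | const => rfl
  | get a i j =>
    simp only [reads, List.mem_append] at h
    simp only [eval, NExp.eval_congr fun a ha => h a (.inl ha),
      NExp.eval_congr fun a ha => h a (.inr ha), hr]
  | add e f he hf =>
    simp only [reads, List.mem_append] at h
    simp only [eval, he fun a ha => h a (.inl ha), hf fun a ha => h a (.inr ha)]
  | sub e f he hf =>
    simp only [reads, List.mem_append] at h
    simp only [eval, he fun a ha => h a (.inl ha), hf fun a ha => h a (.inr ha)]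

theorem BExp.holds_congr {σ τ : Store} {b : BExp} (h : ∀ a ∈ b.reads, σ.nat a = τ.nat a)
    (hr : σ.real = τ.real) : b.holds σ ↔ b.holds τ := by
  induction b with
  | leN e f =>
    simp only [reads, List.mem_append] at h
    simp only [holds, NExp.eval_congr fun a ha => h a (.inl ha),
      NExp.eval_congr fun a ha => h a (.inr ha)]
  | leR e f =>
    simp only [reads, List.mem_append] at h
    simp only [holds, RExp.eval_congr (fun a ha => h a (.inl ha)) hr,
      RExp.eval_congr (fun a ha => h a (.inr ha)) hr]
  | not b hb => simp only [holds, hb h]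
  | and b c hb hc =>
    simp only [reads, List.mem_append] at h
    simp only [holds, hb fun a ha => h a (.inl ha), hc fun a ha => h a (.inr ha)]

/-- No entry of the first list occurs in the second one. -/
def disj (l m : List ℕ) : Bool := l.all fun a => m.all fun b => a != b

theorem not_mem_of_disj {l m : List ℕ} (h : disj l m = true) {a : ℕ} (ha : a ∈ l) : a ∉ m := by
  simp only [disj, List.all_eq_true, bne_iff_ne] at h
  exact fun hm => h a ha a hm rfl

@[simp] theorem updN_same {σ : Store} {a i j v : ℕ} : (σ.updN a i j v).nat a i j = v := by
  simp [Store.updN]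

theorem updN_nat {σ : Store} {a i j v b : ℕ} (h : b ≠ a) : (σ.updN a i j v).nat b = σ.nat b := by
  funext x y
  simp [Store.updN, h]

@[simp] theorem updN_real {σ : Store} {a i j v : ℕ} : (σ.updN a i j v).real = σ.real := rfl

@[simp] theorem updR_nat {σ : Store} {a i j : ℕ} {v : ℝ} : (σ.updR a i j v).nat = σ.nat := rfl

theorem updR_real {σ : Store} {a i j b : ℕ} {v : ℝ} (h : b ≠ a) :
    (σ.updR a i j v).real b = σ.real b := by
  funext x y
  simp [Store.updR, h]

@[simp] theorem updR_same {σ : Store} {a i j : ℕ} {v : ℝ} : (σ.updR a i j v).real a i j = v := by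
  simp [Store.updR]

/-- The invariant for `i` refers to the memory in which the counter already holds `i`, which
explains the updates of `x` in the hypotheses. The two disjointness tests say that the body touches
neither the counter nor the bound, so the number of iterations is known on entry. -/
theorem Ok.forC {E : Env} {x : ℕ} {e : NExp} {c : Cmd} {σ : Store} {N : ℕ} (hN : e.eval σ = N)
    (hM : N ≤ E.iter) (hx : disj [x] c.modN = true) (he : disj e.reads (x :: c.modN) = true)
    (I : ℕ → Store → Prop) (h0 : I 0 (σ.updN x 0 0 0))
    (hstep : ∀ i τ, i < N → τ.nat x 0 0 = i → (∀ a ∉ x :: c.modN, τ.nat a = σ.nat a) →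
      (∀ a ∉ c.modR, τ.real a = σ.real a) → I i τ →
      Ok E c τ fun τ' => I (i + 1) (τ'.updN x 0 0 (i + 1))) :
    Ok E (.forC x e c) σ (I N) := by
  have hmod : ∀ y, (y ∈ c.modN ∨ y = x) ↔ y ∈ x :: c.modN := by
    intro y; simp [or_comm]
  refine Ok.seq (Ok.setN ?_)
  have := Ok.loop (E := E) (c := .seq c (.setV x (.add (.var x) (.const 1))))
    (σ := σ.updN x 0 0 0) (b := .leN (.add (.var x) (.const 1)) e) hM
    (fun i τ => τ.nat x 0 0 = i ∧ I i τ) ⟨by simp, h0⟩ ?_ ?_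
  · exact this.mono fun _ h => h.2
  · intro i τ hi hf hI
    have hfN : ∀ a ∉ x :: c.modN, τ.nat a = σ.nat a := by
      intro a ha
      rw [hf.1 a (by simpa [Cmd.modN, hmod] using ha), updN_nat]
      rintro rfl
      exact ha (by simp)
    have hfR : ∀ a ∉ c.modR, τ.real a = σ.real a := by
      intro a ha
      rw [hf.2 a (by simpa [Cmd.modR] using ha)]
      rfl
    refine ⟨?_, ?_⟩
    · have : e.eval τ = e.eval σ := NExp.eval_congr fun a ha => hfN a (not_mem_of_disj he ha)
      simp only [BExp.holds, NExp.eval, this, hN, hI.1]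
      omega
    · refine Ok.seq ((hstep i τ hi hI.1 hfN hfR hI.2).frame.mono ?_)
      rintro τ' ⟨hf', hI'⟩
      have : τ'.nat x = τ.nat x := hf'.1 x (not_mem_of_disj hx (by simp))
      refine Ok.setN ?_
      simp only [NExp.eval, this, hI.1]
      exact ⟨by simp, hI'⟩
  · intro τ hf hI
    have hfN : ∀ a ∉ x :: c.modN, τ.nat a = σ.nat a := by
      intro a ha
      rw [hf.1 a (by simpa [Cmd.modN, hmod] using ha), updN_nat]
      rintro rfl
      exact ha (by simp)
    have : e.eval τ = e.eval σ := NExp.eval_congr fun a ha => hfN a (not_mem_of_disj he ha)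
    simp only [BExp.holds, NExp.eval, this, hN, hI.1]
    omega

/-! ### Growth of the step bound -/

/-- The step bound is polynomial in the number of iterations. -/
theorem Cmd.exists_bound_le (h : ℕ) (c : Cmd) :
    ∃ K e, ∀ M, 1 ≤ M → c.bound h M 0 ≤ K * M ^ e := by
  induction c with
  | skip => exact ⟨1, 0, fun M _ => by simp [bound]⟩
  | setN _ i j e => exact ⟨i.cost + j.cost + e.cost + 1, 0, fun M _ => by simp [bound]⟩
  | setR _ i j e => exact ⟨i.cost + j.cost + e.cost + 1, 0, fun M _ => by simp [bound]⟩
  | seq c d hc hd =>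
    obtain ⟨K, e, h1⟩ := hc
    obtain ⟨L, f, h2⟩ := hd
    refine ⟨K + L, e + f, fun M hM => ?_⟩
    have a1 := Nat.mul_le_mul_left K (Nat.pow_le_pow_right hM (Nat.le_add_right e f))
    have a2 := Nat.mul_le_mul_left L (Nat.pow_le_pow_right hM (Nat.le_add_left f e))
    have := h1 M hM
    have := h2 M hM
    simp only [bound, Nat.add_mul]
    omega
  | ite b c d hc hd =>
    obtain ⟨K, e, h1⟩ := hc
    obtain ⟨L, f, h2⟩ := hd
    refine ⟨b.cost + K + L, e + f, fun M hM => ?_⟩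
    have a1 := Nat.mul_le_mul_left K (Nat.pow_le_pow_right hM (Nat.le_add_right e f))
    have a2 := Nat.mul_le_mul_left L (Nat.pow_le_pow_right hM (Nat.le_add_left f e))
    have a3 := Nat.le_mul_of_pos_right b.cost (Nat.pow_pos (n := e + f) hM)
    have := h1 M hM
    have := h2 M hM
    simp only [bound, Nat.add_mul]
    omega
  | loop b c hc =>
    obtain ⟨K, e, h1⟩ := hc
    refine ⟨2 * b.cost + K, e + 1, fun M hM => ?_⟩
    have a1 := Nat.mul_le_mul_left M (h1 M hM)
    have a3 := Nat.le_mul_of_pos_right b.cost (Nat.pow_pos (n := e + 1) hM)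
    have a2 : M * b.cost ≤ b.cost * M ^ (e + 1) := by
      rw [mul_comm]
      exact Nat.mul_le_mul_left _ (Nat.le_self_pow (by omega) M)
    have a4 : M * (K * M ^ e) = K * M ^ (e + 1) := by ring
    simp only [bound, Nat.add_mul, Nat.mul_add]
    rw [mul_assoc]
    omega
  | call n s t A W O =>
    refine ⟨n.cost + s.cost + t.cost + 1 + h + 1 + 1, 2, fun M hM => ?_⟩
    have a2 : M ≤ M ^ 2 := Nat.le_self_pow (by omega) M
    have a3 := Nat.le_mul_of_pos_right (n.cost + s.cost + t.cost + 1) (Nat.pow_pos (n := 2) hM)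
    have a4 := Nat.mul_le_mul_left h a2
    simp only [bound, Nat.add_mul] at *
    nlinarith

theorem Cmd.one_le_bound (h M T : ℕ) (c : Cmd) : 1 ≤ c.bound h M T := by
  have hb : ∀ b : BExp, 1 ≤ b.cost := fun b => by cases b <;> simp [BExp.cost]
  induction c <;> simp only [bound] <;> first | omega | (rename_i b _ _; have := hb b; omega)

/-- A call contributes `T` on top of an overhead of at least 1, so its cost is at most `T + 1` times
its own steps; this passes through sequencing, branching and loops. -/
theorem Cmd.bound_le_mul (h M T : ℕ) (c : Cmd) :
    c.bound h M T ≤ c.bound h M 0 * (T + 1) := by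
  induction c with
  | skip => simp [bound]
  | setN => exact Nat.le_mul_of_pos_right _ (by omega)
  | setR => exact Nat.le_mul_of_pos_right _ (by omega)
  | seq c d hc hd => simp only [bound, Nat.add_mul]; omega
  | ite b c d hc hd =>
    have := Nat.le_mul_of_pos_right b.cost (show 0 < T + 1 by omega)
    simp only [bound, Nat.add_mul b.cost]
    rw [Nat.add_mul (bound _ _ _ _)]
    omega
  | loop b c hc =>
    have := Nat.le_mul_of_pos_right b.cost (show 0 < T + 1 by omega)
    have a1 : M * (b.cost + c.bound h M T) ≤ M * ((b.cost + c.bound h M 0) * (T + 1)) := by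
      apply Nat.mul_le_mul_left
      rw [Nat.add_mul b.cost]
      omega
    simp only [bound]
    rw [Nat.add_mul (M * _), mul_assoc]
    omega
  | call n s t A W O =>
    simp only [bound]
    have := Nat.mul_le_mul_right T
      (show 1 ≤ n.cost + s.cost + t.cost + M * M + M * h + M + 1 + 0 by omega)
    rw [Nat.mul_add (n.cost + s.cost + t.cost + M * M + M * h + M + 1 + 0)]
    omega

end MPHC


namespace MPHC

/-! ### Evaluation of first-order conditions -/

/-- Conditions with bounded quantifiers; the bound variables are scalar variables of the machine. -/
inductive Fm where
  | tst (b : BExp)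
  | neg (F : Fm)
  | conj (F G : Fm)
  | all (x : ℕ) (e : NExp) (F : Fm)

namespace Fm

def disj (F G : Fm) : Fm := neg (conj (neg F) (neg G))
def imp (F G : Fm) : Fm := neg (conj F (neg G))
def ex (x : ℕ) (e : NExp) (F : Fm) : Fm := neg (all x e (neg F))
def eqN (e f : NExp) : Fm := tst (.and (.leN e f) (.leN f e))

def holds (σ : Store) : Fm → Prop
  | tst b => b.holds σ
  | neg F => ¬ F.holds σ
  | conj F G => F.holds σ ∧ G.holds σ
  | all x e F => ∀ i < e.eval σ, F.holds (σ.updN x 0 0 i)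

theorem holds_disj {σ : Store} {F G : Fm} : (disj F G).holds σ ↔ F.holds σ ∨ G.holds σ := by
  simp only [disj, holds]; tauto

theorem holds_imp {σ : Store} {F G : Fm} : (imp F G).holds σ ↔ (F.holds σ → G.holds σ) := by
  simp only [imp, holds]; tauto

theorem holds_ex {σ : Store} {x : ℕ} {e : NExp} {F : Fm} :
    (ex x e F).holds σ ↔ ∃ i < e.eval σ, F.holds (σ.updN x 0 0 i) := by
  simp only [ex, holds]; push Not; rfl

theorem holds_eqN {σ : Store} {e f : NExp} : (eqN e f).holds σ ↔ e.eval σ = f.eval σ := by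
  simp only [eqN, holds, BExp.holds]; omega

/-- The arrays read by the condition, bound variables included. -/
def reads : Fm → List ℕ
  | tst b => b.reads
  | neg F => F.reads
  | conj F G => F.reads ++ G.reads
  | all x e F => e.reads ++ F.reads.filter (· != x)

/-- The arrays read by the bounds of the quantifiers. -/
def ranges : Fm → List ℕ
  | tst _ => []
  | neg F => F.ranges
  | conj F G => F.ranges ++ G.ranges
  | all _ e F => e.reads ++ F.ranges

/-- Evaluation of the condition, with the truth value put in the scalar variable `f`; the
variables from `f` on serve as work space. -/
def compile : Fm → ℕ → Cmd
  | tst b, f => .ite b (.setV f (.const 1)) (.setV f (.const 0))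
  | neg F, f => .seq (F.compile f) (.setV f (.sub (.const 1) (.var f)))
  | conj F G, f => .seq (F.compile f)
      (.ite (.leN (.const 1) (.var f)) (G.compile f) .skip)
  | all x e F, f => .seq (.setV f (.const 1)) (.forC x e (.seq (F.compile (f + 1))
      (.ite (.leN (.const 1) (.var (f + 1))) .skip (.setV f (.const 0)))))

/-- The variables used during the evaluation do not interfere with each other. -/
def wf : Fm → ℕ → Bool
  | tst _, _ => true
  | neg F, f => F.wf f
  | conj F G, f => F.wf f && G.wf f && MPHC.disj (G.reads ++ G.ranges) (F.compile f).modN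
  | all x e F, f => F.wf (f + 1) &&
      MPHC.disj [x, f] ((F.compile (f + 1)).modN) && MPHC.disj [x] [f, f + 1] &&
      MPHC.disj (e.reads ++ F.ranges) (x :: f :: (F.compile (f + 1)).modN) &&
      MPHC.disj (F.reads.filter (· != x)) (f :: (F.compile (f + 1)).modN)

/-- All quantifiers range over at most `M` numbers. -/
def bdd (M : ℕ) (σ : Store) : Fm → Prop
  | tst _ => True
  | neg F => F.bdd M σ
  | conj F G => F.bdd M σ ∧ G.bdd M σ
  | all _ e F => e.eval σ ≤ M ∧ F.bdd M σ

theorem bdd_congr {M : ℕ} {F : Fm} {σ τ : Store} (h : ∀ a ∈ F.ranges, σ.nat a = τ.nat a)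
    (hb : F.bdd M σ) : F.bdd M τ := by
  induction F with
  | tst b => trivial
  | neg F hF => exact hF h hb
  | conj F G hF hG =>
    exact ⟨hF (fun a ha => h a (List.mem_append_left _ ha)) hb.1,
      hG (fun a ha => h a (List.mem_append_right _ ha)) hb.2⟩
  | all x e F hF =>
    refine ⟨?_, hF (fun a ha => h a (List.mem_append_right _ ha)) hb.2⟩
    rw [← NExp.eval_congr fun a ha => h a (List.mem_append_left _ ha)]
    exact hb.1

/-- The memories agree on the arrays in `l`, and elsewhere up to scalar variables. -/
def Agree (l : List ℕ) (σ τ : Store) : Prop :=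
  (∀ a u v, a ∈ l ∨ ¬ (u = 0 ∧ v = 0) → σ.nat a u v = τ.nat a u v) ∧ σ.real = τ.real

theorem Agree.mono {l m : List ℕ} {σ τ : Store} (h : Agree l σ τ) (hm : ∀ a ∈ m, a ∈ l) :
    Agree m σ τ :=
  ⟨fun a u v hauv => h.1 a u v (hauv.imp_left (hm a)), h.2⟩

theorem Agree.nat_eq {l : List ℕ} {σ τ : Store} (h : Agree l σ τ) {a : ℕ} (ha : a ∈ l) :
    σ.nat a = τ.nat a := by
  funext u v
  exact h.1 a u v (.inl ha)

/-- A quantifier overwrites only entry `(0, 0)` of the array of its variable. That array is dropped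
from `reads` as a whole, so `Agree` must still demand equality of all its other entries. -/
theorem holds_congr {F : Fm} {σ τ : Store} (h : Agree F.reads σ τ) : F.holds σ ↔ F.holds τ := by
  induction F generalizing σ τ with
  | tst b => exact BExp.holds_congr (fun a ha => h.nat_eq ha) h.2
  | neg F hF => simp only [holds, hF h]
  | conj F G hF hG =>
    simp only [holds, hF (h.mono fun a ha => List.mem_append_left _ ha),
      hG (h.mono fun a ha => List.mem_append_right _ ha)]
  | all x e F hF =>
    simp only [holds, NExp.eval_congr fun a ha => h.nat_eq (List.mem_append_left _ ha)]
    refine forall₂_congr fun i _ => hF ⟨fun a u v hauv => ?_, h.2⟩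
    simp only [Store.updN]
    split_ifs with hc
    · rfl
    · refine h.1 a u v ?_
      by_cases hz : u = 0 ∧ v = 0
      · refine .inl (List.mem_append_right _ (List.mem_filter.2 ⟨hauv.resolve_right (by simp [hz]), ?_⟩))
        simp only [bne_iff_ne, ne_eq]
        tauto
      · exact .inr hz

theorem compile_modR (F : Fm) (f : ℕ) : (F.compile f).modR = [] := by
  induction F generalizing f with
  | tst => rfl
  | neg F hF => simp [compile, Cmd.modR, hF]
  | conj F G hF hG => simp [compile, Cmd.modR, hF, hG]
  | all x e F hF => simp [compile, Cmd.modR, Cmd.forC, hF]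

theorem Agree.of_frame {F : Fm} {c : Cmd} {σ τ : Store} (hd : MPHC.disj F.reads c.modN = true)
    (hf : Frame c σ τ) (hR : c.modR = [])
    (h0 : ∀ a u v, ¬ (u = 0 ∧ v = 0) → τ.nat a u v = σ.nat a u v) : Agree F.reads τ σ :=
  ⟨fun a u v h => h.elim (fun ha => by rw [hf.1 a (not_mem_of_disj hd ha)]) (h0 a u v),
    funext fun a => hf.2 a (by simp [hR])⟩

theorem disj_left {l m k : List ℕ} (h : MPHC.disj (l ++ m) k = true) :
    MPHC.disj l k = true := by
  simp only [MPHC.disj, List.all_append, Bool.and_eq_true] at h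
  exact h.1

theorem disj_right {l m k : List ℕ} (h : MPHC.disj (l ++ m) k = true) :
    MPHC.disj m k = true := by
  simp only [MPHC.disj, List.all_append, Bool.and_eq_true] at h
  exact h.2

-- The second conclusion is what makes the induction close: evaluation disturbs scalar entries only.
-- Together with the disjointness in `wf` it gives `Agree`, so later conjuncts and iterations are
-- evaluated in a memory equivalent to the initial one.
open Classical in
theorem compile_ok {E : Env} {F : Fm} {f : ℕ} {σ : Store} (hwf : F.wf f = true)
    (hb : F.bdd E.iter σ) : Ok E (F.compile f) σ fun σ' =>
      σ'.nat f 0 0 = (if F.holds σ then 1 else 0) ∧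
      ∀ a u v, ¬ (u = 0 ∧ v = 0) → σ'.nat a u v = σ.nat a u v := by
  have hupd : ∀ (σ : Store) x k a u v, ¬ (u = 0 ∧ v = 0) →
      (σ.updN x 0 0 k).nat a u v = σ.nat a u v := by
    intro σ x k a u v h
    simp only [Store.updN]
    rw [if_neg]
    tauto
  induction F generalizing f σ with
  | tst b =>
    refine Ok.ite (fun h => Ok.setN ?_) (fun h => Ok.setN ?_)
    · exact ⟨by simp [NExp.eval, holds, h], fun a u v => hupd _ _ _ a u v⟩
    · exact ⟨by simp [NExp.eval, holds, h], fun a u v => hupd _ _ _ a u v⟩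
  | neg F hF =>
    refine Ok.seq ((hF hwf hb).mono ?_)
    rintro τ ⟨h1, h2⟩
    refine Ok.setN ⟨?_, fun a u v h => (hupd _ _ _ a u v h).trans (h2 a u v h)⟩
    simp only [NExp.eval, updN_same, h1, holds]
    split_ifs <;> simp_all
  | conj F G hF hG =>
    simp only [wf, Bool.and_eq_true] at hwf
    refine Ok.seq ((hF hwf.1.1 hb.1).frame.mono ?_)
    rintro τ ⟨hfr, h1, h2⟩
    have hag : ∀ G' : Fm, MPHC.disj G'.reads (F.compile f).modN = true → Agree G'.reads τ σ :=
      fun G' h => Agree.of_frame h hfr (compile_modR F f) h2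
    refine Ok.ite (fun h => ?_) (fun h => Ok.skip ⟨?_, h2⟩)
    · have hbG : G.bdd E.iter τ := 
        bdd_congr (fun a ha => (hfr.1 a (not_mem_of_disj (disj_right hwf.2) ha)).symm) hb.2
      refine (hG hwf.1.2 hbG).mono ?_
      rintro τ' ⟨h3, h4⟩
      refine ⟨?_, fun a u v h => (h4 a u v h).trans (h2 a u v h)⟩
      have hFh : F.holds σ := by
        by_contra hc
        simp [BExp.holds, NExp.eval, h1, hc] at h
      simp only [h3, holds, holds_congr (hag G (disj_left hwf.2)), hFh, true_and]
    · have hFh : ¬ F.holds σ := by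
        intro hc
        simp [BExp.holds, NExp.eval, h1, hc] at h
      simp [h1, hFh, holds]
  | all x e F hF =>
    simp only [wf, Bool.and_eq_true] at hwf
    obtain ⟨⟨⟨⟨w1, w2⟩, w3⟩, w4⟩, w5⟩ := hwf
    have hxf : x ≠ f ∧ x ≠ f + 1 := by simpa [MPHC.disj] using w3
    have hxm := not_mem_of_disj w2 (a := x) (by simp)
    have hfm := not_mem_of_disj w2 (a := f) (by simp)
    refine Ok.seq (Ok.setN ?_)
    simp only [NExp.eval]
    have hev : e.eval (σ.updN f 0 0 1) = e.eval σ := NExp.eval_congr fun a ha =>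
      updN_nat fun h => not_mem_of_disj (disj_left w4) ha (by simp [h])
    refine (Ok.forC hev hb.1 ?_ ?_ (fun k τ =>
      τ.nat f 0 0 = (if ∀ i < k, F.holds (σ.updN x 0 0 i) then 1 else 0) ∧
      ∀ a u v, ¬ (u = 0 ∧ v = 0) → τ.nat a u v = σ.nat a u v) ?_ ?_).mono ?_
    · have : x ∉ (F.compile (f + 1)).modN := hxm
      simp only [MPHC.disj, Cmd.modN, List.nil_append, List.all_cons, List.all_nil,
        List.all_append, Bool.and_true, Bool.and_eq_true, List.all_eq_true, bne_iff_ne]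
      exact ⟨fun a ha h => this (h ▸ ha), hxf.1⟩
    · have := disj_left w4
      simp only [MPHC.disj, List.all_eq_true, bne_iff_ne, Cmd.modN, List.mem_cons,
        List.mem_append] at this ⊢
      intro a ha b hb
      refine this a ha b ?_
      simp only [List.not_mem_nil, or_false, false_or] at hb
      tauto
    · refine ⟨?_, fun a u v h => (hupd _ _ _ a u v h).trans (hupd _ _ _ a u v h)⟩
      rw [updN_nat (Ne.symm hxf.1)]
      simp
    · rintro i τ hi hτx hN hR ⟨hf, h0⟩
      have hN' : ∀ a, a ≠ x → a ≠ f → a ∉ (F.compile (f + 1)).modN → τ.nat a = σ.nat a := by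
        intro a h1 h2 h3
        rw [hN a (by simp [Cmd.modN, h1, h2, h3]), updN_nat h2]
      have hbτ : F.bdd E.iter τ := bdd_congr (fun a ha => by
        have := not_mem_of_disj (disj_right w4) ha
        simp only [List.mem_cons, not_or] at this
        exact (hN' a this.1 this.2.1 this.2.2).symm) hb.2
      have hRτ : τ.real = σ.real := funext fun a => by
        rw [hR a (by simp [Cmd.modR, compile_modR])]; rfl
      have hag : Agree F.reads τ (σ.updN x 0 0 i) := by
        refine ⟨fun a u v h => ?_, hRτ⟩
        by_cases hz : u = 0 ∧ v = 0
        · obtain ⟨rfl, rfl⟩ := hz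
          by_cases hax : a = x
          · subst hax; simp [hτx]
          · have := not_mem_of_disj w5 (a := a) (by simpa [hax] using h)
            simp only [List.mem_cons, not_or] at this
            rw [hN' a hax this.1 this.2, updN_nat hax]
        · rw [h0 a u v hz, hupd _ _ _ a u v hz]
      refine Ok.seq ((hF w1 hbτ).frame.mono ?_)
      rintro τ₁ ⟨hfr, h1, h2⟩
      have hcongr := holds_congr hag
      have hf1 : τ₁.nat f 0 0 = τ.nat f 0 0 := by rw [hfr.1 f hfm]
      have hall : (∀ j < i + 1, F.holds (σ.updN x 0 0 j)) ↔
          (∀ j < i, F.holds (σ.updN x 0 0 j)) ∧ F.holds (σ.updN x 0 0 i) := by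
        simp only [Nat.lt_succ_iff_lt_or_eq, or_imp, forall_and, forall_eq]
      refine Ok.ite (fun h => Ok.skip ⟨?_, ?_⟩) (fun h => Ok.setN ⟨?_, ?_⟩)
      · have hh : F.holds τ := by
          by_contra hc
          simp [BExp.holds, NExp.eval, h1, hc] at h
        rw [updN_nat (Ne.symm hxf.1), hf1, hf]
        simp only [hall, ← hcongr, hh, and_true]
      · exact fun a u v hz => ((hupd _ _ _ a u v hz).trans (h2 a u v hz)).trans (h0 a u v hz)
      · have hh : ¬ F.holds τ := by
          intro hc
          simp [BExp.holds, NExp.eval, h1, hc] at h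
        rw [updN_nat (Ne.symm hxf.1)]
        rw [if_neg fun hc => hh (hcongr.2 (hall.1 hc).2)]
        simp [NExp.eval]
      · exact fun a u v hz => (((hupd _ _ _ a u v hz).trans (hupd _ _ _ a u v hz)).trans
          (h2 a u v hz)).trans (h0 a u v hz)
    · rintro σ' ⟨h, h'⟩
      refine ⟨?_, h'⟩
      rw [h]
      exact if_congr Iff.rfl rfl rfl

/-- `if F then c else d`, where the condition is evaluated with work space from `f` on. -/
def ite (f : ℕ) (F : Fm) (c d : Cmd) : Cmd :=
  .seq (F.compile f) (.ite (.leN (.const 1) (.var f)) c d)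

theorem ite_ok {E : Env} {F : Fm} {f : ℕ} {σ : Store} {c d : Cmd} {Q : Store → Prop}
    (hwf : F.wf f = true) (hb : F.bdd E.iter σ)
    (hc : ∀ τ, F.holds σ → Frame (F.compile f) σ τ → Ok E c τ Q)
    (hd : ∀ τ, ¬ F.holds σ → Frame (F.compile f) σ τ → Ok E d τ Q) : Ok E (F.ite f c d) σ Q := by
  refine Ok.seq ((compile_ok hwf hb).frame.mono ?_)
  rintro τ ⟨hfr, h1, -⟩
  refine Ok.ite (fun h => hc τ ?_ hfr) (fun h => hd τ ?_ hfr)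
  · by_contra hc
    simp [BExp.holds, NExp.eval, h1, hc] at h
  · intro hc
    simp [BExp.holds, NExp.eval, h1, hc] at h

end Fm
end MPHC


namespace MPHC

/-! ### Graph theory -/

section graph

variable {V : Type*} {G : SimpleGraph V}

/-- The Erdős–Szekeres argument: fix `v` in `T`. By Pascal's rule, either the neighbours or the
non-neighbours of `v` are numerous enough for the induction, and `v` is added to the set found
there. -/
theorem exists_clique_or_indep [DecidableEq V] (G : SimpleGraph V) (a b : ℕ) (T : Finset V)
    (hT : (a + b).choose a ≤ T.card) :
    (∃ S ⊆ T, S.card = a + 1 ∧ ∀ x ∈ S, ∀ y ∈ S, x ≠ y → G.Adj x y) ∨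
      ∃ S ⊆ T, S.card = b + 1 ∧ ∀ x ∈ S, ∀ y ∈ S, ¬ G.Adj x y := by
  classical
  induction hn : a + b generalizing a b T with
  | zero =>
    obtain ⟨rfl, rfl⟩ : a = 0 ∧ b = 0 := by omega
    obtain ⟨v, hv⟩ : T.Nonempty := Finset.card_pos.1 (by simpa using hT)
    exact .inl ⟨{v}, by simpa using hv, by simp, by simp⟩
  | succ n ih =>
    have hne : T.Nonempty := by
      refine Finset.card_pos.1 (lt_of_lt_of_le (Nat.choose_pos (Nat.le_add_right a b)) hT)
    obtain ⟨v, hv⟩ := hne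
    rcases a with _ | a
    · exact .inl ⟨{v}, by simpa using hv, by simp, by simp⟩
    rcases b with _ | b
    · exact .inr ⟨{v}, by simpa using hv, by simp, by simp⟩
    have hsplit : ((T.erase v).filter (G.Adj v)).card +
        ((T.erase v).filter (fun x => ¬ G.Adj v x)).card + 1 = T.card := by
      rw [Finset.card_filter_add_card_filter_not, Finset.card_erase_add_one hv]
    have hch : (a + 1 + (b + 1)).choose (a + 1) =
        (a + (b + 1)).choose a + (a + 1 + b).choose (a + 1) := by
      rw [show a + 1 + (b + 1) = (a + b + 1) + 1 by ring, Nat.choose_succ_succ,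
        show a + (b + 1) = a + b + 1 by ring, show a + 1 + b = a + b + 1 by ring]
    rcases Nat.lt_or_ge ((T.erase v).filter (G.Adj v)).card ((a + (b + 1)).choose a) with h | h
    · have h2 : (a + 1 + b).choose (a + 1) ≤
          ((T.erase v).filter (fun x => ¬ G.Adj v x)).card := by omega
      rcases ih (a + 1) b _ h2 (by omega) with ⟨S, h3, h4, h5⟩ | ⟨S, h3, h4, h5⟩
      · exact .inl ⟨S, fun x hx => Finset.mem_of_mem_erase (Finset.mem_filter.1 (h3 hx)).1, h4, h5⟩
      · have hvS : v ∉ S := fun hx => by simpa using h3 hx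
        refine .inr ⟨insert v S, ?_, by rw [Finset.card_insert_of_notMem hvS, h4], ?_⟩
        · intro x hx
          rcases Finset.mem_insert.1 hx with rfl | hx
          · exact hv
          · exact Finset.mem_of_mem_erase (Finset.mem_filter.1 (h3 hx)).1
        · have hn : ∀ y ∈ S, ¬ G.Adj v y := fun y hy => (Finset.mem_filter.1 (h3 hy)).2
          intro x hx y hy
          rcases Finset.mem_insert.1 hx with hx' | hx' <;> rcases Finset.mem_insert.1 hy with hy' | hy'
          · rw [hx', hy']; exact G.irrefl
          · rw [hx']; exact hn y hy'
          · rw [hy']; exact fun h => hn x hx' h.symm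
          · exact h5 x hx' y hy'
    · rcases ih a (b + 1) _ h (by omega) with ⟨S, h3, h4, h5⟩ | ⟨S, h3, h4, h5⟩
      · have hvS : v ∉ S := fun hx => by simpa using h3 hx
        refine .inl ⟨insert v S, ?_, by rw [Finset.card_insert_of_notMem hvS, h4], ?_⟩
        · intro x hx
          rcases Finset.mem_insert.1 hx with rfl | hx
          · exact hv
          · exact Finset.mem_of_mem_erase (Finset.mem_filter.1 (h3 hx)).1
        · have hn : ∀ y ∈ S, G.Adj v y := fun y hy => (Finset.mem_filter.1 (h3 hy)).2
          intro x hx y hy hxy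
          rcases Finset.mem_insert.1 hx with hx' | hx' <;> rcases Finset.mem_insert.1 hy with hy' | hy'
          · exact absurd (hx'.trans hy'.symm) hxy
          · rw [hx']; exact hn y hy'
          · rw [hy']; exact (hn x hx').symm
          · exact h5 x hx' y hy' hxy
      · exact .inr ⟨S, fun x hx => Finset.mem_of_mem_erase (Finset.mem_filter.1 (h3 hx)).1, h4, h5⟩

/-- A vertex `u`, independent neighbours `e i` of `u` and private neighbours `q i` of these outside
the neighbourhood of `u` induce the graph `F`, which may be `S_m` or `L_m`. -/
theorem isIndContained_of_private {m : ℕ} {F : SimpleGraph (Unit ⊕ Fin m ⊕ Fin m)} {u : V}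
    {e q : Fin m → V} (he : Function.Injective e) (hu : ∀ i, G.Adj u (e i))
    (hee : ∀ i j, ¬ G.Adj (e i) (e j)) (heq : ∀ i j, G.Adj (e i) (q j) ↔ i = j)
    (huq : ∀ j, ¬ G.Adj u (q j)) (hne : ∀ j, q j ≠ u)
    (F1 : ∀ i, F.Adj (.inl ()) (.inr (.inl i))) (F2 : ∀ i, ¬ F.Adj (.inl ()) (.inr (.inr i)))
    (F3 : ∀ i j, ¬ F.Adj (.inr (.inl i)) (.inr (.inl j)))
    (F4 : ∀ i j, F.Adj (.inr (.inl i)) (.inr (.inr j)) ↔ i = j)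
    (F5 : ∀ i j, F.Adj (.inr (.inr i)) (.inr (.inr j)) ↔ G.Adj (q i) (q j)) :
    F.IsIndContained G := by
  have hqe : ∀ i j, q i ≠ e j := fun i j h => huq i (h ▸ hu j)
  have hq : Function.Injective q := fun i j h => (heq i j).1 (h ▸ (heq i i).2 rfl)
  set f : Unit ⊕ Fin m ⊕ Fin m → V := Sum.elim (fun _ => u) (Sum.elim e q) with hf
  have hinj : Function.Injective f := by
    rintro (_ | i | i) (_ | j | j) h
    · rfl
    · exact absurd h (hu j).ne
    · exact absurd h.symm (hne j)
    · exact absurd h (hu i).ne'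
    · exact congrArg (fun x => Sum.inr (Sum.inl x)) (he h)
    · exact absurd h.symm (hqe j i)
    · exact absurd h (hne i)
    · exact absurd h (hqe i j)
    · exact congrArg (fun x => Sum.inr (Sum.inr x)) (hq h)
  have hadj : ∀ x y, G.Adj (f x) (f y) ↔ F.Adj x y := by
    rintro (⟨⟩ | i | i) (⟨⟩ | j | j)
    · simp
    · simp [hf, hu, F1]
    · simp [hf, huq, F2]
    · simp [hf, (hu i).symm, (F1 i).symm]
    · simp [hf, hee, F3]
    · simp [hf, heq, F4]
    · exact iff_of_false (fun h => huq i h.symm) (fun h => F2 i h.symm)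
    · have := F4 j i
      rw [F.adj_comm] at this
      have h2 := heq j i
      rw [G.adj_comm] at h2
      simp [hf, h2, this]
    · simp [hf, F5]
  exact ⟨⟨⟨f, hinj⟩, hadj _ _⟩⟩

theorem one_le_ramsey {s t : ℕ} (ht : 1 ≤ t) : 1 ≤ ramsey s t :=
  Nat.choose_pos (by omega)

/-- The neighbourhood of an independent set `I` of neighbours of `u` outside of the neighbourhood
of `u` is the neighbourhood of a small subset of `I`. -/
theorem exists_small_cover [DecidableEq V] {s t : ℕ} (hs : 1 ≤ s) (ht : 1 ≤ t)
    (hL : IndFree (graphL s) G) (hS : IndFree (graphS t) G) (u : V) (I T : Finset V)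
    (hI : ∀ v ∈ I, G.Adj u v) (hind : ∀ v ∈ I, ∀ w ∈ I, ¬ G.Adj v w)
    (hT : ∀ w ∈ T, ¬ G.Adj u w) :
    ∃ D ⊆ I, D.card ≤ ramsey s t ∧ ∀ w ∈ T, (∃ v ∈ I, G.Adj v w) → ∃ v ∈ D, G.Adj v w := by
  classical
  obtain ⟨D, hD, hmin⟩ := Finset.exists_min_image
    (I.powerset.filter fun D => ∀ w ∈ T, (∃ v ∈ I, G.Adj v w) → ∃ v ∈ D, G.Adj v w) Finset.card
    ⟨I, by simpa using fun w _ v hv hvw => ⟨v, hv, hvw⟩⟩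
  simp only [Finset.mem_filter, Finset.mem_powerset] at hD hmin
  refine ⟨D, hD.1, ?_, hD.2⟩
  by_contra hcard
  -- By minimality, removing `d` uncovers a vertex; that vertex is a private neighbour of `d`.
  have hpriv : ∀ d ∈ D, ∃ w ∈ T, G.Adj d w ∧ ∀ v ∈ D, G.Adj v w → v = d := by
    intro d hd
    by_contra hc
    push Not at hc
    have := hmin (D.erase d) ⟨(Finset.erase_subset d D).trans hD.1, fun w hw hI' => by
      obtain ⟨v, hv, hvw⟩ := hD.2 w hw hI'
      by_cases hvd : v = d
      · subst hvd
        obtain ⟨v', h1, h2, h3⟩ := hc w hw hvw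
        exact ⟨v', by simp [h1, h3], h2⟩
      · exact ⟨v, by simp [hv, hvd], hvw⟩⟩
    have h2 := Finset.card_erase_lt_of_mem hd
    omega
  choose! q hqT hq1 hq2 using hpriv
  have h1R := one_le_ramsey (s := s) ht
  -- The vertex `u` is adjacent to all of `D`, which has at least two members, so it is private to
  -- none.
  have hqu : ∀ d ∈ D, q d ≠ u := by
    intro d hd h
    obtain ⟨d', hd', hne⟩ := Finset.exists_mem_ne (show 1 < D.card by omega) d
    exact hne (hq2 d hd d' hd' (h ▸ (hI d' (hD.1 hd')).symm))
  have hR : (s - 1 + (t - 1)).choose (s - 1) ≤ D.card := by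
    rw [show s - 1 + (t - 1) = s + t - 2 by omega]
    exact (not_le.1 hcard).le
  -- Ramsey's theorem for the private neighbours, pulled back to `D`: a clique of them gives `L_s`,
  -- an independent set gives `S_t`.
  rcases exists_clique_or_indep (G.comap q) (s - 1) (t - 1) D hR with
    ⟨S, h1, h2, h3⟩ | ⟨S, h1, h2, h3⟩
  · obtain ⟨e⟩ : Nonempty (Fin s ≃ S) := ⟨(Finset.equivFinOfCardEq (by omega)).symm⟩
    have heD : ∀ i, (e i : V) ∈ D := fun i => h1 (e i).2
    refine hL (isIndContained_of_private (u := u) (e := fun i => e i) (q := fun i => q (e i))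
      (Subtype.val_injective.comp e.injective) (fun i => hI _ (hD.1 (heD i)))
      (fun i j => hind _ (hD.1 (heD i)) _ (hD.1 (heD j))) (fun i j => ⟨fun h => ?_, ?_⟩)
      (fun j => hT _ (hqT _ (heD j))) (fun j => hqu _ (heD j)) ?_ ?_ ?_ ?_ ?_)
    · exact e.injective (Subtype.ext (hq2 _ (heD j) _ (heD i) h))
    · rintro rfl; exact hq1 _ (heD i)
    · simp [graphL, graphS]
    · simp [graphL, graphS]
    · simp [graphL, graphS]
    · simp [graphL, graphS]
    · intro i j
      by_cases hij : i = j
      · subst hij; simp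
      · have := h3 _ (e i).2 _ (e j).2 (fun h => hij (e.injective (Subtype.ext h)))
        simp only [SimpleGraph.comap_adj] at this
        simp [graphL, graphS, hij, this]
  · obtain ⟨e⟩ : Nonempty (Fin t ≃ S) := ⟨(Finset.equivFinOfCardEq (by omega)).symm⟩
    have heD : ∀ i, (e i : V) ∈ D := fun i => h1 (e i).2
    refine hS (isIndContained_of_private (u := u) (e := fun i => e i) (q := fun i => q (e i))
      (Subtype.val_injective.comp e.injective) (fun i => hI _ (hD.1 (heD i)))
      (fun i j => hind _ (hD.1 (heD i)) _ (hD.1 (heD j))) (fun i j => ⟨fun h => ?_, ?_⟩)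
      (fun j => hT _ (hqT _ (heD j))) (fun j => hqu _ (heD j)) ?_ ?_ ?_ ?_ ?_)
    · exact e.injective (Subtype.ext (hq2 _ (heD j) _ (heD i) h))
    · rintro rfl; exact hq1 _ (heD i)
    · simp [graphS]
    · simp [graphS]
    · simp [graphS]
    · simp [graphS]
    · intro i j
      have := h3 _ (e i).2 _ (e j).2
      simp only [SimpleGraph.comap_adj] at this
      simp [graphS, this]

/-! ### Domination in `P_6`-free graphs -/

/-- Injectivity of `f` comes for free: no two vertices of a path on six vertices have the same
neighbourhood. -/
theorem pathGraph_six_isIndContained {f : Fin 6 → V}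
    (hf : ∀ i j, i < j → (G.Adj (f i) (f j) ↔ i.val + 1 = j.val)) :
    (SimpleGraph.pathGraph 6).IsIndContained G := by
  have key : ∀ i j, (G.Adj (f i) (f j) ↔ i.val + 1 = j.val ∨ j.val + 1 = i.val) := by
    intro i j
    rcases lt_trichotomy i j with h | h | h
    · rw [hf i j h]; omega
    · subst h; simp
    · rw [G.adj_comm, hf j i h]; omega
  have rows : ∀ i j : Fin 6, (∀ k : Fin 6, (i.val + 1 = k.val ∨ k.val + 1 = i.val) ↔
      (j.val + 1 = k.val ∨ k.val + 1 = j.val)) → i = j := by decide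
  refine ⟨⟨⟨f, fun i j h => rows i j fun k => ?_⟩, fun {i j} => ?_⟩⟩
  · rw [← key, ← key, h]
  · rw [SimpleGraph.pathGraph_adj]
    exact key i j

theorem no_induced_path_six (hP : IndFree (SimpleGraph.pathGraph 6) G) {a b c d e f : V}
    (hab : G.Adj a b) (hbc : G.Adj b c) (hcd : G.Adj c d) (hde : G.Adj d e) (hef : G.Adj e f)
    (hac : ¬ G.Adj a c) (had : ¬ G.Adj a d) (hae : ¬ G.Adj a e) (haf : ¬ G.Adj a f)
    (hbd : ¬ G.Adj b d) (hbe : ¬ G.Adj b e) (hbf : ¬ G.Adj b f) (hce : ¬ G.Adj c e)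
    (hcf : ¬ G.Adj c f) (hdf : ¬ G.Adj d f) : False := by
  refine hP (pathGraph_six_isIndContained (f := ![a, b, c, d, e, f]) fun i j hij => ?_)
  fin_cases i <;> fin_cases j <;> first | (exfalso; revert hij; decide) | simp_all

/-- `b` can be reached from `a` by a walk whose vertices after `a` belong to `Z`. -/
def Conn (G : SimpleGraph V) (Z : Set V) (a b : V) : Prop :=
  Relation.ReflTransGen (fun x y => G.Adj x y ∧ y ∈ Z) a b

theorem Conn.mem {Z : Set V} {a b : V} (h : Conn G Z a b) (ha : a ∈ Z) : b ∈ Z := by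
  induction h with
  | refl => exact ha
  | tail _ h _ => exact h.2

theorem Conn.symm {Z : Set V} {a b : V} (h : Conn G Z a b) (ha : a ∈ Z) : Conn G Z b a := by
  induction h with
  | refl => exact .refl
  | tail h1 h2 ih => exact .head ⟨h2.1.symm, Conn.mem h1 ha⟩ ih

theorem Conn.mono {Z Z' : Set V} {a b : V} (h : Conn G Z a b) (hZ : Z ⊆ Z') : Conn G Z' a b :=
  Relation.ReflTransGen.mono (fun _ _ h => ⟨h.1, hZ h.2⟩) _ _ h

theorem Conn.trans {Z : Set V} {a b c : V} (h : Conn G Z a b) (h' : Conn G Z b c) :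
    Conn G Z a c := Relation.ReflTransGen.trans h h'

theorem Conn.of_adj {Z : Set V} {a b x y : V} (ha : Conn G Z a x) (hb : Conn G Z b y) (hbZ : b ∈ Z)
    (h : G.Adj x y) : Conn G Z a b :=
  (Relation.ReflTransGen.tail ha ⟨h, hb.mem hbZ⟩).trans (hb.symm hbZ)

/-- A vertex with a neighbour and a non-neighbour in a component distinguishes the ends of
an edge of this component. -/
theorem exists_mixed_edge {Z : Set V} {a b c x : V} (ha : a ∈ Z) (hb : Conn G Z a b)
    (hc : Conn G Z a c) (hxb : G.Adj x b) (hxc : ¬ G.Adj x c) :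
    ∃ y y', Conn G Z a y ∧ Conn G Z a y' ∧ G.Adj x y ∧ ¬ G.Adj x y' ∧ G.Adj y y' := by
  have hbc : Conn G Z b c := (hb.symm ha).trans hc
  induction hbc with
  | refl => exact absurd hxb hxc
  | @tail y y' h1 h2 ih =>
    by_cases hxy : G.Adj x y
    · exact ⟨y, y', hb.trans h1, (hb.trans h1).tail h2, hxy, hxc, h2.1⟩
    · exact ih (hb.trans h1) hxy

/-- A component of `Z` that is left by a walk in `Z'` has a neighbour in `Z'` outside of `Z`. -/
theorem exists_attachment {Z Z' : Set V} {a b : V} (ha : a ∈ Z) (hb : Conn G Z' a b)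
    (hbZ : b ∉ Z) : ∃ y q, Conn G Z' a y ∧ y ∈ Z' ∧ y ∉ Z ∧ Conn G Z a q ∧ G.Adj y q := by
  suffices h : Conn G Z a b ∨
      ∃ y q, Conn G Z' a y ∧ y ∈ Z' ∧ y ∉ Z ∧ Conn G Z a q ∧ G.Adj y q from
    h.resolve_left fun h => hbZ (h.mem ha)
  clear hbZ
  induction hb with
  | refl => exact .inl .refl
  | @tail y y' h1 h2 ih =>
    rcases ih with h | h
    · by_cases hy : y' ∈ Z
      · exact .inl (h.tail ⟨h2.1, hy⟩)
      · exact .inr ⟨y', y, h1.tail h2, h2.2, hy, h, h2.1.symm⟩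
    · exact .inr h

/-- The component of `a` in `Z` is not contained in the neighbourhood of a vertex. -/
def Bad (G : SimpleGraph V) (Z : Set V) (a : V) : Prop :=
  a ∈ Z ∧ ∀ x, ∃ y, Conn G Z a y ∧ ¬ G.Adj x y

/-- The neighbours of `c` that have neighbours in the component of `a` in `Z`. -/
def side (G : SimpleGraph V) (Z : Set V) (c a : V) : Set V :=
  {x | G.Adj c x ∧ ∃ y, Conn G Z a y ∧ G.Adj x y}

/-- The component only grows when `Z` does, and so does the difficulty of dominating it by one
vertex. -/
theorem Bad.mono {Z Z' : Set V} {a : V} (h : Bad G Z a) (hZ : Z ⊆ Z') : Bad G Z' a :=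
  ⟨hZ h.1, fun x => (h.2 x).imp fun _ hy => ⟨hy.1.mono hZ, hy.2⟩⟩

theorem Bad.mixed {Z : Set V} {c a x : V} (h : Bad G Z a) (hx : x ∈ side G Z c a) :
    ∃ y y', Conn G Z a y ∧ Conn G Z a y' ∧ G.Adj x y ∧ ¬ G.Adj x y' ∧ G.Adj y y' := by
  obtain ⟨b, h1, h2⟩ := hx.2
  obtain ⟨d, h3, h4⟩ := h.2 x
  exact exists_mixed_edge h.1 h1 h3 h2 h4

/-- Suppose `x` attaches only to the component of `a` and `x'` only to that of `b`. Badness lets `x`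
distinguish the ends of an edge `y y'` and `x'` those of an edge `w w'`. Then `y' y x x' w w'` is an
induced path if `x` and `x'` are adjacent, and `y' y x c x' w` is one otherwise. -/
theorem side_nested (hP : IndFree (SimpleGraph.pathGraph 6) G) {Z : Set V} {c a b : V}
    (hc : ∀ z ∈ Z, ¬ G.Adj c z) (ha : Bad G Z a) (hb : Bad G Z b) :
    side G Z c a ⊆ side G Z c b ∨ side G Z c b ⊆ side G Z c a := by
  by_contra! hcon
  obtain ⟨x, hxa, hxb⟩ := Set.not_subset.1 hcon.1
  obtain ⟨x', hxb', hxa'⟩ := Set.not_subset.1 hcon.2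
  obtain ⟨y, y', h1, h2, h3, h4, h5⟩ := ha.mixed hxa
  obtain ⟨w, w', g1, g2, g3, g4, g5⟩ := hb.mixed hxb'
  have hab : ¬ Conn G Z a b := fun h => hxb ⟨hxa.1, y, (h.symm ha.1).trans h1, h3⟩
  have hanti : ∀ p q, Conn G Z a p → Conn G Z b q → ¬ G.Adj p q :=
    fun p q hp hq h => hab (hp.of_adj hq hb.1 h)
  have nx : ∀ q, Conn G Z b q → ¬ G.Adj x q := fun q hq h => hxb ⟨hxa.1, q, hq, h⟩
  have nx' : ∀ q, Conn G Z a q → ¬ G.Adj x' q := fun q hq h => hxa' ⟨hxb'.1, q, hq, h⟩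
  have hca : ∀ q, Conn G Z a q → ¬ G.Adj c q := fun q hq => hc q (hq.mem ha.1)
  have hcb : ∀ q, Conn G Z b q → ¬ G.Adj c q := fun q hq => hc q (hq.mem hb.1)
  by_cases hxx : G.Adj x x'
  · exact no_induced_path_six hP h5.symm h3.symm hxx g3 g5 (fun h => h4 h.symm)
      (fun h => nx' _ h2 h.symm) (hanti _ _ h2 g1) (hanti _ _ h2 g2) (fun h => nx' _ h1 h.symm)
      (hanti _ _ h1 g1) (hanti _ _ h1 g2) (nx _ g1) (nx _ g2) g4
  · exact no_induced_path_six hP h5.symm h3.symm hxa.1.symm hxb'.1 g3 (fun h => h4 h.symm)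
      (fun h => hca _ h2 h.symm) (fun h => nx' _ h2 h.symm) (hanti _ _ h2 g1)
      (fun h => hca _ h1 h.symm) (fun h => nx' _ h1 h.symm) (hanti _ _ h1 g1) hxx (nx _ g1)
      (hcb _ g1)

/-- A smallest set of a chain is contained in all the others. -/
theorem exists_common_of_nested [Finite V] (B : Set V) (hB : B.Nonempty) (S : V → Set V)
    (hne : ∀ a ∈ B, (S a).Nonempty) (hnest : ∀ a ∈ B, ∀ b ∈ B, S a ⊆ S b ∨ S b ⊆ S a) :
    ∃ a ∈ B, ∃ x ∈ S a, ∀ b ∈ B, x ∈ S b := by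
  obtain ⟨a, ha, hmin⟩ := Set.exists_min_image B (fun a => (S a).ncard) (Set.toFinite B) hB
  obtain ⟨x, hx⟩ := hne a ha
  refine ⟨a, ha, x, hx, fun b hb => ?_⟩
  rcases hnest a ha b hb with h | h
  · exact h hx
  · rwa [Set.eq_of_subset_of_ncard_le h (hmin b hb) (Set.toFinite _)]

theorem conn_univ_of_reachable {a b : V} (h : G.Reachable a b) : Conn G Set.univ a b := by
  rw [SimpleGraph.reachable_iff_reflTransGen] at h
  exact Relation.ReflTransGen.mono (fun _ _ h => ⟨h, trivial⟩) _ _ h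

/-- In a `P_6`-free graph, the component of `r` has a path on three vertices from `r` such that
every component of what is outside of its neighbourhood is contained in the neighbourhood of a
vertex. -/
theorem exists_dominating_triple [Finite V] (hP : IndFree (SimpleGraph.pathGraph 6) G) (r : V) :
    ∃ v z, ∀ w, G.Reachable r w → ¬ G.Adj r w → ¬ G.Adj v w → ¬ G.Adj z w →
      ∃ x, ∀ y, ¬ G.Adj r y → ¬ G.Adj v y → ¬ G.Adj z y → G.Adj w y → G.Adj y x ∧ G.Adj w x := by
  by_cases hiso : ∀ v, ¬ G.Adj r v
  · refine ⟨r, r, fun w hw _ _ _ => ⟨r, fun y hy _ _ hwy => ?_⟩⟩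
    rcases Relation.ReflTransGen.cases_head ((SimpleGraph.reachable_iff_reflTransGen _ _).1 hw) with
      rfl | ⟨v, hv, -⟩
    · exact absurd hwy hy
    · exact absurd hv (hiso v)
  push Not at hiso
  set Z₁ : Set V := {w | G.Reachable r w ∧ ¬ G.Adj r w ∧ w ≠ r} with hZ₁
  have hside1 : ∀ a ∈ Z₁, (side G Z₁ r a).Nonempty := by
    intro a ha
    obtain ⟨y, q, h1, -, h3, h4, h5⟩ := exists_attachment (Z' := Set.univ) ha
      (conn_univ_of_reachable ha.1.symm) (b := r) (by simp [hZ₁])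
    have hq := h4.mem ha
    refine ⟨y, ?_, q, h4, h5⟩
    by_contra hry
    refine h3 ⟨hq.1.trans h5.symm.reachable, hry, ?_⟩
    rintro rfl
    exact hq.2.1 h5
  -- A neighbour of `r` that touches all bad components of `Z₁`; if none is bad, any neighbour will
  -- do.
  have hv : ∃ v, G.Adj r v ∧ ∀ a, Bad G Z₁ a → v ∈ side G Z₁ r a := by
    by_cases hB : ∃ a, Bad G Z₁ a
    · obtain ⟨a, ha, x, hx, h⟩ := exists_common_of_nested {a | Bad G Z₁ a} hB (side G Z₁ r)
        (fun a ha => hside1 a ha.1) (fun a ha b hb => side_nested hP (fun z hz => hz.2.1) ha hb)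
      exact ⟨x, hx.1, h⟩
    · push Not at hB
      exact hiso.imp fun v hv => ⟨hv, fun a ha => absurd ha (hB a)⟩
  obtain ⟨v, hrv, hv⟩ := hv
  set Z₂ : Set V := {w | w ∈ Z₁ ∧ ¬ G.Adj v w} with hZ₂
  have hZ21 : Z₂ ⊆ Z₁ := fun w hw => hw.1
  -- A bad component of `Z₂` lies in a bad component of `Z₁`, where `v` has a neighbour. A walk
  -- towards it inside `Z₁` leaves `Z₂` at a neighbour of `v`.
  have hside2 : ∀ a, Bad G Z₂ a → ∃ x ∈ side G Z₂ v a, Conn G Z₁ a x := by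
    intro a ha
    obtain ⟨-, b, h1, h2⟩ := hv a (ha.mono hZ21)
    obtain ⟨y, q, g1, g2, g3, g4, g5⟩ := exists_attachment ha.1 h1 (by simp [hZ₂, h2])
    refine ⟨y, ⟨?_, q, g4, g5⟩, g1⟩
    by_contra hvy
    exact g3 ⟨g2, hvy⟩
  -- Otherwise `y' y x v w w'` is an induced path, with `y`, `y'` in the component of `a` in `Z₂`
  -- and `w`, `w'` in the component of `b` in `Z₁`.
  have hsame : ∀ a b, Bad G Z₂ a → Bad G Z₂ b → Conn G Z₁ a b := by
    intro a b ha hb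
    by_contra hab
    have hb1 := hb.mono hZ21
    have ha1 := hZ21 ha.1
    obtain ⟨x, hx, hax⟩ := hside2 a ha
    obtain ⟨y, y', h1, h2, h3, h4, h5⟩ := ha.mixed hx
    obtain ⟨w, w', g1, g2, g3, g4, g5⟩ := hb1.mixed (hv b hb1)
    have hanti : ∀ p q, Conn G Z₁ a p → Conn G Z₁ b q → ¬ G.Adj p q :=
      fun p q hp hq h => hab (hp.of_adj hq hb1.1 h)
    have k1 := h1.mono hZ21
    have k2 := h2.mono hZ21
    exact no_induced_path_six hP h5.symm h3.symm hx.1.symm g3 g5 (fun h => h4 h.symm)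
      (fun h => (h2.mem ha.1).2 h.symm) (hanti _ _ k2 g1) (hanti _ _ k2 g2)
      (fun h => (h1.mem ha.1).2 h.symm) (hanti _ _ k1 g1) (hanti _ _ k1 g2) (hanti _ _ hax g1)
      (hanti _ _ hax g2) g4
  have hz : ∃ z, ∀ a, Bad G Z₂ a → z ∈ side G Z₂ v a ∧ z ∈ Z₁ := by
    by_cases hB : ∃ a, Bad G Z₂ a
    · have hnest : ∀ a ∈ {a | Bad G Z₂ a}, ∀ b ∈ {a | Bad G Z₂ a},
          side G Z₂ v a ∩ {x | Conn G Z₁ a x} ⊆ side G Z₂ v b ∩ {x | Conn G Z₁ b x} ∨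
          side G Z₂ v b ∩ {x | Conn G Z₁ b x} ⊆ side G Z₂ v a ∩ {x | Conn G Z₁ a x} := by
        intro a ha b hb
        have h1 := hsame a b ha hb
        have h2 := hsame b a hb ha
        rcases side_nested hP (fun z hz => hz.2) ha hb with h | h
        · exact .inl fun x hx => ⟨h hx.1, h2.trans hx.2⟩
        · exact .inr fun x hx => ⟨h hx.1, h1.trans hx.2⟩
      obtain ⟨a, ha, x, hx, h⟩ := exists_common_of_nested {a | Bad G Z₂ a} hB
        (fun a => side G Z₂ v a ∩ {x | Conn G Z₁ a x}) hside2 hnest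
      exact ⟨x, fun b hb => ⟨(h b hb).1, (h b hb).2.mem (hZ21 hb.1)⟩⟩
    · push Not at hB
      exact ⟨r, fun a ha => absurd ha (hB a)⟩
  obtain ⟨z, hz⟩ := hz
  set Z₃ : Set V := {w | w ∈ Z₂ ∧ ¬ G.Adj z w} with hZ₃
  have hZ32 : Z₃ ⊆ Z₂ := fun w hw => hw.1
  -- A bad component would have an attachment `y` in `Z₂` adjacent to `z`, and `y` would distinguish
  -- the ends of an edge `e e'` in it: `e' e y z v r` would be an induced path.
  have hgood : ∀ a, ¬ Bad G Z₃ a := by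
    intro a ha
    obtain ⟨⟨hvz, b, hb, hzb⟩, hz1⟩ := hz a (ha.mono hZ32)
    obtain ⟨y, q, g1, g2, g3, g4, g5⟩ := exists_attachment ha.1 hb (by simp [hZ₃, hzb])
    have hzy : G.Adj z y := by
      by_contra h
      exact g3 ⟨g2, h⟩
    obtain ⟨e, e', h1, h2, h3, h4, h5⟩ := ha.mixed (c := z) ⟨hzy, q, g4, g5⟩
    have k1 := h1.mem ha.1
    have k2 := h2.mem ha.1
    exact no_induced_path_six hP h5.symm h3.symm hzy.symm hvz.symm hrv.symm (fun h => h4 h.symm)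
      (fun h => k2.2 h.symm) (fun h => k2.1.2 h.symm) (fun h => k2.1.1.2.1 h.symm)
      (fun h => k1.2 h.symm) (fun h => k1.1.2 h.symm) (fun h => k1.1.1.2.1 h.symm)
      (fun h => g2.2 h.symm) (fun h => g2.1.2.1 h.symm) (fun h => hz1.2.1 h.symm)
  refine ⟨v, z, fun w hw hrw hvw hzw => ?_⟩
  have hmem : ∀ y, G.Reachable r y → ¬ G.Adj r y → ¬ G.Adj v y → ¬ G.Adj z y → y ∈ Z₃ := by
    intro y h1 h2 h3 h4
    refine ⟨⟨⟨h1, h2, ?_⟩, h3⟩, h4⟩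
    rintro rfl
    exact h3 hrv.symm
  have hw3 := hmem w hw hrw hvw hzw
  have := hgood w
  simp only [Bad, hw3, true_and, not_forall, not_exists, not_and, not_not] at this
  obtain ⟨x, hx⟩ := this
  refine ⟨x, fun y h1 h2 h3 h4 => ⟨(hx y ?_).symm, (hx w .refl).symm⟩⟩
  exact Relation.ReflTransGen.single ⟨h4, hmem y (hw.trans h4.reachable) h1 h2 h3⟩

end graph

end MPHC


namespace MPHC

/-! ### Diameter, inheritance of forbidden subgraphs, and the drop of the clique number -/

section graph

variable {V : Type*} {G : SimpleGraph V}

/-- In a `P_6`-free graph all distances in a component are at most four. -/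
theorem reachable_iff_of_free (hP : IndFree (SimpleGraph.pathGraph 6) G) (r w : V) :
    G.Reachable r w ↔ ∃ a b c, (r = a ∨ G.Adj r a) ∧ (a = b ∨ G.Adj a b) ∧ (b = c ∨ G.Adj b c) ∧
      (c = w ∨ G.Adj c w) := by
  have step : ∀ {x y : V}, x = y ∨ G.Adj x y → G.Reachable x y := by
    rintro x y (rfl | h)
    · rfl
    · exact h.reachable
  constructor
  · intro h
    obtain ⟨p, hp⟩ := h.exists_walk_length_eq_dist
    have hadj : ∀ i, p.getVert i = p.getVert (i + 1) ∨ G.Adj (p.getVert i) (p.getVert (i + 1)) := by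
      intro i
      rcases lt_or_ge i p.length with hi | hi
      · exact .inr (p.adj_getVert_succ hi)
      · exact .inl (by rw [p.getVert_of_length_le hi, p.getVert_of_length_le (hi.trans (by omega))])
    -- The first six vertices of a shortest walk with five or more edges induce a path, as a chord
    -- would shorten the walk.
    have hlen : p.length ≤ 4 := by
      by_contra! hlen
      refine hP (pathGraph_six_isIndContained (f := fun i => p.getVert i) fun i j hij => ?_)
      constructor
      · intro hij'
        have hj : (j : ℕ) ≤ p.length := by omega
        have := G.dist_le ((p.take i).append (.cons hij' (p.drop j)))
        rw [← hp] at this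
        simp only [SimpleGraph.Walk.length_append, SimpleGraph.Walk.length_cons,
          SimpleGraph.Walk.take_length, SimpleGraph.Walk.drop_length] at this
        have hij2 : i.val < j.val := hij
        omega
      · intro hij'
        rw [← hij']
        exact p.adj_getVert_succ (by omega)
    refine ⟨p.getVert 1, p.getVert 2, p.getVert 3, ?_, hadj 1, hadj 2, ?_⟩
    · simpa using hadj 0
    · have := hadj 3
      rwa [p.getVert_of_length_le hlen] at this
  · rintro ⟨a, b, c, h1, h2, h3, h4⟩
    exact (((step h1).trans (step h2)).trans (step h3)).trans (step h4)

/-- By `hcomp` the components of `G'` are induced subgraphs of `G`, and a copy of the connected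
graph `F` lies within one of them. -/
theorem IndFree.of_le {W : Type*} {F : SimpleGraph W} {G' : SimpleGraph V} (hF : F.Preconnected)
    (h : IndFree F G) (hle : G' ≤ G)
    (hcomp : ∀ u v, G'.Reachable u v → G.Adj u v → G'.Adj u v) : IndFree F G' := by
  rintro ⟨f⟩
  refine h ⟨⟨f.toEmbedding, fun {x y} => ⟨fun hxy => ?_, fun hxy => ?_⟩⟩⟩
  · exact f.map_adj_iff.1 (hcomp _ _ ((hF x y).map f.toHom) hxy)
  · exact hle (f.map_adj_iff.2 hxy)

theorem graphS_preconnected (t : ℕ) : (graphS t).Preconnected := by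
  have h1 : ∀ i : Fin t, (graphS t).Reachable (.inl ()) (.inr (.inl i)) := fun i =>
    SimpleGraph.Adj.reachable (by simp [graphS])
  have h : ∀ x, (graphS t).Reachable (.inl ()) x := by
    rintro (⟨⟩ | i | i)
    · rfl
    · exact h1 i
    · exact (h1 i).trans (SimpleGraph.Adj.reachable (by simp [graphS]))
  exact fun x y => (h x).symm.trans (h y)

theorem graphL_preconnected (s : ℕ) : (graphL s).Preconnected :=
  (graphS_preconnected s).mono le_sup_left

/-- A maximum clique of `G'` on at least two vertices lies in the closed neighbourhood of a member
`w`, so the vertex `x` provided by `hext` extends it in `G`. Smaller cliques are beaten by an edge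
of `G`. -/
theorem cliqueNum_lt_of_le [Fintype V] {G' : SimpleGraph V} (hle : G' ≤ G)
    (hedge : ∃ u v, G.Adj u v)
    (hext : ∀ w, ∃ x, ∀ y, G'.Adj w y → G.Adj y x ∧ G.Adj w x) :
    G'.cliqueNum < G.cliqueNum := by
  classical
  obtain ⟨S, hS⟩ := G'.exists_isNClique_cliqueNum
  rcases Nat.lt_or_ge 1 S.card with h | h
  · obtain ⟨w, hw, y, hy, hwy⟩ := Finset.one_lt_card.1 h
    obtain ⟨x, hx⟩ := hext w
    have hwx : G.Adj w x := (hx y (hS.isClique hw hy hwy)).2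
    have hSx : ∀ z ∈ S, G.Adj z x := by
      intro z hz
      by_cases hzw : w = z
      · exact hzw ▸ hwx
      · exact (hx z (hS.isClique hw hz hzw)).1
    have hxS : x ∉ S := fun hxS => G.irrefl (hSx x hxS)
    have hcl : G.IsClique (insert x S : Finset V) := by
      rw [Finset.coe_insert, SimpleGraph.isClique_insert]
      exact ⟨hS.isClique.mono hle, fun z hz _ => (hSx z hz).symm⟩
    have := hcl.card_le_cliqueNum
    rw [Finset.card_insert_of_notMem hxS, hS.card_eq] at this
    omega
  · obtain ⟨u, v, huv⟩ := hedge
    have hcl : G.IsClique ({u, v} : Finset V) := by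
      simp [huv]
    have := hcl.card_le_cliqueNum
    rw [Finset.card_pair huv.ne] at this
    have := hS.card_eq
    omega

end graph

/-! ### Restricting the colours -/

section colour

variable {n h : ℕ}

/-- Adjacency in terms of natural numbers. -/
def NAdj (G : SimpleGraph (Fin n)) (i j : ℕ) : Prop :=
  ∃ (hi : i < n) (hj : j < n), G.Adj ⟨i, hi⟩ ⟨j, hj⟩

@[simp] theorem nAdj_val {G : SimpleGraph (Fin n)} {u v : Fin n} : NAdj G u v ↔ G.Adj u v := by
  simp [NAdj]

theorem NAdj.symm {G : SimpleGraph (Fin n)} {i j : ℕ} (h : NAdj G i j) : NAdj G j i := by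
  obtain ⟨hi, hj, h⟩ := h
  exact ⟨hj, hi, h.symm⟩

open Classical in
/-- The first of the vertices `x`, `y`, `z` that is adjacent to `w`. -/
noncomputable def lab (G : SimpleGraph (Fin n)) (x y z w : ℕ) : ℕ :=
  if NAdj G x w then 0 else if NAdj G y w then 1 else if NAdj G z w then 2 else 3

/-- The guess `f` contains a neighbour of `w` with colour `a`. -/
def Cov (G : SimpleGraph (Fin n)) (m : ℕ) (f : ℕ → ℕ) (a w : ℕ) : Prop :=
  ∃ j < m, f (m + j) = a ∧ NAdj G (f j) w

/-- The colour `a` may be used for the vertex `v` of `K`, given the guess `f`. -/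
def Allowed (G : SimpleGraph (Fin n)) (H : SimpleGraph (Fin h)) (K : ℕ → Prop) (l : ℕ → ℕ)
    (m : ℕ) (f : ℕ → ℕ) (v a : ℕ) : Prop :=
  K v ∧ (∀ w < n, NAdj G v w → l v < l w → Cov G m f a w) ∧ ∀ b < h, Cov G m f b v → NAdj H a b

/-- The guess collects the small covers of all colour classes of `ψ` within the labels 0, 1, 2.
Covering gives the first rule; the second holds because guessed vertices carry their colour under
`ψ`. -/
theorem exists_guess {G : SimpleGraph (Fin n)} {H : SimpleGraph (Fin h)} {s t m : ℕ} (hs : 1 ≤ s)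
    (ht : 1 ≤ t) (hL : IndFree (graphL s) G) (hS : IndFree (graphS t) G)
    (hm : 3 * h * ramsey s t ≤ m) (K : ℕ → Prop) {x y z : ℕ} (hx : x < n) (hy : y < n)
    (hz : z < n) {ψ : Fin n → Option (Fin h)} (hψ : IsPartialColoring G H ψ) :
    ∃ f : ℕ → ℕ, (∀ i, f i < n + h + 1) ∧ ∀ (v : Fin n) (a : Fin h), K v → ψ v = some a →
      Allowed G H K (lab G x y z) m f v a := by
  classical
  let c : Fin 3 → Fin n := ![⟨x, hx⟩, ⟨y, hy⟩, ⟨z, hz⟩]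
  have hlab : ∀ (l : Fin 3) (w : Fin n), lab G x y z w = l → G.Adj (c l) w := by
    intro l w hw
    rw [← nAdj_val]
    unfold lab at hw
    fin_cases l
    · show NAdj G x w
      by_contra hc
      simp only [hc, if_false] at hw
      split_ifs at hw
    · show NAdj G y w
      by_contra hc
      simp only [hc, if_false] at hw
      split_ifs at hw <;> simp at hw
    · show NAdj G z w
      by_contra hc
      simp only [hc, if_false] at hw
      split_ifs at hw <;> simp at hw
  have hlab' : ∀ (l : Fin 3) (w : Fin n), l < lab G x y z w → ¬ G.Adj (c l) w := by
    intro l w hw hadj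
    rw [← nAdj_val] at hadj
    unfold lab at hw
    fin_cases l
    · have : NAdj G x w := hadj
      simp [this] at hw
    · have : NAdj G y w := hadj
      simp only [this, if_true] at hw
      split_ifs at hw <;> simp at hw
    · have : NAdj G z w := hadj
      simp only [this, if_true] at hw
      split_ifs at hw <;> simp at hw
  have hcov : ∀ (l : Fin 3) (a : Fin h), ∃ D : Finset (Fin n), (∀ v ∈ D, ψ v = some a) ∧
      D.card ≤ ramsey s t ∧ ∀ v w : Fin n, ψ v = some a → lab G x y z v = l →
        l < lab G x y z w → G.Adj v w → ∃ d ∈ D, G.Adj d w := by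
    intro l a
    obtain ⟨D, h1, h2, h3⟩ := exists_small_cover hs ht hL hS (c l)
      (Finset.univ.filter fun v : Fin n => ψ v = some a ∧ lab G x y z v = l)
      (Finset.univ.filter fun w : Fin n => l < lab G x y z w)
      (fun v hv => hlab l v (Finset.mem_filter.1 hv).2.2)
      (fun v hv w hw hvw => H.irrefl (hψ v w hvw a a (Finset.mem_filter.1 hv).2.1
        (Finset.mem_filter.1 hw).2.1))
      (fun w hw => hlab' l w (Finset.mem_filter.1 hw).2)
    refine ⟨D, fun v hv => (Finset.mem_filter.1 (h1 hv)).2.1, h2, fun v w g1 g2 g3 g4 => ?_⟩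
    exact h3 w (by simpa using g3) ⟨v, by simp [g1, g2], g4⟩
  choose D hD1 hD2 hD3 using hcov
  -- Covers of different labels are merged: `Cov` asks only for a guessed neighbour of the right
  -- colour. The size is at most `3 * h * ramsey s t`.
  let S : Finset (Fin n × Fin h) := (Finset.univ : Finset (Fin 3 × Fin h)).biUnion fun p =>
    (D p.1 p.2).image fun v => (v, p.2)
  have hSmem : ∀ v a, (v, a) ∈ S ↔ ∃ l, v ∈ D l a := by
    intro v a
    simp only [S, Finset.mem_biUnion, Finset.mem_univ, true_and, Finset.mem_image, Prod.mk.injEq]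
    constructor
    · rintro ⟨⟨l, b⟩, u, h1, rfl, rfl⟩
      exact ⟨l, h1⟩
    · rintro ⟨l, h1⟩
      exact ⟨(l, a), v, h1, rfl, rfl⟩
  have hScard : S.card ≤ m := by
    refine le_trans (Finset.card_biUnion_le_card_mul _ _ (ramsey s t) fun p _ =>
      Finset.card_image_le.trans (hD2 p.1 p.2)) (le_trans ?_ hm)
    simp
  let e := S.equivFin
  -- Places not needed are filled with the vertex `n`, which is adjacent to nothing, and the colour
  -- `h`, which is none.
  let f : ℕ → ℕ := fun i => if i < m then
      (if hi : i < S.card then ((e.symm ⟨i, hi⟩ : Fin n × Fin h).1 : ℕ) else n)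
    else (if hi : i - m < S.card then ((e.symm ⟨i - m, hi⟩ : Fin n × Fin h).2 : ℕ) else h)
  have hfcov : ∀ (b : Fin h) (w : Fin n), Cov G m f b w ↔ ∃ v, (v, b) ∈ S ∧ G.Adj v w := by
    intro b w
    constructor
    · rintro ⟨j, hj, h1, h2⟩
      by_cases hjS : j < S.card
      · simp only [f, hj, hjS, if_true, dif_pos, nAdj_val] at h2
        simp only [f, hjS, dif_pos, Nat.add_sub_cancel_left, show ¬ m + j < m by omega,
          if_false] at h1
        refine ⟨_, ?_, h2⟩
        have := (e.symm ⟨j, hjS⟩).2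
        rwa [← Fin.ext h1]
      · simp only [f, hj, hjS, if_true, dif_neg, not_false_iff] at h2
        exact absurd h2.1 (lt_irrefl _)
    · rintro ⟨v, hv, hvw⟩
      have hlt := (e ⟨(v, b), hv⟩).2
      refine ⟨e ⟨(v, b), hv⟩, by omega, ?_, ?_⟩
      · simp [f]
      · simp only [f, show (e ⟨(v, b), hv⟩ : ℕ) < m by omega, hlt, if_true, dif_pos, Fin.eta,
          Equiv.symm_apply_apply, nAdj_val]
        exact hvw
  refine ⟨f, fun i => ?_, fun v a hKv hva => ⟨hKv, fun w hw hvw hlt => ?_, fun b hb hbv => ?_⟩⟩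
  · simp only [f]
    split_ifs
    · have := (e.symm ⟨i, by assumption⟩ : Fin n × Fin h).1.2
      omega
    · omega
    · have := (e.symm ⟨i - m, by assumption⟩ : Fin n × Fin h).2.2
      omega
    · omega
  · have h4 : ∀ w, lab G x y z w ≤ 3 := by
      intro w; unfold lab; split_ifs <;> omega
    have hl : lab G x y z v < 3 := lt_of_lt_of_le hlt (h4 w)
    obtain ⟨d, h1, h2⟩ := hD3 ⟨_, hl⟩ a v ⟨w, hw⟩ hva rfl hlt (nAdj_val.1 hvw)
    exact (hfcov a ⟨w, hw⟩).2 ⟨d, (hSmem _ _).2 ⟨_, h1⟩, h2⟩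
  · obtain ⟨u, h1, h2⟩ := (hfcov ⟨b, hb⟩ v).1 hbv
    obtain ⟨l, h3⟩ := (hSmem _ _).1 h1
    exact (nAdj_val (u := a) (v := ⟨b, hb⟩)).2 (hψ v u h2.symm a _ hva (hD1 _ _ u h3))

/-- Leaving `u` uncoloured is always permitted; hence revenue -1 effectively forbids a colour. -/
theorem IsOptimum.rev_nonneg {H : SimpleGraph (Fin h)} {I : Instance h}
    {φ : Fin I.n → Option (Fin h)} (hφ : IsOptimum H I φ) {u : Fin I.n} {a : Fin h}
    (hu : φ u = some a) : 0 ≤ I.rev u a := by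
  classical
  have hcol : IsPartialColoring I.graph H (Function.update φ u none) := by
    intro v w hvw x y hx hy
    refine hφ.1 v w hvw x y ?_ ?_
    · by_cases hv : v = u
      · subst hv; simp at hx
      · simpa [hv] using hx
    · by_cases hw : w = u
      · subst hw; simp at hy
      · simpa [hw] using hy
  have h1 := hφ.2 _ hcol
  simp only [revenue] at h1
  rw [← Finset.add_sum_erase _ _ (Finset.mem_univ u),
    ← Finset.add_sum_erase (a := u) _ (fun v => (φ v).elim 0 (I.rev v)) (Finset.mem_univ u)] at h1
  have h2 : ∑ v ∈ Finset.univ.erase u, (Function.update φ u none v).elim 0 (I.rev v) =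
      ∑ v ∈ Finset.univ.erase u, (φ v).elim 0 (I.rev v) := by
    refine Finset.sum_congr rfl fun v hv => ?_
    rw [Function.update_of_ne (Finset.ne_of_mem_erase hv)]
  rw [h2] at h1
  simpa [hu] using h1

theorem isOptimum_nonneg {H : SimpleGraph (Fin h)} {I : Instance h}
    {φ : Fin I.n → Option (Fin h)} (hφ : IsOptimum H I φ) : 0 ≤ revenue I.rev φ := by
  have := hφ.2 (fun _ => none) (fun u v _ x y hx => by simp at hx)
  simpa [revenue] using this

/-- An optimum solution for the graph without the edges between different classes is a solution for
`G` if the colours are restricted. -/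
theorem IsOptimum.of_restricted {G G' : SimpleGraph (Fin n)} {H : SimpleGraph (Fin h)}
    {K : ℕ → Prop} {l : ℕ → ℕ} {m : ℕ} {f : ℕ → ℕ} {s t : ℕ} {rev' : Fin n → Fin h → ℝ}
    (hG' : ∀ u v : Fin n, K u → G.Adj u v → l u = l v → G'.Adj u v)
    (hrev : ∀ (v : Fin n) (a : Fin h), ¬ Allowed G H K l m f v a → rev' v a = -1)
    {φ : Fin n → Option (Fin h)} (hφ : IsOptimum H ⟨s, t, n, G', rev'⟩ φ) :
    IsPartialColoring G H φ ∧ ∀ v a, φ v = some a → Allowed G H K l m f v a := by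
  have hall : ∀ v a, φ v = some a → Allowed G H K l m f v a := by
    intro v a hva
    by_contra hc
    have : 0 ≤ rev' v a := hφ.rev_nonneg hva
    rw [hrev v a hc] at this
    linarith
  refine ⟨fun u v huv x y hx hy => ?_, hall⟩
  have hxa := hall u x hx
  have hya := hall v y hy
  -- Across different labels, the colour of the end with the smaller label is guessed in a neighbour
  -- of the other end, whose own colour must then be compatible with it. Edges within a label are
  -- edges of `G'`.
  rcases lt_trichotomy (l u) (l v) with hlt | heq | hlt
  · exact (nAdj_val.1 (hya.2.2 x x.2 (hxa.2.1 v v.2 (nAdj_val.2 huv) hlt))).symm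
  · exact hφ.1 u v (hG' u v hxa.1 huv heq) x y hx hy
  · exact nAdj_val.1 (hxa.2.2 y y.2 (hya.2.1 u u.2 (nAdj_val.2 huv.symm) hlt))

open Classical in
/-- The revenue from the vertices in `K`. -/
noncomputable def revenueOn (K : ℕ → Prop) (rev : Fin n → Fin h → ℝ)
    (φ : Fin n → Option (Fin h)) : ℝ :=
  ∑ u : Fin n, if K u then (φ u).elim 0 (rev u) else 0

/-- Revenue is a sum over the components, and edges stay within them. -/
theorem isOptimum_of_components {G : SimpleGraph (Fin n)} {H : SimpleGraph (Fin h)} {s t : ℕ}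
    {rev : Fin n → Fin h → ℝ} {φ : Fin n → Option (Fin h)} {K : ℕ → ℕ → Prop}
    (hK : ∀ r u : Fin n, K r u ↔ G.Reachable r u)
    (hcol : ∀ r u v : Fin n, K r u → G.Adj u v → ∀ x y, φ u = some x → φ v = some y → H.Adj x y)
    (hopt : ∀ (r : Fin n) (ψ : Fin n → Option (Fin h)), IsPartialColoring G H ψ →
      revenueOn (K r) rev ψ ≤ revenueOn (K r) rev φ) :
    IsOptimum H ⟨s, t, n, G, rev⟩ φ := by
  classical
  refine ⟨fun u v huv x y => hcol u u v ((hK u u).2 (.refl u)) huv x y, fun ψ hψ => ?_⟩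
  have hsum : ∀ χ : Fin n → Option (Fin h), revenue rev χ =
      ∑ c : G.ConnectedComponent, ∑ u with G.connectedComponentMk u = c, (χ u).elim 0 (rev u) :=
    fun χ => (Finset.sum_fiberwise _ _ _).symm
  show revenue rev ψ ≤ revenue rev φ
  rw [hsum, hsum]
  refine Finset.sum_le_sum fun c _ => ?_
  induction c using SimpleGraph.ConnectedComponent.ind with
  | h r =>
    have := hopt r ψ hψ
    simp only [revenueOn, ← Finset.sum_filter] at this
    have hf : (Finset.univ.filter fun u => G.connectedComponentMk u = G.connectedComponentMk r) =
        Finset.univ.filter fun u : Fin n => K r u := by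
      ext u
      simp [hK, SimpleGraph.reachable_comm]
    rw [hf]
    exact this

end colour

end MPHC


namespace MPHC

/-! ### The program -/

namespace Prog

abbrev nE : NExp := .var 0
abbrev sE : NExp := .get 0 (.const 0) (.const 1)
abbrev tE : NExp := .get 0 (.const 0) (.const 2)

/-- Adjacency of the vertices `i` and `j` of the input graph. -/
def adjF (i j : NExp) : Fm := .eqN (.get 1 i j) (.const 1)

/-- The vertices `i` and `j` are equal or adjacent. -/
def nearF (i j : NExp) : Fm := .disj (.eqN i j) (adjF i j)

def edgelessF : Fm := .all 40 nE (.all 41 nE (.neg (adjF (.var 40) (.var 41))))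

def revE (v a : NExp) : RExp := .get 0 v a

/-- The colour `a` is the best one for the vertex `v`, and better than none. -/
def bestF (h : ℕ) (v a : NExp) : Fm :=
  .conj (.tst (.not (.leR (revE v a) (.const 0))))
    (.all 42 (.const h) (.tst (.leR (revE v (.var 42)) (revE v a))))

/-- An optimum solution of an edgeless graph. -/
def edgeless (h : ℕ) : Cmd :=
  .forC 21 nE (.forC 22 (.const h) ((bestF h (.var 21) (.var 22)).ite 100
    (.setN 2 (.var 21) (.const 0) (.add (.var 22) (.const 1))) .skip))

/-- The distance of the vertices `i` and `j` is at most four. -/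
def ballF (i j : NExp) : Fm :=
  .ex 40 nE (.ex 41 nE (.ex 42 nE (.conj (nearF i (.var 40))
    (.conj (nearF (.var 40) (.var 41)) (.conj (nearF (.var 41) (.var 42)) (nearF (.var 42) j))))))

/-- The component of vertex `3` is put in the array `6`. -/
def component : Cmd :=
  .forC 26 nE ((ballF (.var 3) (.var 26)).ite 100
    (.setN 6 (.var 26) (.const 0) (.const 1)) (.setN 6 (.var 26) (.const 0) (.const 0)))

/-- The number of the first of the vertices in the variables `3`, `y`, `z` adjacent to `w`. -/
def labE (y z : ℕ) (w : NExp) : NExp :=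
  .add (.sub (.const 1) (.get 1 (.var 3) w))
    (.add (.sub (.const 1) (.add (.get 1 (.var 3) w) (.get 1 (.var y) w)))
      (.sub (.const 1) (.add (.get 1 (.var 3) w) (.add (.get 1 (.var y) w) (.get 1 (.var z) w)))))

/-- Adjacency of vertices of the component with equal labels. -/
def innerF (y z : ℕ) (i j : NExp) : Fm :=
  .conj (adjF i j) (.conj (.eqN (labE y z i) (labE y z j)) (.eqN (.arr 6 i) (.const 1)))

/-- Only a vertex and its neighbours in the same class must have a common neighbour, not the whole
component of the class. This is first-order and is all that `cliqueNum_lt_of_le` uses. -/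
def checkF (y z : ℕ) : Fm :=
  .all 40 nE (.ex 41 nE (.all 42 nE (.imp (innerF y z (.var 40) (.var 42))
    (.conj (adjF (.var 42) (.var 41)) (adjF (.var 40) (.var 41))))))

/-- The search for two vertices that together with vertex `3` dominate enough. -/
def search : Cmd :=
  .forC 27 nE (.forC 28 nE ((checkF 27 28).ite 100
    (.seq (.setV 4 (.var 27)) (.setV 5 (.var 28))) .skip))

/-- The graph for the recursive call is put in the array `7`. -/
def subgraph : Cmd :=
  .forC 29 nE (.forC 30 nE ((innerF 4 5 (.var 29) (.var 30)).ite 100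
    (.setN 7 (.var 29) (.var 30) (.const 1)) (.setN 7 (.var 29) (.var 30) (.const 0))))

/-- With `m` in variable `10`, the entries of array `8` below `m` are guessed vertices, and entry `m
+ j` is the colour of the `j`-th one. -/
def covF (j : ℕ) (a w : NExp) : Fm :=
  .ex j (.var 10) (.conj (.eqN (.arr 8 (.add (.var 10) (.var j))) a) (adjF (.arr 8 (.var j)) w))

def allowedF (h : ℕ) (v a : NExp) : Fm :=
  .conj (.eqN (.arr 6 v) (.const 1)) (.conj
    (.all 40 nE (.imp (adjF v (.var 40))
      (.imp (.tst (.not (.leN (labE 4 5 (.var 40)) (labE 4 5 v)))) (covF 41 a (.var 40)))))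
    (.all 43 (.const h) (.imp (covF 44 (.var 43) v) (.eqN (.get 11 a (.var 43)) (.const 1)))))

/-- The revenues for the recursive call are put in the real array `1`. -/
def restrict (h : ℕ) : Cmd :=
  .forC 31 nE (.forC 32 (.const h) ((allowedF h (.var 31) (.var 32)).ite 100
    (.setR 1 (.var 31) (.var 32) (revE (.var 31) (.var 32)))
    (.setR 1 (.var 31) (.var 32) (.const (-1)))))

abbrev rvar (x : ℕ) : RExp := .get x (.const 0) (.const 0)

/-- The revenue of the solution in the array `9` is put in the real variable `2`. -/
def value : Cmd :=
  .seq (.setR 2 (.const 0) (.const 0) (.const 0))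
    (.forC 33 nE (.ite (.leN (.const 1) (.arr 9 (.var 33)))
      (.setR 2 (.const 0) (.const 0)
        (.add (rvar 2) (revE (.var 33) (.sub (.arr 9 (.var 33)) (.const 1))))) .skip))

/-- A better solution on the component is stored. -/
def update : Cmd :=
  .ite (.not (.leR (rvar 2) (rvar 3)))
    (.seq (.setR 3 (.const 0) (.const 0) (rvar 2))
      (.forC 34 nE (.ite (.leN (.const 1) (.arr 6 (.var 34)))
        (.setN 2 (.var 34) (.const 0) (.arr 9 (.var 34))) .skip))) .skip

/-- The next guess; variable `12` becomes `1` if there is none. -/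
def next (h : ℕ) : Cmd :=
  .seq (.setV 12 (.const 1))
    (.forC 35 (.add (.var 10) (.var 10)) (.ite (.leN (.const 1) (.var 12))
      (.ite (.leN (.add (.arr 8 (.var 35)) (.const 1)) (.add nE (.const h)))
        (.seq (.setN 8 (.var 35) (.const 0) (.add (.arr 8 (.var 35)) (.const 1)))
          (.setV 12 (.const 0)))
        (.setN 8 (.var 35) (.const 0) (.const 0))) .skip))

def guess (h : ℕ) : Cmd :=
  .seq (restrict h) (.seq (.call nE sE tE 7 1 9) (.seq value (.seq update (next h))))

/-- An optimum solution for the component of vertex `3`. -/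
def solve (h : ℕ) : Cmd :=
  .seq component (.seq search (.seq subgraph
    (.seq (.forC 36 (.add (.var 10) (.var 10)) (.setN 8 (.var 36) (.const 0) (.const 0)))
      (.seq (.setR 3 (.const 0) (.const 0) (.const (-1)))
        (.seq (.setV 12 (.const 0)) (.loop (.leN (.var 12) (.const 0)) (guess h)))))))

/-- Multiplication is not an instruction, but `k` is a constant of the program, so a sum of `k`
terms serves. -/
def mulE : ℕ → NExp → NExp
  | 0, _ => .const 0
  | k + 1, e => .add (mulE k e) e

/-- The parameters `s` and `t` may exceed every polynomial in `n`. Cutting them at `n + 1` keeps the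
table of binomial coefficients small, and `IndFree.min_size` shows that nothing is lost. -/
def capE (x : ℕ) (e : NExp) : Cmd :=
  .ite (.leN e (.add nE (.const 1))) (.setV x e) (.setV x (.add nE (.const 1)))

/-- The length of the guesses is put in variable `10`. -/
def length (h : ℕ) : Cmd :=
  .seq (capE 13 sE) (.seq (capE 14 tE) (.seq
    (.forC 23 (.var 13) (.forC 24 (.var 14) (.ite (.leN (.var 23) (.const 0))
      (.setN 15 (.var 23) (.var 24) (.const 1))
      (.ite (.leN (.var 24) (.const 0)) (.setN 15 (.var 23) (.var 24) (.const 1))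
        (.setN 15 (.var 23) (.var 24)
          (.add (.get 15 (.sub (.var 23) (.const 1)) (.var 24))
            (.get 15 (.var 23) (.sub (.var 24) (.const 1)))))))))
    (.setV 10 (mulE (3 * h) (.get 15 (.sub (.var 13) (.const 1)) (.sub (.var 14) (.const 1)))))))

open Classical in
/-- The entries of the adjacency matrix of the pattern graph given by a list are put in the
array `11`. -/
noncomputable def pattern {h : ℕ} (H : SimpleGraph (Fin h)) : List (ℕ × ℕ) → Cmd
  | [] => .skip
  | x :: l => .seq (.setN 11 (.const x.1) (.const x.2) (.const (if NAdj H x.1 x.2 then 1 else 0)))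
      (pattern H l)

/-- Edgeless graphs end the recursion. Otherwise every vertex serves as root once, so a component is
solved again for each of its vertices, which costs no more than a factor `n` and spares bookkeeping.
-/
noncomputable def main {h : ℕ} (H : SimpleGraph (Fin h)) : Cmd :=
  edgelessF.ite 100 (edgeless h) (.seq (pattern H (List.range h ×ˢ List.range h))
    (.seq (length h) (.forC 3 nE (solve h))))

end Prog

/-! ### Verification of the program -/

theorem not_mem_of_elem {a : ℕ} {l : List ℕ} (h : l.elem a = false) : a ∉ l := by
  intro ha
  rw [List.elem_eq_true_of_mem ha] at h
  exact absurd h (by simp)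

theorem updN_at {σ : Store} {a i j v x y : ℕ} :
    (σ.updN a i j v).nat a x y = if x = i ∧ y = j then v else σ.nat a x y := by
  simp [Store.updN]

theorem updR_at {σ : Store} {a i j : ℕ} {v : ℝ} {x y : ℕ} :
    (σ.updR a i j v).real a x y = if x = i ∧ y = j then v else σ.real a x y := by
  simp [Store.updR]

open Classical in
/-- The adjacency matrix, extended by zero. -/
noncomputable def adjM {n : ℕ} (G : SimpleGraph (Fin n)) (i j : ℕ) : ℕ :=
  if NAdj G i j then 1 else 0

theorem adjM_eq_one {n : ℕ} {G : SimpleGraph (Fin n)} {i j : ℕ} : adjM G i j = 1 ↔ NAdj G i j := by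
  simp [adjM]

/-- The revenues, extended by zero. -/
def revM {n h : ℕ} (rev : Fin n → Fin h → ℝ) (i j : ℕ) : ℝ :=
  if hij : i < n ∧ j < h then rev ⟨i, hij.1⟩ ⟨j, hij.2⟩ else 0

/-- The memory still contains the instance. -/
structure Input {h : ℕ} (I : Instance h) (σ : Store) : Prop where
  n : σ.nat 0 0 0 = I.n
  s : σ.nat 0 0 1 = I.s
  t : σ.nat 0 0 2 = I.t
  adj : σ.nat 1 = adjM I.graph
  rev : σ.real 0 = revM I.rev

theorem input_load {h : ℕ} (I : Instance h) : Input I (Store.load I) := by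
  refine ⟨by simp [Store.load], by simp [Store.load], by simp [Store.load], ?_, ?_⟩
  · funext i j
    simp only [Store.load, adjM, one_ne_zero, false_and, if_false]
    by_cases hij : NAdj I.graph i j
    · rw [if_pos hij]
      exact if_pos ⟨rfl, hij⟩
    · rw [if_neg hij]
      exact if_neg fun hc => hij hc.2
  · funext i j
    simp [Store.load, revM]

theorem Input.of_frame {h : ℕ} {I : Instance h} {σ τ : Store} (hI : Input I σ)
    (h0 : τ.nat 0 = σ.nat 0) (h1 : τ.nat 1 = σ.nat 1) (h2 : τ.real 0 = σ.real 0) : Input I τ :=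
  ⟨by rw [h0, hI.n], by rw [h0, hI.s], by rw [h0, hI.t], by rw [h1, hI.adj], by rw [h2, hI.rev]⟩

section pieces

variable {h : ℕ} {I : Instance h} {σ : Store} {E : Env}

open Prog

theorem holds_adjF {i j : NExp} (hA : σ.nat 1 = adjM I.graph) :
    (adjF i j).holds σ ↔ NAdj I.graph (i.eval σ) (j.eval σ) := by
  rw [adjF, Fm.holds_eqN]
  simp [NExp.eval, hA, adjM_eq_one]

/-- The three truncated differences indicate that none of the first one, two or three of the
vertices is adjacent to `w`; their sum is the label. -/
theorem eval_labE {y z : ℕ} {w : NExp} (hA : σ.nat 1 = adjM I.graph) :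
    (labE y z w).eval σ =
      lab I.graph (σ.nat 3 0 0) (σ.nat y 0 0) (σ.nat z 0 0) (w.eval σ) := by
  simp only [labE, NExp.eval, hA, adjM, lab]
  split_ifs <;> rfl

theorem edgelessF_holds (hI : Input I σ) :
    edgelessF.holds σ ↔ ∀ u v, ¬ I.graph.Adj u v := by
  simp only [edgelessF, adjF, Fm.holds, Fm.holds_eqN, NExp.eval]
  simp [updN_nat, hI.n, hI.adj, adjM_eq_one]
  constructor
  · exact fun hh u v huv => hh u u.2 v v.2 (nAdj_val.2 huv)
  · rintro hh i - j - ⟨hi, hj, hij⟩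
    exact hh _ _ hij

/-- The component as computed by the program. -/
def Ball {n : ℕ} (G : SimpleGraph (Fin n)) (r w : ℕ) : Prop :=
  ∃ a < n, ∃ b < n, ∃ c < n, (r = a ∨ NAdj G r a) ∧ (a = b ∨ NAdj G a b) ∧
    (b = c ∨ NAdj G b c) ∧ (c = w ∨ NAdj G c w)

theorem ballF_holds (hI : Input I σ) {x y : ℕ} (hx : x < 40) (hy : y < 40) :
    (ballF (.var x) (.var y)).holds σ ↔ Ball I.graph (σ.nat x 0 0) (σ.nat y 0 0) := by
  simp only [ballF, Fm.holds, Fm.holds_ex, Fm.holds_disj, Fm.holds_eqN, NExp.eval, nearF, adjF]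
  have x0 : x ≠ 40 := by omega
  have x1 : x ≠ 41 := by omega
  have x2 : x ≠ 42 := by omega
  have y0 : y ≠ 40 := by omega
  have y1 : y ≠ 41 := by omega
  have y2 : y ≠ 42 := by omega
  simp [updN_nat, hI.n, hI.adj, adjM_eq_one, x0, x1, x2, y0, y1, y2]
  rfl

open Classical in
theorem component_ok (hI : Input I σ) (hM : I.n ≤ E.iter) : Ok E component σ fun τ =>
    ∀ w < I.n, τ.nat 6 w 0 = if Ball I.graph (σ.nat 3 0 0) w then 1 else 0 := by
  unfold component
  refine Ok.forC (N := I.n) (by exact hI.n) hM rfl rfl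
    (fun i τ => ∀ w < i, τ.nat 6 w 0 = if Ball I.graph (σ.nat 3 0 0) w then 1 else 0)
    (by simp) ?_
  intro i τ hi hτi hN hR hinv
  have hIτ : Input I τ := hI.of_frame (hN 0 (not_mem_of_elem rfl)) (hN 1 (not_mem_of_elem rfl))
    (hR 0 (not_mem_of_elem rfl))
  have h3 : τ.nat 3 = σ.nat 3 := hN 3 (not_mem_of_elem rfl)
  have hB := ballF_holds hIτ (x := 3) (y := 26) (by decide) (by decide)
  rw [hτi, h3] at hB
  refine Fm.ite_ok rfl
    (by simp [Fm.bdd, ballF, Fm.ex, nearF, Fm.disj, adjF, Fm.eqN, NExp.eval, hIτ.n, hM])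
    (fun τ' hF hfr => Ok.setN ?_) (fun τ' hF hfr => Ok.setN ?_)
  all_goals
    have e1 : τ'.nat 26 = τ.nat 26 := hfr.1 26 (not_mem_of_elem rfl)
    have e2 : τ'.nat 6 = τ.nat 6 := hfr.1 6 (not_mem_of_elem rfl)
    rw [hB] at hF
    intro w hw
    rw [updN_nat (by decide), updN_at]
    simp only [NExp.eval, e1, e2, hτi]
    rcases Nat.lt_succ_iff_lt_or_eq.1 hw with hw | rfl
    · simp [hw.ne, hinv w hw]
    · simp [hF]

end pieces

end MPHC


namespace MPHC

section pieces

variable {h : ℕ} {I : Instance h} {σ : Store} {E : Env}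

open Prog

/-- Adjacency of vertices of `K` with equal labels. -/
def Inner {n : ℕ} (G : SimpleGraph (Fin n)) (K : ℕ → Prop) (x y z i j : ℕ) : Prop :=
  NAdj G i j ∧ lab G x y z i = lab G x y z j ∧ K i

theorem innerF_holds (hA : σ.nat 1 = adjM I.graph) {y z : ℕ} {i j : NExp} :
    (innerF y z i j).holds σ ↔ Inner I.graph (fun w => σ.nat 6 w 0 = 1) (σ.nat 3 0 0)
      (σ.nat y 0 0) (σ.nat z 0 0) (i.eval σ) (j.eval σ) := by
  simp only [innerF, Fm.holds, Fm.holds_eqN, holds_adjF hA, eval_labE hA, NExp.eval, Inner]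

/-- The vertices `x`, `y`, `z` dominate enough. -/
def Check {n : ℕ} (G : SimpleGraph (Fin n)) (K : ℕ → Prop) (x y z : ℕ) : Prop :=
  ∀ w < n, ∃ v < n, ∀ u < n, Inner G K x y z w u → NAdj G u v ∧ NAdj G w v

theorem checkF_holds (hI : Input I σ) {y z : ℕ} (hy : y < 40) (hz : z < 40) :
    (checkF y z).holds σ ↔
      Check I.graph (fun w => σ.nat 6 w 0 = 1) (σ.nat 3 0 0) (σ.nat y 0 0) (σ.nat z 0 0) := by
  have y0 : y ≠ 40 := by omega
  have y1 : y ≠ 41 := by omega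
  have y2 : y ≠ 42 := by omega
  have z0 : z ≠ 40 := by omega
  have z1 : z ≠ 41 := by omega
  have z2 : z ≠ 42 := by omega
  have hA : ∀ {i j k}, (((σ.updN 40 0 0 i).updN 41 0 0 j).updN 42 0 0 k).nat 1 = adjM I.graph := by
    intro i j k
    simp [updN_nat, hI.adj]
  simp only [checkF, Fm.holds, Fm.holds_ex, Fm.holds_imp, innerF_holds hA, holds_adjF hA, Check]
  simp [updN_nat, hI.n, NExp.eval, y0, y1, y2, z0, z1, z2]

theorem search_ok (hI : Input I σ) (hM : I.n ≤ E.iter)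
    (hex : ∃ y < I.n, ∃ z < I.n, Check I.graph (fun w => σ.nat 6 w 0 = 1) (σ.nat 3 0 0) y z) :
    Ok E search σ fun τ => τ.nat 4 0 0 < I.n ∧ τ.nat 5 0 0 < I.n ∧
      Check I.graph (fun w => σ.nat 6 w 0 = 1) (σ.nat 3 0 0) (τ.nat 4 0 0) (τ.nat 5 0 0) := by
  set P : Store → Prop := fun τ => τ.nat 4 0 0 < I.n ∧ τ.nat 5 0 0 < I.n ∧
    Check I.graph (fun w => σ.nat 6 w 0 = 1) (σ.nat 3 0 0) (τ.nat 4 0 0) (τ.nat 5 0 0) with hP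
  set R := Check I.graph (fun w => σ.nat 6 w 0 = 1) (σ.nat 3 0 0) with hR
  unfold search
  -- Later successes overwrite earlier ones, so the invariant is conditional: once some pair tried
  -- has passed, the stored pair passes.
  refine (Ok.forC (N := I.n) (by exact hI.n) hM rfl rfl
    (fun i τ => (∃ y < i, ∃ z < I.n, R y z) → P τ) (by simp) ?_).mono fun τ hτ => hτ hex
  intro i τ hi hτi hN hR' hinv
  have hIτ : Input I τ := hI.of_frame (hN 0 (not_mem_of_elem rfl)) (hN 1 (not_mem_of_elem rfl))
    (hR' 0 (not_mem_of_elem rfl))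
  have h3 : τ.nat 3 = σ.nat 3 := hN 3 (not_mem_of_elem rfl)
  have h6 : τ.nat 6 = σ.nat 6 := hN 6 (not_mem_of_elem rfl)
  refine (Ok.forC (N := I.n) (by exact hIτ.n) hM rfl rfl
    (fun j τ => ((∃ y < i, ∃ z < I.n, R y z) ∨ ∃ z < j, R i z) → P τ) ?_ ?_).mono ?_
  · rintro (hh | ⟨z, hz, -⟩)
    · exact hinv hh
    · omega
  · intro j τ₁ hj hτj hN1 hR1 hinv1
    have hI1 : Input I τ₁ := hIτ.of_frame (hN1 0 (not_mem_of_elem rfl))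
      (hN1 1 (not_mem_of_elem rfl)) (hR1 0 (not_mem_of_elem rfl))
    have g3 : τ₁.nat 3 = τ.nat 3 := hN1 3 (not_mem_of_elem rfl)
    have g6 : τ₁.nat 6 = τ.nat 6 := hN1 6 (not_mem_of_elem rfl)
    have g27 : τ₁.nat 27 = τ.nat 27 := hN1 27 (not_mem_of_elem rfl)
    have hC := checkF_holds hI1 (y := 27) (z := 28) (by decide) (by decide)
    rw [g3, g6, h3, h6, g27, hτi, hτj, ← hR] at hC
    refine Fm.ite_ok rfl
      (by simp [Fm.bdd, checkF, Fm.ex, Fm.imp, innerF, adjF, Fm.eqN, NExp.eval, hI1.n, hM])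
      (fun τ' hF hfr => Ok.seq (Ok.setN (Ok.setN fun _ => ?_))) (fun τ' hF hfr => Ok.skip ?_)
    · have e1 : τ'.nat 27 = τ₁.nat 27 := hfr.1 27 (not_mem_of_elem rfl)
      have e2 : τ'.nat 28 = τ₁.nat 28 := hfr.1 28 (not_mem_of_elem rfl)
      have hF' := hC.1 hF
      simp [hP, NExp.eval, updN_nat, e1, e2, g27, hτi, hτj, hi, hj, hF']
    · intro hh
      have e1 : τ'.nat 4 = τ₁.nat 4 := hfr.1 4 (not_mem_of_elem rfl)
      have e2 : τ'.nat 5 = τ₁.nat 5 := hfr.1 5 (not_mem_of_elem rfl)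
      have : P τ₁ := hinv1 (hh.imp_right fun ⟨z, hz, hz'⟩ => ⟨z, by
        rcases Nat.lt_succ_iff_lt_or_eq.1 hz with h | rfl
        · exact h
        · exact absurd (hC.2 hz') hF, hz'⟩)
      simpa [hP, updN_nat, e1, e2] using this
  · rintro τ' hτ' ⟨y, hy, z, hz, hyz⟩
    have : P τ' := hτ' (by
      rcases Nat.lt_succ_iff_lt_or_eq.1 hy with h | rfl
      · exact .inl ⟨y, h, z, hz, hyz⟩
      · exact .inr ⟨z, hz, hyz⟩)
    simpa [hP, updN_nat] using this

open Classical in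
theorem subgraph_ok (hI : Input I σ) (hM : I.n ≤ E.iter) : Ok E subgraph σ fun τ =>
    ∀ i < I.n, ∀ j < I.n, τ.nat 7 i j = if Inner I.graph (fun w => σ.nat 6 w 0 = 1) (σ.nat 3 0 0)
      (σ.nat 4 0 0) (σ.nat 5 0 0) i j then 1 else 0 := by
  set R := Inner I.graph (fun w => σ.nat 6 w 0 = 1) (σ.nat 3 0 0) (σ.nat 4 0 0) (σ.nat 5 0 0)
    with hR
  unfold subgraph
  refine Ok.forC (N := I.n) (by exact hI.n) hM rfl rfl
    (fun i τ => ∀ i' < i, ∀ j < I.n, τ.nat 7 i' j = if R i' j then 1 else 0) (by simp) ?_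
  intro i τ hi hτi hN hR' hinv
  have hIτ : Input I τ := hI.of_frame (hN 0 (not_mem_of_elem rfl)) (hN 1 (not_mem_of_elem rfl))
    (hR' 0 (not_mem_of_elem rfl))
  have h3 : τ.nat 3 = σ.nat 3 := hN 3 (not_mem_of_elem rfl)
  have h4 : τ.nat 4 = σ.nat 4 := hN 4 (not_mem_of_elem rfl)
  have h5 : τ.nat 5 = σ.nat 5 := hN 5 (not_mem_of_elem rfl)
  have h6 : τ.nat 6 = σ.nat 6 := hN 6 (not_mem_of_elem rfl)
  refine (Ok.forC (N := I.n) (by exact hIτ.n) hM rfl rfl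
    (fun j τ => ∀ i' j', (i' < i ∧ j' < I.n) ∨ (i' = i ∧ j' < j) →
      τ.nat 7 i' j' = if R i' j' then 1 else 0) ?_ ?_).mono ?_
  · rintro i' j' (hh | hh)
    · rw [updN_nat (by decide)]
      exact hinv i' hh.1 j' hh.2
    · omega
  · intro j τ₁ hj hτj hN1 hR1 hinv1
    have hI1 : Input I τ₁ := hIτ.of_frame (hN1 0 (not_mem_of_elem rfl))
      (hN1 1 (not_mem_of_elem rfl)) (hR1 0 (not_mem_of_elem rfl))
    have g3 : τ₁.nat 3 = τ.nat 3 := hN1 3 (not_mem_of_elem rfl)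
    have g4 : τ₁.nat 4 = τ.nat 4 := hN1 4 (not_mem_of_elem rfl)
    have g5 : τ₁.nat 5 = τ.nat 5 := hN1 5 (not_mem_of_elem rfl)
    have g6 : τ₁.nat 6 = τ.nat 6 := hN1 6 (not_mem_of_elem rfl)
    have g29 : τ₁.nat 29 = τ.nat 29 := hN1 29 (not_mem_of_elem rfl)
    have hC := innerF_holds hI1.adj (y := 4) (z := 5) (i := .var 29) (j := .var 30)
    simp only [NExp.eval] at hC
    rw [g3, g4, g5, g6, h3, h4, h5, h6, g29, hτi, hτj, ← hR] at hC
    refine Fm.ite_ok rfl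
      (by simp [Fm.bdd, innerF, adjF, Fm.eqN])
      (fun τ' hF hfr => Ok.setN ?_) (fun τ' hF hfr => Ok.setN ?_)
    all_goals
      have e1 : τ'.nat 29 = τ₁.nat 29 := hfr.1 29 (not_mem_of_elem rfl)
      have e2 : τ'.nat 30 = τ₁.nat 30 := hfr.1 30 (not_mem_of_elem rfl)
      have e7 : τ'.nat 7 = τ₁.nat 7 := hfr.1 7 (not_mem_of_elem rfl)
      rw [hC] at hF
      intro i' j' hh
      rw [updN_nat (by decide), updN_at]
      simp only [NExp.eval, e1, e2, e7, hτi, hτj, g29]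
      by_cases hc : i' = i ∧ j' = j
      · obtain ⟨rfl, rfl⟩ := hc
        simp [hF]
      · rw [if_neg hc]
        exact hinv1 i' j' (by omega)
  · intro τ' hτ' i' hi' j' hj'
    rw [updN_nat (by decide)]
    exact hτ' i' j' (by omega)

theorem holds_covF (hI : Input I σ) {j : ℕ} {a w : NExp} (hj : 40 < j)
    (ha : ∀ i, a.eval (σ.updN j 0 0 i) = a.eval σ) (hw : ∀ i, w.eval (σ.updN j 0 0 i) = w.eval σ) :
    (covF j a w).holds σ ↔
      Cov I.graph (σ.nat 10 0 0) (fun i => σ.nat 8 i 0) (a.eval σ) (w.eval σ) := by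
  have hA : ∀ {i}, (σ.updN j 0 0 i).nat 1 = adjM I.graph := by
    intro i
    rw [updN_nat (by omega), hI.adj]
  have j1 : 10 ≠ j := by omega
  have j2 : 8 ≠ j := by omega
  simp only [covF, Fm.holds_ex, Fm.holds, Fm.holds_eqN, holds_adjF hA, Cov, ha, hw]
  simp [updN_nat, NExp.eval, j1, j2]

theorem allowedF_holds {H : SimpleGraph (Fin h)} (hI : Input I σ)
    (hH : ∀ a < h, ∀ b < h, σ.nat 11 a b = 1 ↔ NAdj H a b) (ha : σ.nat 32 0 0 < h) :
    (allowedF h (.var 31) (.var 32)).holds σ ↔ Allowed I.graph H (fun w => σ.nat 6 w 0 = 1)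
      (lab I.graph (σ.nat 3 0 0) (σ.nat 4 0 0) (σ.nat 5 0 0)) (σ.nat 10 0 0)
      (fun i => σ.nat 8 i 0) (σ.nat 31 0 0) (σ.nat 32 0 0) := by
  have hI1 : ∀ {i}, Input I (σ.updN 40 0 0 i) := fun {i} =>
    hI.of_frame (updN_nat (by decide)) (updN_nat (by decide)) rfl
  have hI2 : ∀ {i}, Input I (σ.updN 43 0 0 i) := fun {i} =>
    hI.of_frame (updN_nat (by decide)) (updN_nat (by decide)) rfl
  have hc1 : ∀ {i}, (covF 41 (.var 32) (.var 40)).holds (σ.updN 40 0 0 i) ↔ _ := fun {i} =>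
    holds_covF hI1 (by decide) (by simp [NExp.eval, updN_nat]) (by simp [NExp.eval, updN_nat])
  have hc2 : ∀ {i}, (covF 44 (.var 43) (.var 31)).holds (σ.updN 43 0 0 i) ↔ _ := fun {i} =>
    holds_covF hI2 (by decide) (by simp [NExp.eval, updN_nat]) (by simp [NExp.eval, updN_nat])
  simp only [allowedF, Fm.holds, Fm.holds_eqN, Fm.holds_imp, holds_adjF hI1.adj, BExp.holds,
    eval_labE hI1.adj, hc1, hc2, Allowed]
  simp only [NExp.eval, updN_same]
  simp only [updN_nat, ne_eq, not_false_eq_true, Nat.reduceEqDiff, hI.n, not_le]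
  refine and_congr_right fun _ => and_congr_right fun _ => ?_
  exact forall₂_congr fun b hb => imp_congr_right fun _ => hH _ ha _ hb

open Classical in
theorem restrict_ok {H : SimpleGraph (Fin h)} (hI : Input I σ) (hM : I.n ≤ E.iter)
    (hh : h ≤ E.iter) (hm : σ.nat 10 0 0 ≤ E.iter)
    (hH : ∀ a < h, ∀ b < h, σ.nat 11 a b = 1 ↔ NAdj H a b) : Ok E (restrict h) σ fun τ =>
    ∀ v < I.n, ∀ a < h, τ.real 1 v a = if Allowed I.graph H (fun w => σ.nat 6 w 0 = 1)
      (lab I.graph (σ.nat 3 0 0) (σ.nat 4 0 0) (σ.nat 5 0 0)) (σ.nat 10 0 0)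
      (fun i => σ.nat 8 i 0) v a then revM I.rev v a else -1 := by
  set R := Allowed I.graph H (fun w => σ.nat 6 w 0 = 1)
      (lab I.graph (σ.nat 3 0 0) (σ.nat 4 0 0) (σ.nat 5 0 0)) (σ.nat 10 0 0)
      (fun i => σ.nat 8 i 0) with hR
  unfold restrict
  refine Ok.forC (N := I.n) (by exact hI.n) hM rfl rfl
    (fun i τ => ∀ v < i, ∀ a < h, τ.real 1 v a = if R v a then revM I.rev v a else -1)
    (by simp) ?_
  intro i τ hi hτi hN hR' hinv
  have hIτ : Input I τ := hI.of_frame (hN 0 (not_mem_of_elem rfl)) (hN 1 (not_mem_of_elem rfl))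
    (hR' 0 (not_mem_of_elem rfl))
  refine (Ok.forC (N := h) (by rfl) hh rfl rfl
    (fun j τ => ∀ v a, (v < i ∧ a < h) ∨ (v = i ∧ a < j) →
      τ.real 1 v a = if R v a then revM I.rev v a else -1) ?_ ?_).mono ?_
  · rintro i' j' (hh | hh)
    · exact hinv i' hh.1 j' hh.2
    · omega
  · intro j τ₁ hj hτj hN1 hR1 hinv1
    have hI1 : Input I τ₁ := hIτ.of_frame (hN1 0 (not_mem_of_elem rfl))
      (hN1 1 (not_mem_of_elem rfl)) (hR1 0 (not_mem_of_elem rfl))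
    have g31 : τ₁.nat 31 = τ.nat 31 := hN1 31 (not_mem_of_elem rfl)
    have g3 : τ₁.nat 3 = σ.nat 3 :=
      (hN1 3 (not_mem_of_elem rfl)).trans (hN 3 (not_mem_of_elem rfl))
    have g4 : τ₁.nat 4 = σ.nat 4 :=
      (hN1 4 (not_mem_of_elem rfl)).trans (hN 4 (not_mem_of_elem rfl))
    have g5 : τ₁.nat 5 = σ.nat 5 :=
      (hN1 5 (not_mem_of_elem rfl)).trans (hN 5 (not_mem_of_elem rfl))
    have g6 : τ₁.nat 6 = σ.nat 6 :=
      (hN1 6 (not_mem_of_elem rfl)).trans (hN 6 (not_mem_of_elem rfl))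
    have g8 : τ₁.nat 8 = σ.nat 8 :=
      (hN1 8 (not_mem_of_elem rfl)).trans (hN 8 (not_mem_of_elem rfl))
    have g10 : τ₁.nat 10 = σ.nat 10 :=
      (hN1 10 (not_mem_of_elem rfl)).trans (hN 10 (not_mem_of_elem rfl))
    have g11 : τ₁.nat 11 = σ.nat 11 :=
      (hN1 11 (not_mem_of_elem rfl)).trans (hN 11 (not_mem_of_elem rfl))
    have hC := allowedF_holds (H := H) hI1 (by rw [g11]; exact hH) (by rw [hτj]; exact hj)
    rw [g3, g4, g5, g6, g8, g10, g31, hτi, hτj, ← hR] at hC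
    refine Fm.ite_ok rfl
      (by simp [Fm.bdd, allowedF, covF, Fm.ex, Fm.imp, adjF, Fm.eqN, NExp.eval, hI1.n, hM, hh, g10,
        hm])
      (fun τ' hF hfr => Ok.setR ?_) (fun τ' hF hfr => Ok.setR ?_)
    all_goals
      have e1 : τ'.nat 31 = τ₁.nat 31 := hfr.1 31 (not_mem_of_elem rfl)
      have e2 : τ'.nat 32 = τ₁.nat 32 := hfr.1 32 (not_mem_of_elem rfl)
      have e0 : τ'.real 0 = τ₁.real 0 := hfr.2 0 (not_mem_of_elem rfl)
      have e7 : τ'.real 1 = τ₁.real 1 := hfr.2 1 (not_mem_of_elem rfl)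
      rw [hC] at hF
      intro i' j' hh
      rw [updN_real, updR_at]
      simp only [NExp.eval, revE, RExp.eval, e0, e1, e2, e7, hτi, hτj, g31, hI1.rev]
      by_cases hc : i' = i ∧ j' = j
      · obtain ⟨rfl, rfl⟩ := hc
        simp [hF]
      · rw [if_neg hc]
        exact hinv1 i' j' (by omega)
  · intro τ' hτ' i' hi' j' hj'
    exact hτ' i' j' (by omega)

theorem value_ok (hI : Input I σ) (hM : I.n ≤ E.iter) : Ok E value σ fun τ =>
    τ.real 2 0 0 = ∑ v ∈ Finset.range I.n,
      if 1 ≤ σ.nat 9 v 0 then revM I.rev v (σ.nat 9 v 0 - 1) else 0 := by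
  unfold value
  refine Ok.seq (Ok.setR ?_)
  refine Ok.forC (N := I.n) (by exact hI.n) hM rfl rfl
    (fun i τ => τ.real 2 0 0 = ∑ v ∈ Finset.range i,
      if 1 ≤ σ.nat 9 v 0 then revM I.rev v (σ.nat 9 v 0 - 1) else 0)
    (by simp [NExp.eval, RExp.eval]) ?_
  intro i τ hi hτi hN hR hinv
  have h9 : τ.nat 9 = σ.nat 9 := hN 9 (not_mem_of_elem rfl)
  have hr : τ.real 0 = σ.real 0 := by
    rw [hR 0 (not_mem_of_elem rfl), updR_real (by decide)]
  refine Ok.ite (fun hb => Ok.setR ?_) (fun hb => Ok.skip ?_)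
  · simp only [BExp.holds, NExp.eval, hτi, h9] at hb
    simp [NExp.eval, RExp.eval, revE, Finset.sum_range_succ, hinv, hb, hτi, h9, hr, hI.rev]
  · simp only [BExp.holds, NExp.eval, hτi, h9] at hb
    simp [Finset.sum_range_succ, hinv, hb]

theorem update_ok (hI : Input I σ) (hM : I.n ≤ E.iter) : Ok E update σ fun τ =>
    (σ.real 2 0 0 ≤ σ.real 3 0 0 ∧ τ = σ) ∨ (σ.real 3 0 0 < σ.real 2 0 0 ∧
      τ.real 3 0 0 = σ.real 2 0 0 ∧
      ∀ v < I.n, τ.nat 2 v 0 = if 1 ≤ σ.nat 6 v 0 then σ.nat 9 v 0 else σ.nat 2 v 0) := by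
  unfold update
  refine Ok.ite (fun hb => ?_) (fun hb => Ok.skip ?_)
  · simp only [BExp.holds, RExp.eval, NExp.eval, not_le] at hb
    refine Ok.seq (Ok.setR ?_)
    refine (Ok.forC (N := I.n) (by exact hI.n) hM rfl rfl
      (fun i τ => (∀ v < i, τ.nat 2 v 0 = if 1 ≤ σ.nat 6 v 0 then σ.nat 9 v 0 else σ.nat 2 v 0) ∧
        ∀ v, i ≤ v → τ.nat 2 v 0 = σ.nat 2 v 0) ?_ ?_).frame.mono ?_
    · simp [updN_nat]
    · rintro i τ hi hτi hN hR ⟨hinv, hinv'⟩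
      have h6 : τ.nat 6 = σ.nat 6 := hN 6 (not_mem_of_elem rfl)
      have h9 : τ.nat 9 = σ.nat 9 := hN 9 (not_mem_of_elem rfl)
      refine Ok.ite (fun hb => Ok.setN ?_) (fun hb => Ok.skip ?_)
      · simp only [BExp.holds, NExp.eval, hτi, h6] at hb
        rw [updN_nat (by decide)]
        simp only [updN_at, NExp.eval, hτi, h9, and_true]
        refine ⟨fun v hv => ?_, fun v hv => ?_⟩
        · by_cases hvi : v = i
          · subst hvi
            simp [hb]
          · rw [if_neg hvi]
            exact hinv v (by omega)
        · rw [if_neg (by omega)]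
          exact hinv' v (by omega)
      · simp only [BExp.holds, NExp.eval, hτi, h6] at hb
        rw [updN_nat (by decide)]
        refine ⟨fun v hv => ?_, fun v hv => hinv' v (by omega)⟩
        by_cases hvi : v = i
        · subst hvi
          rw [if_neg hb]
          exact hinv' v le_rfl
        · exact hinv v (by omega)
    · rintro τ ⟨hfr, hτ, -⟩
      refine .inr ⟨hb, ?_, hτ⟩
      rw [hfr.2 3 (not_mem_of_elem rfl)]
      simp [RExp.eval, NExp.eval]
  · simp only [BExp.holds, RExp.eval, NExp.eval, not_le, not_lt] at hb
    exact .inl ⟨hb, rfl⟩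

/-- Array `8` is a counter in base `B`, least significant digit first, and variable `12` is the
carry. The carry into position `i` is present exactly if `B ^ i` divides `e + 1`. -/
theorem next_ok (hI : Input I σ) {e m B : ℕ} (hm : σ.nat 10 0 0 = m) (hM : m + m ≤ E.iter)
    (hB : B = I.n + h + 1) (hσ : ∀ i < m + m, σ.nat 8 i 0 = e / B ^ i % B) :
    Ok E (next h) σ fun τ => (∀ i < m + m, τ.nat 8 i 0 = (e + 1) / B ^ i % B) ∧
      τ.nat 12 0 0 = if B ^ (m + m) ∣ e + 1 then 1 else 0 := by
  unfold next
  refine Ok.seq (Ok.setN ?_)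
  refine (Ok.forC (N := m + m) (by simp [NExp.eval, updN_nat, hm]) hM rfl rfl
    (fun i τ => (∀ j < i, τ.nat 8 j 0 = (e + 1) / B ^ j % B) ∧
      (∀ j < m + m, i ≤ j → τ.nat 8 j 0 = e / B ^ j % B) ∧
      τ.nat 12 0 0 = if B ^ i ∣ e + 1 then 1 else 0) ?_ ?_).mono fun τ hτ => ⟨hτ.1, hτ.2.2⟩
  · refine ⟨by simp, fun j hj _ => ?_, ?_⟩
    · simpa [updN_nat] using hσ j hj
    · simp [updN_nat, NExp.eval]
  · rintro i τ hi hτi hN hR ⟨h1, h2, h3⟩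
    have h0 : τ.nat 0 0 0 = I.n := by
      rw [hN 0 (not_mem_of_elem rfl), updN_nat (by decide), hI.n]
    have hBpos : 0 < B := by omega
    have hlt : e / B ^ i % B < B := Nat.mod_lt _ hBpos
    have hdig : (e + 1) / B ^ i = e / B ^ i + if B ^ i ∣ e + 1 then 1 else 0 := Nat.succ_div
    -- A carry that enters position `i` leaves it exactly if the digit there is `B - 1`.
    have hdvd : B ^ i ∣ e + 1 → (B ^ (i + 1) ∣ e + 1 ↔ e / B ^ i % B + 1 = B) := by
      intro hd
      rw [if_pos hd] at hdig
      rw [pow_succ, ← Nat.dvd_div_iff_mul_dvd hd, hdig]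
      constructor
      · intro hk
        by_contra hne
        have hlt' : e / B ^ i % B + 1 < B := by omega
        have := Nat.mod_eq_zero_of_dvd hk
        rw [Nat.add_mod, Nat.mod_eq_of_lt (a := 1) (by omega), Nat.mod_eq_of_lt hlt'] at this
        omega
      · intro hk
        refine Nat.dvd_of_mod_eq_zero ?_
        have := Nat.div_add_mod (e / B ^ i) B
        rw [← this, add_assoc, hk]
        simp
    have hi2 := h2 i hi le_rfl
    refine Ok.ite (fun hb => Ok.ite (fun hb' => Ok.seq (Ok.setN (Ok.setN ?_)))
      (fun hb' => Ok.setN ?_)) (fun hb => Ok.skip ?_)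
    · simp only [BExp.holds, NExp.eval, h3, hτi, hi2, h0] at hb hb'
      have hd : B ^ i ∣ e + 1 := by
        by_contra hc
        simp [hc] at hb
      rw [if_pos hd] at hdig
      have hnd : ¬ B ^ (i + 1) ∣ e + 1 := by
        rw [hdvd hd]
        omega
      simp only [NExp.eval, updN_same, updN_nat, ne_eq, Nat.reduceEqDiff, not_false_eq_true, hτi,
        hi2, hnd, if_false, updN_at, and_true]
      refine ⟨fun j hj => ?_, fun j hj hij => ?_⟩
      · by_cases hji : j = i
        · subst hji
          rw [if_pos rfl, hdig, Nat.add_mod, Nat.mod_eq_of_lt (show 1 < B by omega),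
            Nat.mod_eq_of_lt (show e / B ^ j % B + 1 < B by omega)]
        · rw [if_neg hji]
          exact h1 j (by omega)
      · rw [if_neg (by omega)]
        exact h2 j hj (by omega)
    · simp only [BExp.holds, NExp.eval, h3, hτi, hi2, h0] at hb hb'
      have hd : B ^ i ∣ e + 1 := by
        by_contra hc
        simp [hc] at hb
      rw [if_pos hd] at hdig
      have hnd : B ^ (i + 1) ∣ e + 1 := by
        rw [hdvd hd]
        omega
      simp only [NExp.eval, updN_nat, ne_eq, Nat.reduceEqDiff, not_false_eq_true, hτi,
        hnd, if_true, updN_at, and_true]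
      refine ⟨fun j hj => ?_, fun j hj hij => ?_, ?_⟩
      · by_cases hji : j = i
        · subst hji
          rw [if_pos rfl]
          have := Nat.mod_eq_zero_of_dvd ((Nat.dvd_div_iff_mul_dvd hd).2 (pow_succ B j ▸ hnd))
          exact this.symm
        · rw [if_neg hji]
          exact h1 j (by omega)
      · rw [if_neg (by omega)]
        exact h2 j hj (by omega)
      · rw [h3, if_pos hd]
    · simp only [BExp.holds, NExp.eval, h3] at hb
      have hd : ¬ B ^ i ∣ e + 1 := by
        intro hc
        simp [hc] at hb
      have hnd : ¬ B ^ (i + 1) ∣ e + 1 := fun hc => hd ((pow_dvd_pow B (by omega)).trans hc)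
      rw [if_neg hd] at hdig
      simp only [updN_nat, ne_eq, Nat.reduceEqDiff, not_false_eq_true, hnd, if_false]
      refine ⟨fun j hj => ?_, fun j hj hij => h2 j hj (by omega), by rw [h3, if_neg hd]⟩
      by_cases hji : j = i
      · subst hji
        rw [hi2, hdig, add_zero]
      · exact h1 j (by omega)

end pieces

end MPHC


namespace MPHC

/-! ### Solving the problem on a component -/

section colour

variable {n h : ℕ}

/-- The instance for the recursive call. -/
def innerGraph (G : SimpleGraph (Fin n)) (K : ℕ → Prop) (x y z : ℕ) : SimpleGraph (Fin n) :=
  SimpleGraph.fromRel fun u v => Inner G K x y z u v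

open Classical in
noncomputable def restrictedRev (rev : Fin n → Fin h → ℝ) (P : ℕ → ℕ → Prop) (v : Fin n)
    (a : Fin h) : ℝ :=
  if P v a then rev v a else -1

theorem revenueOn_congr {K : ℕ → Prop} {rev : Fin n → Fin h → ℝ} {φ ψ : Fin n → Option (Fin h)}
    (hφ : ∀ v : Fin n, K v → φ v = ψ v) : revenueOn K rev φ = revenueOn K rev ψ := by
  refine Finset.sum_congr rfl fun v _ => ?_
  split_ifs with hv
  · rw [hφ v hv]
  · rfl

variable {G : SimpleGraph (Fin n)} {H : SimpleGraph (Fin h)} {K : ℕ → Prop} {x y z m : ℕ}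
  {f : ℕ → ℕ} {rev : Fin n → Fin h → ℝ} {φ : Fin n → Option (Fin h)} {s t : ℕ}

/-- The optimum of the restricted instance uses allowed colours only, so it is proper in `G`, lives
on `K`, and has the same value for both revenue functions. Any `ψ` that follows the guess on `K`
competes with it after being restricted to `K`. -/
theorem IsOptimum.restricted_spec (hφ : IsOptimum H ⟨s, t, n, innerGraph G K x y z,
      restrictedRev rev (Allowed G H K (lab G x y z) m f)⟩ φ) :
    IsPartialColoring G H φ ∧ 0 ≤ revenue rev φ ∧ revenueOn K rev φ = revenue rev φ ∧
    ∀ ψ, IsPartialColoring G H ψ →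
      (∀ (v : Fin n) (a : Fin h), K v → ψ v = some a → Allowed G H K (lab G x y z) m f v a) →
      revenueOn K rev ψ ≤ revenue rev φ := by
  classical
  obtain ⟨h1, h2⟩ := hφ.of_restricted (G := G) (K := K) (l := lab G x y z) (m := m) (f := f)
    (fun u v hu huv hl => by
      rw [innerGraph, SimpleGraph.fromRel_adj]
      exact ⟨huv.ne, .inl ⟨nAdj_val.2 huv, hl, hu⟩⟩)
    (fun v a hva => by simp only [restrictedRev, if_neg hva])
  have hrev : revenue (restrictedRev rev (Allowed G H K (lab G x y z) m f)) φ = revenue rev φ := by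
    refine Finset.sum_congr rfl fun v _ => ?_
    cases hv : φ v with
    | none => rfl
    | some a =>
      show restrictedRev rev (Allowed G H K (lab G x y z) m f) v a = rev v a
      rw [restrictedRev, if_pos (h2 v a hv)]
  refine ⟨h1, ?_, ?_, ?_⟩
  · rw [← hrev]
    exact isOptimum_nonneg hφ
  · refine Finset.sum_congr rfl fun v _ => ?_
    split_ifs with hv
    · rfl
    · cases hv' : φ v with
      | none => rfl
      | some a => exact absurd (h2 v a hv').1 hv
  · intro ψ hψ hall
    rw [← hrev]
    have hcol : IsPartialColoring (innerGraph G K x y z) H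
        (fun v => if K v then ψ v else none) := by
      intro u v huv a b ha hb
      have hadj : G.Adj u v := by
        rw [innerGraph, SimpleGraph.fromRel_adj] at huv
        rcases huv.2 with hh | hh
        · exact nAdj_val.1 hh.1
        · exact (nAdj_val.1 hh.1).symm
      dsimp only at ha hb
      split_ifs at ha hb
      exact hψ u v hadj a b ha hb
    refine le_of_eq_of_le ?_ (hφ.2 _ hcol)
    refine Finset.sum_congr rfl fun v _ => ?_
    dsimp only
    split_ifs with hv
    · cases hv' : ψ v with
      | none => rfl
      | some a =>
        show rev v a = restrictedRev rev (Allowed G H K (lab G x y z) m f) v a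
        rw [restrictedRev, if_pos (hall v a hv hv')]
    · rfl

theorem answer_congr {σ τ : Store} {u : Fin n} {i : ℕ → ℕ → ℕ} (hτ : i = τ.nat 2)
    (h2 : σ.nat 2 u 0 = i u 0) : σ.answer n h u = τ.answer n h u := by
  subst hτ
  simp only [Store.answer, h2]

/-- Entries beyond the range of colours count as uncoloured on one side and meet the zero extension
of `revM` on the other. -/
theorem revM_answer {σ : Store} {rev : Fin n → Fin h → ℝ} (u : Fin n) :
    (if 1 ≤ σ.nat 2 u 0 then revM rev u (σ.nat 2 u 0 - 1) else 0) =
      (σ.answer n h u).elim 0 (rev u) := by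
  simp only [Store.answer]
  cases hk : σ.nat 2 u 0 with
  | zero => simp
  | succ k => by_cases hkh : k < h <;> simp [revM, hkh]

end colour

section component

open Prog

variable {E : Env} {H : SimpleGraph (Fin E.h)} {I : Instance E.h} {σ : Store}

/-- The program solves the instances with the graph `G'` within the limits. -/
def Solves (E : Env) (H : SimpleGraph (Fin E.h)) (I : Instance E.h) (G' : SimpleGraph (Fin I.n)) :
    Prop :=
  ∀ rev', ∃ τ k, Exec E.h E.prog E.prog (Store.load ⟨I.s, I.t, I.n, G', rev'⟩) τ k ∧
    k.own ≤ E.peak ∧ k.total ≤ E.total ∧ k.depth + 1 ≤ E.depth ∧ k.peak ≤ E.peak ∧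
    IsOptimum H ⟨I.s, I.t, I.n, G', rev'⟩ (τ.answer I.n E.h)

-- The best value and the stored solution change together or not at all. Colours outside `K` are
-- kept, as they may belong to components already solved.
open Classical in
theorem guess_ok (hI : Input I σ) {K : ℕ → Prop} {x y z m e B : ℕ}
    (hK : K = fun w => σ.nat 6 w 0 = 1) (hx : σ.nat 3 0 0 = x) (hy : σ.nat 4 0 0 = y)
    (hz : σ.nat 5 0 0 = z) (hm : σ.nat 10 0 0 = m) (hB : B = I.n + E.h + 1)
    (hK01 : ∀ w < I.n, σ.nat 6 w 0 ≤ 1)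
    (hG' : ∀ i < I.n, ∀ j < I.n, σ.nat 7 i j = if Inner I.graph K x y z i j then 1 else 0)
    (hH : ∀ a < E.h, ∀ b < E.h, σ.nat 11 a b = 1 ↔ NAdj H a b)
    (hM : I.n ≤ E.iter) (hMh : E.h ≤ E.iter) (hMm : m + m ≤ E.iter)
    (hσ : ∀ i < m + m, σ.nat 8 i 0 = e / B ^ i % B)
    (hcall : Solves E H I (innerGraph I.graph K x y z)) :
    Ok E (guess E.h) σ fun τ =>
      (∃ φ, IsOptimum H ⟨I.s, I.t, I.n, innerGraph I.graph K x y z, restrictedRev I.rev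
        (Allowed I.graph H K (lab I.graph x y z) m fun i => σ.nat 8 i 0)⟩ φ ∧
        ((revenue I.rev φ ≤ σ.real 3 0 0 ∧ τ.real 3 0 0 = σ.real 3 0 0 ∧ τ.nat 2 = σ.nat 2) ∨
          (σ.real 3 0 0 < revenue I.rev φ ∧ τ.real 3 0 0 = revenue I.rev φ ∧
            ∀ v, τ.answer I.n E.h v = if K v then φ v else σ.answer I.n E.h v))) ∧
      (∀ i < m + m, τ.nat 8 i 0 = (e + 1) / B ^ i % B) ∧
      τ.nat 12 0 0 = if B ^ (m + m) ∣ e + 1 then 1 else 0 := by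
  unfold guess
  refine Ok.seq ((restrict_ok (H := H) hI hM hMh (by omega) hH).frame.mono ?_)
  rintro σ₁ ⟨f1, hr1⟩
  have hI1 : Input I σ₁ := hI.of_frame (f1.1 0 (not_mem_of_elem rfl))
    (f1.1 1 (not_mem_of_elem rfl)) (f1.2 0 (not_mem_of_elem rfl))
  have h7 : σ₁.nat 7 = σ.nat 7 := f1.1 7 (not_mem_of_elem rfl)
  rw [← hK, hx, hy, hz, hm] at hr1
  set R := Allowed I.graph H K (lab I.graph x y z) m fun i => σ.nat 8 i 0 with hR
  obtain ⟨ρ, k, c1, c2, c3, c4, c5, c6⟩ := hcall (restrictedRev I.rev R)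
  -- The arrays handed over encode precisely the restricted instance, so `hcall` applies to it.
  have harg : σ₁.arg E.h (nE.eval σ₁) (sE.eval σ₁) (tE.eval σ₁) 7 1 =
      ⟨I.s, I.t, I.n, innerGraph I.graph K x y z, restrictedRev I.rev R⟩ := by
    have e1 : nE.eval σ₁ = I.n := hI1.n
    have e2 : sE.eval σ₁ = I.s := hI1.s
    have e3 : tE.eval σ₁ = I.t := hI1.t
    rw [e1, e2, e3, Store.arg, innerGraph]
    congr 1
    · congr 1
      funext u v
      simp [h7, hG' u u.2 v v.2]
    · funext u a
      rw [hr1 u u.2 a a.2, restrictedRev]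
      simp [revM]
  refine Ok.seq (Ok.call (τ := ρ) (k := k) (le_of_eq_of_le hI1.n hM) (by rw [harg]; exact c1)
    c2 c3 c4 c5 ?_)
  have e1 : nE.eval σ₁ = I.n := hI1.n
  rw [e1]
  have hrec : ∀ a ≠ 9, (σ₁.receive ρ I.n 9).nat a = σ₁.nat a := by
    intro a ha
    funext i j
    simp [Store.receive, ha]
  have hrec9 : ∀ v < I.n, (σ₁.receive ρ I.n 9).nat 9 v 0 = ρ.nat 2 v 0 := by
    intro v hv
    simp [Store.receive, hv]
  have hI2 : Input I (σ₁.receive ρ I.n 9) :=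
    hI1.of_frame (hrec 0 (by decide)) (hrec 1 (by decide)) rfl
  refine Ok.seq ((value_ok hI2 hM).frame.mono ?_)
  rintro σ₂ ⟨f2, hval⟩
  have hI3 : Input I σ₂ := hI2.of_frame (f2.1 0 (not_mem_of_elem rfl))
    (f2.1 1 (not_mem_of_elem rfl)) (f2.2 0 (not_mem_of_elem rfl))
  have hval' : σ₂.real 2 0 0 = revenue I.rev (ρ.answer I.n E.h) := by
    rw [hval, revenue, Finset.sum_range]
    refine Finset.sum_congr rfl fun v _ => ?_
    rw [hrec9 v v.2]
    exact revM_answer v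
  refine Ok.seq ((update_ok hI3 hM).frame.mono ?_)
  rintro σ₃ ⟨f3, hupd⟩
  have hI4 : Input I σ₃ := hI3.of_frame (f3.1 0 (not_mem_of_elem rfl))
    (f3.1 1 (not_mem_of_elem rfl)) (f3.2 0 (not_mem_of_elem rfl))
  have g8 : σ₃.nat 8 = σ.nat 8 := by
    rw [f3.1 8 (not_mem_of_elem rfl), f2.1 8 (not_mem_of_elem rfl), hrec 8 (by decide),
      f1.1 8 (not_mem_of_elem rfl)]
  have g10 : σ₃.nat 10 = σ.nat 10 := by
    rw [f3.1 10 (not_mem_of_elem rfl), f2.1 10 (not_mem_of_elem rfl), hrec 10 (by decide),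
      f1.1 10 (not_mem_of_elem rfl)]
  have g6 : σ₂.nat 6 = σ.nat 6 := by
    rw [f2.1 6 (not_mem_of_elem rfl), hrec 6 (by decide), f1.1 6 (not_mem_of_elem rfl)]
  have g2 : σ₂.nat 2 = σ.nat 2 := by
    rw [f2.1 2 (not_mem_of_elem rfl), hrec 2 (by decide), f1.1 2 (not_mem_of_elem rfl)]
  have g9 : ∀ v < I.n, σ₂.nat 9 v 0 = ρ.nat 2 v 0 := by
    intro v hv
    rw [f2.1 9 (not_mem_of_elem rfl), hrec9 v hv]
  have r3 : σ₂.real 3 = σ.real 3 := by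
    rw [f2.2 3 (not_mem_of_elem rfl)]
    exact f1.2 3 (not_mem_of_elem rfl)
  refine (next_ok (h := E.h) hI4 (by rw [g10, hm]) hMm hB (by rw [g8]; exact hσ)).frame.mono ?_
  rintro τ ⟨f4, hn1, hn2⟩
  have k2 : τ.nat 2 = σ₃.nat 2 := f4.1 2 (not_mem_of_elem rfl)
  have k3 : τ.real 3 = σ₃.real 3 := f4.2 3 (not_mem_of_elem rfl)
  refine ⟨⟨_, c6, ?_⟩, hn1, hn2⟩
  rw [hval', r3] at hupd
  rcases hupd with ⟨u1, rfl⟩ | ⟨u1, u2, u3⟩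
  · exact .inl ⟨u1, by rw [k3, r3], by rw [k2, g2]⟩
  · refine .inr ⟨u1, by rw [k3, u2], fun v => ?_⟩
    have h6 := hK01 v v.2
    have u4 := u3 v v.2
    rw [g6, g9 v v.2, g2, ← k2] at u4
    have hKv : K v ↔ 1 ≤ σ.nat 6 v 0 := by
      rw [hK]
      show σ.nat 6 v 0 = 1 ↔ _
      omega
    split_ifs with hv
    · exact answer_congr rfl (by rw [u4, if_pos (hKv.1 hv)])
    · exact answer_congr rfl (by rw [u4, if_neg (fun hc => hv (hKv.2 hc))])

end component

end MPHC


namespace MPHC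

/-! ### The graph of the recursive call -/

section graph

variable {n h : ℕ} {G : SimpleGraph (Fin n)}

theorem ball_iff (hP : IndFree (SimpleGraph.pathGraph 6) G) (r w : Fin n) :
    Ball G r w ↔ G.Reachable r w := by
  rw [reachable_iff_of_free hP]
  constructor
  · rintro ⟨a, ha, b, hb, c, hc, h1, h2, h3, h4⟩
    refine ⟨⟨a, ha⟩, ⟨b, hb⟩, ⟨c, hc⟩, h1.imp ?_ ?_, h2.imp ?_ ?_, h3.imp ?_ ?_, h4.imp ?_ ?_⟩
    all_goals first | exact fun h => Fin.ext h | exact fun h => nAdj_val.1 h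
  · rintro ⟨a, b, c, h1, h2, h3, h4⟩
    refine ⟨a, a.2, b, b.2, c, c.2, h1.imp ?_ ?_, h2.imp ?_ ?_, h3.imp ?_ ?_, h4.imp ?_ ?_⟩
    all_goals first | exact fun h => congrArg Fin.val h | exact fun h => nAdj_val.2 h

/-- Classes 0, 1, 2 lie in the neighbourhoods of `r`, `y`, `z`. Class 3 is the case for which
`exists_dominating_triple` was made, and vertices outside `K` have no neighbours left. -/
theorem exists_check (hP : IndFree (SimpleGraph.pathGraph 6) G) {K : ℕ → Prop} {r : Fin n}
    (hK : ∀ w : Fin n, K w ↔ G.Reachable r w) : ∃ y < n, ∃ z < n, Check G K r y z := by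
  obtain ⟨y, z, hyz⟩ := exists_dominating_triple hP r
  refine ⟨y, y.2, z, z.2, fun w hw => ?_⟩
  by_cases hKw : K w
  swap
  · exact ⟨r, r.2, fun u _ hu => absurd hu.2.2 hKw⟩
  by_cases h0 : NAdj G r w
  · refine ⟨r, r.2, fun u hu hin => ?_⟩
    have hl := hin.2.1
    by_cases h1 : NAdj G r u
    · exact ⟨h1.symm, h0.symm⟩
    · simp only [lab, h0, h1, if_true, if_false] at hl
      split_ifs at hl
  by_cases h1 : NAdj G y w
  · refine ⟨y, y.2, fun u hu hin => ?_⟩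
    have hl := hin.2.1
    by_cases h2 : NAdj G y u
    · exact ⟨h2.symm, h1.symm⟩
    · simp only [lab, h0, h1, h2, if_true, if_false] at hl
      split_ifs at hl <;> simp at hl
  by_cases h2 : NAdj G z w
  · refine ⟨z, z.2, fun u hu hin => ?_⟩
    have hl := hin.2.1
    by_cases h3 : NAdj G z u
    · exact ⟨h3.symm, h2.symm⟩
    · simp only [lab, h0, h1, h2, h3, if_true, if_false] at hl
      split_ifs at hl <;> simp at hl
  have nv : ∀ (u : Fin n) {w : ℕ} {hw : w < n}, ¬ NAdj G u w → ¬ G.Adj u ⟨w, hw⟩ :=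
    fun u w hw hh hc => hh ((nAdj_val (v := ⟨w, hw⟩)).2 hc)
  obtain ⟨x, hx⟩ := hyz ⟨w, hw⟩ ((hK ⟨w, hw⟩).1 hKw) (nv r h0) (nv y h1) (nv z h2)
  refine ⟨x, x.2, fun u hu hin => ?_⟩
  have hl := hin.2.1
  simp only [lab, h0, h1, h2, if_false] at hl
  split_ifs at hl with g1 g2 g3
  · exact absurd hl (by decide)
  · exact absurd hl (by decide)
  · have := hx ⟨u, hu⟩ (nv r g1) (nv y g2) (nv z g3)
      ((nAdj_val (u := ⟨w, hw⟩) (v := ⟨u, hu⟩)).1 hin.1)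
    exact ⟨(nAdj_val (u := ⟨u, hu⟩)).2 this.1, (nAdj_val (u := ⟨w, hw⟩)).2 this.2⟩

variable {K : ℕ → Prop} {x y z : ℕ}

theorem innerGraph_adj (hK : ∀ u v : Fin n, G.Adj u v → K u → K v) {u v : Fin n} :
    (innerGraph G K x y z).Adj u v ↔ G.Adj u v ∧ lab G x y z u = lab G x y z v ∧ K u := by
  rw [innerGraph, SimpleGraph.fromRel_adj]
  constructor
  · rintro ⟨-, hh | hh⟩
    · exact ⟨nAdj_val.1 hh.1, hh.2⟩
    · exact ⟨(nAdj_val.1 hh.1).symm, hh.2.1.symm, hK _ _ (nAdj_val.1 hh.1) hh.2.2⟩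
  · rintro ⟨h1, h2, h3⟩
    exact ⟨h1.ne, .inl ⟨nAdj_val.2 h1, h2, h3⟩⟩

theorem innerGraph_le (hK : ∀ u v : Fin n, G.Adj u v → K u → K v) : innerGraph G K x y z ≤ G :=
  fun _ _ huv => ((innerGraph_adj hK).1 huv).1

/-- Labels and membership in `K` are constant along edges of the inner graph, so its components are
induced subgraphs of `G`. -/
theorem IndFree.innerGraph {W : Type*} {F : SimpleGraph W} (hF : F.Preconnected)
    (hG : IndFree F G) (hK : ∀ u v : Fin n, G.Adj u v → K u → K v) :
    IndFree F (innerGraph G K x y z) := by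
  refine hG.of_le hF (innerGraph_le hK) fun u v huv hadj => (innerGraph_adj hK).2 ⟨hadj, ?_⟩
  suffices h : u = v ∨ (lab G x y z u = lab G x y z v ∧ K u) from
    h.resolve_left hadj.ne
  rw [SimpleGraph.reachable_iff_reflTransGen] at huv
  clear hadj
  induction huv with
  | refl => exact .inl rfl
  | tail _ h2 ih =>
    obtain ⟨-, h3, h4⟩ := (innerGraph_adj hK).1 h2
    rcases ih with rfl | ⟨h5, h6⟩
    · exact .inr ⟨h3, h4⟩
    · exact .inr ⟨h5.trans h3, h6⟩

theorem innerGraph_cliqueNum_lt (hK : ∀ u v : Fin n, G.Adj u v → K u → K v)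
    (hedge : ∃ u v, G.Adj u v) (hC : Check G K x y z) :
    (innerGraph G K x y z).cliqueNum < G.cliqueNum := by
  refine cliqueNum_lt_of_le (innerGraph_le hK) hedge fun w => ?_
  obtain ⟨v, hv, hh⟩ := hC w w.2
  refine ⟨⟨v, hv⟩, fun u hwu => ?_⟩
  obtain ⟨h1, h2, h3⟩ := (innerGraph_adj hK).1 hwu
  have := hh u u.2 ⟨nAdj_val.2 h1, h2, h3⟩
  exact ⟨(nAdj_val (v := ⟨v, hv⟩)).1 this.1, (nAdj_val (v := ⟨v, hv⟩)).1 this.2⟩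

theorem Allowed.congr {H : SimpleGraph (Fin h)} {l : ℕ → ℕ} {m : ℕ} {f g : ℕ → ℕ} {v a : ℕ}
    (hfg : ∀ i < m + m, f i = g i) (hf : Allowed G H K l m f v a) : Allowed G H K l m g v a := by
  have hc : ∀ a w, Cov G m f a w ↔ Cov G m g a w := by
    intro a w
    refine exists_congr fun j => and_congr_right fun hj => ?_
    rw [hfg _ (by omega), hfg _ (by omega)]
  simpa only [Allowed, hc] using hf

theorem exists_digits {B M : ℕ} (f : ℕ → ℕ) (hf : ∀ i, f i < B) :
    ∃ e < B ^ M, ∀ i < M, f i = e / B ^ i % B := by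
  refine ⟨finFunctionFinEquiv fun i : Fin M => (⟨f i, hf i⟩ : Fin B), Fin.is_lt _, fun i hi => ?_⟩
  have := congrFun (finFunctionFinEquiv.symm_apply_apply fun i : Fin M => (⟨f i, hf i⟩ : Fin B))
    ⟨i, hi⟩
  exact (congrArg Fin.val this).symm

end graph

section component

open Prog

variable {E : Env} {H : SimpleGraph (Fin E.h)} {I : Instance E.h} {σ : Store}

-- Two pairs of parameters occur: `s`, `t` control the length of the guesses and will be the capped
-- values, whereas `I.s`, `I.t` are passed on unchanged to the recursive calls.
open Classical in
theorem solve_ok (hI : Input I σ) {r : Fin I.n} {m s t : ℕ} (hs : 1 ≤ s) (ht : 1 ≤ t)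
    (hL' : IndFree (graphL s) I.graph) (hS' : IndFree (graphS t) I.graph)
    (hP : IndFree (SimpleGraph.pathGraph 6) I.graph) (hL : IndFree (graphL I.s) I.graph)
    (hS : IndFree (graphS I.t) I.graph) (hedge : ∃ u v, I.graph.Adj u v)
    (hr : σ.nat 3 0 0 = r) (hm : σ.nat 10 0 0 = m) (hmR : 3 * E.h * ramsey s t ≤ m)
    (hH : ∀ a < E.h, ∀ b < E.h, σ.nat 11 a b = 1 ↔ NAdj H a b)
    (hM : I.n ≤ E.iter) (hMh : E.h ≤ E.iter) (hMm : m + m ≤ E.iter)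
    (hMB : (I.n + E.h + 1) ^ (m + m) ≤ E.iter)
    (hcall : ∀ G' : SimpleGraph (Fin I.n), IndFree (SimpleGraph.pathGraph 6) G' →
      IndFree (graphL I.s) G' → IndFree (graphS I.t) G' → G'.cliqueNum < I.graph.cliqueNum →
      Solves E H I G') :
    Ok E (solve E.h) σ fun τ =>
      (∀ u v : Fin I.n, Ball I.graph r u → I.graph.Adj u v → ∀ a b,
        τ.answer I.n E.h u = some a → τ.answer I.n E.h v = some b → H.Adj a b) ∧
      (∀ ψ, IsPartialColoring I.graph H ψ → revenueOn (Ball I.graph r) I.rev ψ ≤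
        revenueOn (Ball I.graph r) I.rev (τ.answer I.n E.h)) ∧
      ∀ v : Fin I.n, ¬ Ball I.graph r v → τ.answer I.n E.h v = σ.answer I.n E.h v := by
  unfold solve
  refine Ok.seq ((component_ok hI hM).frame.mono ?_)
  rintro σ₁ ⟨f1, hK1⟩
  rw [hr] at hK1
  have hI1 : Input I σ₁ := hI.of_frame (f1.1 0 (not_mem_of_elem rfl))
    (f1.1 1 (not_mem_of_elem rfl)) (f1.2 0 (not_mem_of_elem rfl))
  obtain ⟨K, hKdef⟩ : ∃ K : ℕ → Prop, K = fun w => σ₁.nat 6 w 0 = 1 := ⟨_, rfl⟩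
  have hKB : ∀ w : Fin I.n, K w ↔ Ball I.graph r w := by
    intro w
    rw [hKdef]
    show σ₁.nat 6 w 0 = 1 ↔ _
    rw [hK1 w w.2]
    simp
  have hKR : ∀ w : Fin I.n, K w ↔ I.graph.Reachable r w := fun w =>
    (hKB w).trans (ball_iff hP r w)
  have hKc : ∀ u v : Fin I.n, I.graph.Adj u v → K u → K v := fun u v huv hu =>
    (hKR v).2 (((hKR u).1 hu).trans huv.reachable)
  have r1 : σ₁.nat 3 0 0 = r := by rw [f1.1 3 (not_mem_of_elem rfl), hr]
  refine Ok.seq ((search_ok hI1 hM (by rw [r1, ← hKdef]; exact exists_check hP hKR)).frame.mono ?_)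
  rintro σ₂ ⟨f2, hy, hz, hC⟩
  rw [← hKdef, r1] at hC
  have hI2 : Input I σ₂ := hI1.of_frame (f2.1 0 (not_mem_of_elem rfl))
    (f2.1 1 (not_mem_of_elem rfl)) (f2.2 0 (not_mem_of_elem rfl))
  obtain ⟨y, hyd⟩ : ∃ y, y = σ₂.nat 4 0 0 := ⟨_, rfl⟩
  obtain ⟨z, hzd⟩ : ∃ z, z = σ₂.nat 5 0 0 := ⟨_, rfl⟩
  rw [← hyd] at hy hC
  rw [← hzd] at hz hC
  have r2 : σ₂.nat 3 0 0 = r := by rw [f2.1 3 (not_mem_of_elem rfl), r1]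
  have s2 : σ₂.nat 6 = σ₁.nat 6 := f2.1 6 (not_mem_of_elem rfl)
  refine Ok.seq ((subgraph_ok hI2 hM).frame.mono ?_)
  rintro σ₃ ⟨f3, hG3⟩
  rw [r2, ← hyd, ← hzd, s2, ← hKdef] at hG3
  have hI3 : Input I σ₃ := hI2.of_frame (f3.1 0 (not_mem_of_elem rfl))
    (f3.1 1 (not_mem_of_elem rfl)) (f3.2 0 (not_mem_of_elem rfl))
  have m3 : σ₃.nat 10 0 0 = m := by
    rw [f3.1 10 (not_mem_of_elem rfl), f2.1 10 (not_mem_of_elem rfl),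
      f1.1 10 (not_mem_of_elem rfl), hm]
  refine Ok.seq ((Ok.forC (N := m + m) (by simp [NExp.eval, m3]) hMm rfl rfl
    (fun i τ => ∀ j < i, τ.nat 8 j 0 = 0) (by simp) ?_).frame.mono ?_)
  · intro i τ hi hτi hN hR hinv
    refine Ok.setN ?_
    intro j hj
    rw [updN_nat (by decide), updN_at]
    simp only [NExp.eval, hτi, and_true]
    split_ifs with hji
    · rfl
    · exact hinv j (by omega)
  rintro σ₄ ⟨f4, hg4⟩
  refine Ok.seq (Ok.setR (Ok.seq (Ok.setN ?_)))
  simp only [NExp.eval, RExp.eval, Int.reduceNeg, Int.cast_neg, Int.cast_one]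
  set σ₅ := (σ₄.updR 3 0 0 (-1)).updN 12 0 0 0 with hσ5
  have a5 : ∀ a, a ≠ 12 → σ₅.nat a = σ₄.nat a := fun a ha => by
    rw [hσ5, updN_nat ha]; rfl
  have ansσ : σ₅.nat 2 = σ.nat 2 := by
    rw [a5 2 (by decide), f4.1 2 (not_mem_of_elem rfl), f3.1 2 (not_mem_of_elem rfl),
      f2.1 2 (not_mem_of_elem rfl), f1.1 2 (not_mem_of_elem rfl)]
  have hI5 : Input I σ₅ := by
    refine hI3.of_frame ?_ ?_ ?_
    · rw [a5 0 (by decide), f4.1 0 (not_mem_of_elem rfl)]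
    · rw [a5 1 (by decide), f4.1 1 (not_mem_of_elem rfl)]
    · rw [hσ5, updN_real, updR_real (by decide), f4.2 0 (not_mem_of_elem rfl)]
  have s5 : ∀ a, a = 3 ∨ a = 4 ∨ a = 5 ∨ a = 6 ∨ a = 10 ∨ a = 11 → σ₅.nat a = σ₂.nat a := by
    rintro a (rfl | rfl | rfl | rfl | rfl | rfl) <;>
    · rw [a5 _ (by decide), f4.1 _ (not_mem_of_elem rfl), f3.1 _ (not_mem_of_elem rfl)]
  have t5 : σ₅.nat 7 = σ₃.nat 7 := by
    rw [a5 7 (by decide), f4.1 7 (not_mem_of_elem rfl)]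
  have u2 : ∀ a, a = 10 ∨ a = 11 → σ₂.nat a = σ.nat a := by
    rintro a (rfl | rfl) <;>
    · rw [f2.1 _ (not_mem_of_elem rfl), f1.1 _ (not_mem_of_elem rfl)]
  set B := I.n + E.h + 1 with hB
  set L := lab I.graph r y z with hLdef
  have hBpos : 0 < B ^ (m + m) := Nat.pow_pos (by omega)
  have hsol := hcall (innerGraph I.graph K r y z)
    (hP.innerGraph (SimpleGraph.pathGraph_connected 5).preconnected hKc)
    (hL.innerGraph (graphL_preconnected _) hKc) (hS.innerGraph (graphS_preconnected _) hKc)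
    (innerGraph_cliqueNum_lt hKc hedge hC)
  -- Here `e` is the number of guesses tried. After the first of them, real variable `3` is the
  -- revenue on `K` of the stored solution, and it is at least that of every colouring consistent
  -- with a guess already tried.
  refine (Ok.loop (N := B ^ (m + m)) hMB (fun e τ =>
    (∀ i < m + m, τ.nat 8 i 0 = e / B ^ i % B) ∧
    (τ.nat 12 0 0 = if e = B ^ (m + m) then 1 else 0) ∧
    (∀ v : Fin I.n, ¬ K v → τ.answer I.n E.h v = σ.answer I.n E.h v) ∧
    (e = 0 → τ.real 3 0 0 = -1) ∧
    (0 < e → (∀ u v : Fin I.n, K u → I.graph.Adj u v → ∀ a b, τ.answer I.n E.h u = some a →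
      τ.answer I.n E.h v = some b → H.Adj a b) ∧
      revenueOn K I.rev (τ.answer I.n E.h) = τ.real 3 0 0) ∧
    (∀ e' < e, ∀ f, (∀ i < m + m, f i = e' / B ^ i % B) → ∀ ψ, IsPartialColoring I.graph H ψ →
      (∀ (v : Fin I.n) (a : Fin E.h), K v → ψ v = some a → Allowed I.graph H K L m f v a) →
      revenueOn K I.rev ψ ≤ τ.real 3 0 0)) ?_ ?_ ?_).mono ?_
  · refine ⟨fun i hi => ?_, ?_, fun v _ => ?_, fun _ => ?_, by simp, by simp⟩
    · rw [a5 8 (by decide), hg4 i hi]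
      simp
    · rw [if_neg (by omega), hσ5]
      simp
    · exact answer_congr rfl (by rw [ansσ])
    · rw [hσ5]
      simp
  · rintro e τ he hfr ⟨j1, j2, j3, j4, j5, j6⟩
    refine ⟨?_, ?_⟩
    · rw [if_neg (by omega)] at j2
      simp [BExp.holds, NExp.eval, j2]
    have hIτ : Input I τ := hI5.of_frame (hfr.1 0 (not_mem_of_elem rfl))
      (hfr.1 1 (not_mem_of_elem rfl)) (hfr.2 0 (not_mem_of_elem rfl))
    have w6 : τ.nat 6 = σ₁.nat 6 := by
      rw [hfr.1 6 (not_mem_of_elem rfl), s5 6 (by simp), s2]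
    refine (guess_ok hIτ (K := K) (x := r) (y := y) (z := z) (m := m) (e := e) (by rw [w6, hKdef])
      (by rw [hfr.1 3 (not_mem_of_elem rfl), s5 3 (by simp), r2])
      (by rw [hfr.1 4 (not_mem_of_elem rfl), s5 4 (by simp), hyd])
      (by rw [hfr.1 5 (not_mem_of_elem rfl), s5 5 (by simp), hzd])
      (by rw [hfr.1 10 (not_mem_of_elem rfl), s5 10 (by simp), u2 10 (by simp), hm]) hB
      (fun w hw => by rw [w6, hK1 w hw]; split_ifs <;> simp)
      (fun i hi j hj => by rw [hfr.1 7 (not_mem_of_elem rfl), t5, hG3 i hi j hj])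
      (by rw [hfr.1 11 (not_mem_of_elem rfl), s5 11 (by simp), u2 11 (by simp)]; exact hH)
      hM hMh hMm j1 hsol).mono ?_
    rintro τ' ⟨⟨φ, hφ, hcase⟩, k1, k2⟩
    obtain ⟨p1, p2, p3, p4⟩ := hφ.restricted_spec
    have hle : τ.real 3 0 0 ≤ τ'.real 3 0 0 ∧ revenue I.rev φ ≤ τ'.real 3 0 0 := by
      rcases hcase with ⟨q1, q2, -⟩ | ⟨q1, q2, -⟩
      · rw [q2]; exact ⟨le_rfl, q1⟩
      · rw [q2]; exact ⟨q1.le, le_rfl⟩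
    refine ⟨k1, ?_, fun v hv => ?_, by simp, fun _ => ?_, fun e' he' f hf ψ hψ hall => ?_⟩
    · rw [k2]
      refine if_congr ⟨fun hd => ?_, fun hd => ?_⟩ rfl rfl
      · have := Nat.le_of_dvd (by omega) hd
        omega
      · rw [hd]
    · rcases hcase with ⟨-, -, q3⟩ | ⟨-, -, q3⟩
      · exact (answer_congr (τ := τ) rfl (by rw [q3])).trans (j3 v hv)
      · rw [q3, if_neg hv]
        exact j3 v hv
    · rcases hcase with ⟨q1, q2, q3⟩ | ⟨q1, q2, q3⟩
      · have he0 : 0 < e := by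
          rcases Nat.eq_zero_or_pos e with h0 | h0
          · rw [j4 h0] at q1
            linarith
          · exact h0
        have hans : τ'.answer I.n E.h = τ.answer I.n E.h :=
          funext fun v => answer_congr rfl (by rw [q3])
        rw [hans, q2]
        exact j5 he0
      · constructor
        · intro u v hu huv a b ha hb
          rw [q3, if_pos hu] at ha
          rw [q3, if_pos (hKc u v huv hu)] at hb
          exact p1 u v huv a b ha hb
        · rw [q2, ← p3]
          exact revenueOn_congr fun v hv => by rw [q3, if_pos hv]
    · rcases Nat.lt_succ_iff_lt_or_eq.1 he' with hlt | rfl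
      · exact (j6 e' hlt f hf ψ hψ hall).trans hle.1
      · refine (p4 ψ hψ fun v a hv ha => ?_).trans hle.2
        exact (hall v a hv ha).congr fun i hi => by rw [hf i hi, j1 i hi]
  · rintro τ - ⟨-, j2, -⟩
    simp [BExp.holds, NExp.eval, j2]
  · rintro τ ⟨-, -, j3, -, j5, j6⟩
    have hon : ∀ φ, revenueOn (Ball I.graph r) I.rev φ = revenueOn K I.rev φ := fun φ =>
      Finset.sum_congr rfl fun v _ => if_congr (hKB v).symm rfl rfl
    refine ⟨fun u v hu => (j5 hBpos).1 u v ((hKB u).2 hu), fun ψ hψ => ?_,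
      fun v hv => j3 v fun hc => hv ((hKB v).1 hc)⟩
    rw [hon, hon, (j5 hBpos).2]
    -- The guess that suits the competitor `ψ` is the digit sequence of some `e`, hence was tried.
    obtain ⟨f, hf1, hf2⟩ := exists_guess hs ht hL' hS' hmR K r.2 hy hz hψ
    obtain ⟨e, he, hfe⟩ := exists_digits (M := m + m) f hf1
    exact j6 e he f hfe ψ hψ hf2

end component

end MPHC


namespace MPHC

/-! ### The whole program -/

section pieces

open Prog

variable {h : ℕ} {I : Instance h} {σ : Store} {E : Env}

theorem bestF_holds (hI : Input I σ) {i j : ℕ} (hi : σ.nat 21 0 0 = i) (hj : σ.nat 22 0 0 = j) :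
    (bestF h (.var 21) (.var 22)).holds σ ↔
      0 < revM I.rev i j ∧ ∀ b < h, revM I.rev i b ≤ revM I.rev i j := by
  simp [bestF, Fm.holds, BExp.holds, RExp.eval, NExp.eval, revE, updN_nat, hI.rev, hi, hj]

theorem edgeless_ok (hI : Input I σ) (hM : I.n ≤ E.iter) (hMh : h ≤ E.iter)
    (h2 : ∀ v, σ.nat 2 v 0 = 0) : Ok E (edgeless h) σ fun τ => ∀ (v : Fin I.n)
      (o : Option (Fin h)), o.elim 0 (I.rev v) ≤ (τ.answer I.n h v).elim 0 (I.rev v) := by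
  set R : ℕ → ℕ → Prop := fun i j =>
    0 < revM I.rev i j ∧ ∀ b < h, revM I.rev i b ≤ revM I.rev i j with hR
  -- After the colours below `k` have been tried at `v`, the entry `x` is still 0 because none was
  -- best, or it encodes a best one.
  set S : ℕ → ℕ → ℕ → Prop := fun v x k =>
    (x = 0 ∧ ∀ a < k, ¬ R v a) ∨ ∃ a < h, x = a + 1 ∧ R v a with hS
  unfold edgeless
  refine (Ok.forC (N := I.n) (by exact hI.n) hM rfl rfl (fun i τ =>
    (∀ v < i, S v (τ.nat 2 v 0) h) ∧ ∀ v, i ≤ v → τ.nat 2 v 0 = 0) ?_ ?_).mono ?_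
  · simp [updN_nat, h2]
  · rintro i τ hi hτi hN hR' ⟨hinv, hinv'⟩
    have hIτ : Input I τ := hI.of_frame (hN 0 (not_mem_of_elem rfl)) (hN 1 (not_mem_of_elem rfl))
      (hR' 0 (not_mem_of_elem rfl))
    refine (Ok.forC (N := h) (by rfl) hMh rfl rfl (fun j τ =>
      ((∀ v < i, S v (τ.nat 2 v 0) h) ∧ ∀ v, i < v → τ.nat 2 v 0 = 0) ∧ S i (τ.nat 2 i 0) j)
      ?_ ?_).mono ?_
    · rw [updN_nat (by decide)]
      exact ⟨⟨hinv, fun v hv => hinv' v hv.le⟩, .inl ⟨hinv' i le_rfl, by simp⟩⟩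
    · rintro j τ₁ hj hτj hN1 hR1 ⟨⟨k1, k2⟩, k3⟩
      have hI1 : Input I τ₁ := hIτ.of_frame (hN1 0 (not_mem_of_elem rfl))
        (hN1 1 (not_mem_of_elem rfl)) (hR1 0 (not_mem_of_elem rfl))
      have g21 : τ₁.nat 21 0 0 = i := by rw [hN1 21 (not_mem_of_elem rfl), hτi]
      have hB := bestF_holds hI1 g21 hτj
      refine Fm.ite_ok rfl (by simp [Fm.bdd, bestF, NExp.eval, hMh])
        (fun τ' hF hfr => Ok.setN ?_) (fun τ' hF hfr => Ok.skip ?_)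
      · have e1 : τ'.nat 21 = τ₁.nat 21 := hfr.1 21 (not_mem_of_elem rfl)
        have e2 : τ'.nat 22 = τ₁.nat 22 := hfr.1 22 (not_mem_of_elem rfl)
        have e3 : τ'.nat 2 = τ₁.nat 2 := hfr.1 2 (not_mem_of_elem rfl)
        rw [updN_nat (by decide)]
        simp only [updN_at, NExp.eval, e1, e2, e3, g21, hτj, and_true, if_true]
        refine ⟨⟨fun v hv => ?_, fun v hv => ?_⟩, .inr ⟨j, hj, rfl, hB.1 hF⟩⟩
        · rw [if_neg (by omega)]; exact k1 v hv
        · rw [if_neg (by omega)]; exact k2 v hv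
      · have e3 : τ'.nat 2 = τ₁.nat 2 := hfr.1 2 (not_mem_of_elem rfl)
        rw [updN_nat (by decide), e3]
        refine ⟨⟨k1, k2⟩, k3.imp_left fun ⟨q1, q2⟩ => ⟨q1, fun a ha => ?_⟩⟩
        rcases Nat.lt_succ_iff_lt_or_eq.1 ha with ha | rfl
        · exact q2 a ha
        · exact fun hc => hF (hB.2 hc)
    · rintro τ' ⟨⟨k1, k2⟩, k3⟩
      rw [updN_nat (by decide)]
      refine ⟨fun v hv => ?_, fun v hv => k2 v (by omega)⟩
      rcases Nat.lt_succ_iff_lt_or_eq.1 hv with hv | rfl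
      · exact k1 v hv
      · exact k3
  · rintro τ ⟨hτ, -⟩ v o
    have hrev : ∀ b : Fin h, revM I.rev v b = I.rev v b := fun b => by simp [revM]
    rw [← revM_answer]
    rcases hτ v v.2 with ⟨q1, q2⟩ | ⟨a, ha, q1, q2, q3⟩
    · rw [q1]
      cases o with
      | none => simp
      | some b =>
        simp only [Option.elim_some, nonpos_iff_eq_zero, one_ne_zero, if_false]
        -- If some colour had positive revenue, one of maximum revenue would have passed the test.
        by_contra! hpos
        have : Nonempty (Fin h) := ⟨b⟩
        obtain ⟨c, hc⟩ := Finite.exists_max (I.rev v)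
        refine q2 c c.2 ⟨?_, fun b' hb' => ?_⟩
        · rw [hrev]
          exact hpos.trans_le (hc b)
        · rw [hrev]
          exact (hrev ⟨b', hb'⟩).trans_le (hc _)
    · rw [q1, if_pos (by omega), Nat.add_sub_cancel]
      cases o with
      | none => exact q2.le
      | some b => exact (hrev b).symm.trans_le (q3 b b.2)

theorem eval_mulE {k : ℕ} {e : NExp} : (mulE k e).eval σ = k * e.eval σ := by
  induction k with
  | zero => simp [mulE, NExp.eval]
  | succ k ih => simp [mulE, NExp.eval, ih, Nat.succ_mul]

theorem capE_ok {x : ℕ} {e : NExp} (hI : Input I σ) :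
    Ok E (capE x e) σ fun τ => τ.nat x 0 0 = min (e.eval σ) (I.n + 1) := by
  have hn : nE.eval σ = I.n := hI.n
  refine Ok.ite (fun hb => Ok.setN ?_) (fun hb => Ok.setN ?_)
  · simp only [BExp.holds, NExp.eval, hI.n] at hb
    simp [NExp.eval, hb]
  · simp only [BExp.holds, NExp.eval, hI.n] at hb
    simp only [NExp.eval, hI.n, updN_same]
    omega

/-- Pascal's triangle is filled row by row, with `(i + j).choose i` at position `(i, j)`; the entry
at `(s' - 1, t' - 1)` is the Ramsey bound for the capped parameters. -/
theorem length_ok (hI : Input I σ) (hs : 1 ≤ I.s) (ht : 1 ≤ I.t) (hM : I.n + 1 ≤ E.iter) :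
    Ok E (length h) σ fun τ =>
      τ.nat 10 0 0 = 3 * h * ramsey (min I.s (I.n + 1)) (min I.t (I.n + 1)) := by
  unfold length
  refine Ok.seq ((capE_ok hI).frame.mono ?_)
  rintro σ₁ ⟨f1, h1⟩
  have hI1 : Input I σ₁ := hI.of_frame (f1.1 0 (not_mem_of_elem rfl))
    (f1.1 1 (not_mem_of_elem rfl)) (f1.2 0 (not_mem_of_elem rfl))
  refine Ok.seq ((capE_ok hI1).frame.mono ?_)
  rintro σ₂ ⟨f2, h2⟩
  simp only [NExp.eval] at h1 h2
  rw [hI.s] at h1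
  rw [hI1.t] at h2
  rw [← f2.1 13 (not_mem_of_elem rfl)] at h1
  set s' := min I.s (I.n + 1)
  set t' := min I.t (I.n + 1)
  have hs' : 1 ≤ s' := by omega
  have ht' : 1 ≤ t' := by omega
  refine Ok.seq ((Ok.forC (N := s') (by exact h1) (by omega) rfl rfl (fun i τ =>
    ∀ i' < i, ∀ j < t', τ.nat 15 i' j = (i' + j).choose i') (by simp) ?_).frame.mono ?_)
  · rintro i τ hi hτi hN hR hinv
    have k14 : τ.nat 14 = σ₂.nat 14 := hN 14 (not_mem_of_elem rfl)
    refine (Ok.forC (N := t') (by simp [NExp.eval, k14, h2]) (by omega) rfl rfl (fun j τ =>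
      ∀ i' j', (i' < i ∧ j' < t') ∨ (i' = i ∧ j' < j) → τ.nat 15 i' j' = (i' + j').choose i')
      ?_ ?_).mono ?_
    · rintro i' j' (hh | hh)
      · rw [updN_nat (by decide)]
        exact hinv i' hh.1 j' hh.2
      · omega
    · intro j τ₁ hj hτj hN1 hR1 hinv1
      have g23 : τ₁.nat 23 0 0 = i := by rw [hN1 23 (not_mem_of_elem rfl), hτi]
      have key : ∀ v, v = (i + j).choose i → ∀ i' j', (i' < i ∧ j' < t') ∨ (i' = i ∧ j' < j + 1) →
          ((τ₁.updN 15 i j v).updN 24 0 0 (j + 1)).nat 15 i' j' = (i' + j').choose i' := by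
        intro v hv i' j' hh
        rw [updN_nat (by decide), updN_at]
        by_cases hc : i' = i ∧ j' = j
        · rw [if_pos hc, hc.1, hc.2, hv]
        · rw [if_neg hc]
          exact hinv1 i' j' (by omega)
      refine Ok.ite (fun hb => Ok.setN ?_) (fun hb => Ok.ite (fun hb' => Ok.setN ?_)
        (fun hb' => Ok.setN ?_))
      all_goals
        simp only [NExp.eval, g23, hτj]
        refine key _ ?_
      · simp only [BExp.holds, NExp.eval, g23] at hb
        obtain rfl : i = 0 := by omega
        simp
      · simp only [BExp.holds, NExp.eval, hτj] at hb'
        obtain rfl : j = 0 := by omega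
        simp
      · simp only [BExp.holds, NExp.eval, g23, hτj] at hb hb'
        obtain ⟨a, rfl⟩ : ∃ a, i = a + 1 := ⟨i - 1, by omega⟩
        obtain ⟨b, rfl⟩ : ∃ b, j = b + 1 := ⟨j - 1, by omega⟩
        rw [hinv1 _ _ (by omega), hinv1 _ _ (by omega)]
        simp only [Nat.add_sub_cancel]
        rw [show a + 1 + (b + 1) = (a + b + 1) + 1 by ring, Nat.choose_succ_succ,
          show a + (b + 1) = a + b + 1 by ring, show a + 1 + b = a + b + 1 by ring]
    · intro τ' hτ' i' hi' j' hj'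
      rw [updN_nat (by decide)]
      exact hτ' i' j' (by omega)
  · rintro τ ⟨hfr, hτ⟩
    have k13 : τ.nat 13 = σ₂.nat 13 := hfr.1 13 (not_mem_of_elem rfl)
    have k14 : τ.nat 14 = σ₂.nat 14 := hfr.1 14 (not_mem_of_elem rfl)
    refine Ok.setN ?_
    rw [eval_mulE]
    simp only [NExp.eval, updN_same, k13, k14, h1, h2]
    rw [hτ _ (by omega) _ (by omega), ramsey, show s' - 1 + (t' - 1) = s' + t' - 2 by omega]

open Classical in
theorem pattern_ok {H : SimpleGraph (Fin h)} {l : List (ℕ × ℕ)} : Ok E (pattern H l) σ fun τ =>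
    (∀ a b, τ.nat 11 a b = if (a, b) ∈ l then (if NAdj H a b then 1 else 0) else σ.nat 11 a b) ∧
      (∀ a, a ≠ 11 → τ.nat a = σ.nat a) ∧ τ.real = σ.real := by
  induction l generalizing σ with
  | nil => exact Ok.skip ⟨by simp, fun _ _ => rfl, rfl⟩
  | cons x l ih =>
    refine Ok.seq (Ok.setN (ih.mono ?_))
    rintro τ ⟨h1, h2, h3⟩
    refine ⟨fun a b => ?_, fun a ha => by rw [h2 a ha, updN_nat ha], by rw [h3]; rfl⟩
    rw [h1 a b, updN_at]
    simp only [NExp.eval, List.mem_cons]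
    by_cases hx : (a, b) = x
    · subst hx
      simp
    · have : ¬ (a = x.1 ∧ b = x.2) := fun hc => hx (Prod.ext hc.1 hc.2)
      simp [hx, this]

theorem edgelessF_bdd (hI : Input I σ) (hM : I.n ≤ E.iter) : edgelessF.bdd E.iter σ := by
  simp [Fm.bdd, edgelessF, adjF, Fm.eqN, NExp.eval, hI.n, hM]

end pieces

/-! ### Correctness of one invocation -/

section main

open Prog

variable {E : Env} {H : SimpleGraph (Fin E.h)} {I : Instance E.h}

theorem main_edgeless_ok (hedge : ∀ u v, ¬ I.graph.Adj u v) (hM : I.n ≤ E.iter)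
    (hMh : E.h ≤ E.iter) :
    Ok E (main H) (Store.load I) fun τ => IsOptimum H I (τ.answer I.n E.h) := by
  have hI := input_load I
  refine Fm.ite_ok rfl (edgelessF_bdd hI hM) (fun τ hF hfr => ?_)
    (fun τ hF _ => absurd ((edgelessF_holds hI).2 hedge) hF)
  have hIτ : Input I τ := hI.of_frame (hfr.1 0 (not_mem_of_elem rfl))
    (hfr.1 1 (not_mem_of_elem rfl)) (hfr.2 0 (not_mem_of_elem rfl))
  refine (edgeless_ok hIτ hM hMh fun v => ?_).mono fun τ' hτ' => ⟨?_, fun ψ _ => ?_⟩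
  · rw [hfr.1 2 (not_mem_of_elem rfl)]
    simp [Store.load]
  · exact fun u v huv => absurd huv (hedge u v)
  · exact Finset.sum_le_sum fun v _ => hτ' v (ψ v)

/-- A member of the family with parameter `n + 1` has `2n + 3` vertices, too many for `G`. -/
theorem IndFree.min_size {n a : ℕ} {G : SimpleGraph (Fin n)}
    {F : ∀ a : ℕ, SimpleGraph (Unit ⊕ Fin a ⊕ Fin a)} (hF : IndFree (F a) G) :
    IndFree (F (min a (n + 1))) G := by
  rcases le_total a (n + 1) with h | h
  · rwa [min_eq_left h]
  · rw [min_eq_right h]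
    rintro ⟨f⟩
    have := Fintype.card_le_of_injective f f.injective
    simp at this
    omega

theorem main_ok (hs : 1 ≤ I.s) (ht : 1 ≤ I.t)
    (hP : IndFree (SimpleGraph.pathGraph 6) I.graph) (hL : IndFree (graphL I.s) I.graph)
    (hS : IndFree (graphS I.t) I.graph) {m : ℕ} (hedge : ∃ u v, I.graph.Adj u v)
    (hm : m = 3 * E.h * ramsey (min I.s (I.n + 1)) (min I.t (I.n + 1)))
    (hM : I.n + 1 ≤ E.iter) (hMh : E.h ≤ E.iter) (hMm : m + m ≤ E.iter)
    (hMB : (I.n + E.h + 1) ^ (m + m) ≤ E.iter)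
    (hcall : ∀ G' : SimpleGraph (Fin I.n), IndFree (SimpleGraph.pathGraph 6) G' →
      IndFree (graphL I.s) G' → IndFree (graphS I.t) G' → G'.cliqueNum < I.graph.cliqueNum →
      Solves E H I G') :
    Ok E (main H) (Store.load I) fun τ => IsOptimum H I (τ.answer I.n E.h) := by
  classical
  have hI := input_load I
  refine Fm.ite_ok rfl (edgelessF_bdd hI (by omega)) (fun τ hF hfr => ?_) (fun σ₁ hF hfr => ?_)
  · obtain ⟨u, v, huv⟩ := hedge
    exact absurd huv ((edgelessF_holds hI).1 hF u v)
  have hI1 : Input I σ₁ := hI.of_frame (hfr.1 0 (not_mem_of_elem rfl))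
    (hfr.1 1 (not_mem_of_elem rfl)) (hfr.2 0 (not_mem_of_elem rfl))
  refine Ok.seq (pattern_ok.mono ?_)
  rintro σ₂ ⟨hH, f2, fr2⟩
  have hI2 : Input I σ₂ := hI1.of_frame (f2 0 (by decide)) (f2 1 (by decide)) (by rw [fr2])
  refine Ok.seq ((length_ok hI2 hs ht hM).frame.mono ?_)
  rintro σ₃ ⟨f3, hm3⟩
  have hI3 : Input I σ₃ := hI2.of_frame (f3.1 0 (not_mem_of_elem rfl))
    (f3.1 1 (not_mem_of_elem rfl)) (f3.2 0 (not_mem_of_elem rfl))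
  have hH3 : ∀ a < E.h, ∀ b < E.h, σ₃.nat 11 a b = 1 ↔ NAdj H a b := by
    intro a ha b hb
    rw [f3.1 11 (not_mem_of_elem rfl), hH a b]
    simp [ha, hb]
  have hbr := fun r w : Fin I.n => ball_iff hP r w
  refine (Ok.forC (N := I.n) (by exact hI3.n) (by omega) rfl rfl (fun i τ =>
    ∀ r : Fin I.n, r < i → (∀ u v : Fin I.n, Ball I.graph r u → I.graph.Adj u v → ∀ a b,
        τ.answer I.n E.h u = some a → τ.answer I.n E.h v = some b → H.Adj a b) ∧
      ∀ ψ, IsPartialColoring I.graph H ψ → revenueOn (Ball I.graph r) I.rev ψ ≤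
        revenueOn (Ball I.graph r) I.rev (τ.answer I.n E.h)) (by simp) ?_).mono ?_
  · intro i τ hi hτi hN hR hinv
    have hIτ : Input I τ := hI3.of_frame (hN 0 (not_mem_of_elem rfl))
      (hN 1 (not_mem_of_elem rfl)) (hR 0 (not_mem_of_elem rfl))
    refine (solve_ok (H := H) (r := ⟨i, hi⟩) (m := m) hIτ (s := min I.s (I.n + 1))
      (t := min I.t (I.n + 1)) (by omega) (by omega) hL.min_size hS.min_size hP hL hS hedge hτi
      (by rw [hN 10 (not_mem_of_elem rfl), hm3, hm]) hm.ge
      (by rw [hN 11 (not_mem_of_elem rfl)]; exact hH3) (by omega) hMh hMm hMB hcall).mono ?_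
    rintro τ' ⟨k1, k2, k3⟩ r hr
    have hans : ∀ v, (τ'.updN 3 0 0 (i + 1)).answer I.n E.h v = τ'.answer I.n E.h v := fun v =>
      answer_congr rfl (by rw [updN_nat (by decide)])
    simp only [funext hans]
    rcases Nat.lt_succ_iff_lt_or_eq.1 hr with hr | hr
    · by_cases hB : I.graph.Reachable ⟨i, hi⟩ r
      · have hBB : ∀ u : Fin I.n, Ball I.graph r u ↔ Ball I.graph i u := fun u => by
          rw [hbr r u, show Ball I.graph i u ↔ _ from hbr ⟨i, hi⟩ u]
          exact ⟨hB.trans, hB.symm.trans⟩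
        have hon : ∀ φ, revenueOn (Ball I.graph r) I.rev φ = revenueOn (Ball I.graph i) I.rev φ :=
          fun φ => Finset.sum_congr rfl fun v _ => if_congr (hBB v) rfl rfl
        exact ⟨fun u v hu => k1 u v ((hBB u).1 hu), fun ψ hψ => by
          rw [hon, hon]; exact k2 ψ hψ⟩
      · have hne : ∀ u : Fin I.n, Ball I.graph r u →
            τ'.answer I.n E.h u = τ.answer I.n E.h u := fun u hu =>
          k3 u fun hc => hB (((hbr ⟨i, hi⟩ u).1 hc).trans ((hbr r u).1 hu).symm)
        obtain ⟨q1, q2⟩ := hinv r hr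
        refine ⟨fun u v hu huv => ?_, fun ψ hψ => ?_⟩
        · rw [hne u hu, hne v ((hbr r v).2 (((hbr r u).1 hu).trans huv.reachable))]
          exact q1 u v hu huv
        · rw [revenueOn_congr (K := Ball I.graph r) hne]
          exact q2 ψ hψ
    · obtain rfl : r = ⟨i, hi⟩ := Fin.ext hr
      exact ⟨k1, k2⟩
  · intro τ hτ
    exact isOptimum_of_components (s := I.s) (t := I.t) (K := fun r => Ball I.graph r) hbr
      (fun r => (hτ r r.2).1) (fun r => (hτ r r.2).2)

end main

theorem ramsey_mono {s s' t t' : ℕ} (hs : 1 ≤ s') (ht : 1 ≤ t') (hss : s' ≤ s) (htt : t' ≤ t) :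
    ramsey s' t' ≤ ramsey s t := by
  obtain ⟨a', rfl⟩ : ∃ a, s' = a + 1 := ⟨s' - 1, by omega⟩
  obtain ⟨b', rfl⟩ : ∃ a, t' = a + 1 := ⟨t' - 1, by omega⟩
  obtain ⟨a, rfl⟩ : ∃ a, s = a + 1 := ⟨s - 1, by omega⟩
  obtain ⟨b, rfl⟩ : ∃ a, t = a + 1 := ⟨t - 1, by omega⟩
  have e : ∀ a b, ramsey (a + 1) (b + 1) = (a + b).choose a := fun a b => by
    simp [ramsey, show a + 1 + (b + 1) - 2 = a + b by omega]
  rw [e, e]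
  calc (a' + b').choose a' ≤ (a' + b).choose a' := Nat.choose_le_choose _ (by omega)
    _ = (a' + b).choose b := Nat.choose_symm_add
    _ ≤ (a + b).choose b := Nat.choose_le_choose _ (by omega)
    _ = (a + b).choose a := Nat.choose_symm_add.symm

/-! ### The recursion and its resource bounds -/

section recursion

open Prog

variable {h : ℕ} (H : SimpleGraph (Fin h)) {s t n : ℕ}

theorem exec_of_ok {I : Instance h} {M T D P : ℕ} {Q : Store → Prop}
    (hok : Ok ⟨h, main H, M, T, D, P⟩ (main H) (Store.load I) Q) :
    ∃ σ k, Exec h (main H) (main H) (Store.load I) σ k ∧ Q σ ∧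
      k.own ≤ (main H).bound h M 0 ∧ k.total ≤ (main H).bound h M T ∧ k.depth ≤ D ∧ k.peak ≤ P := by
  obtain ⟨σ, k, h1, h2, h3⟩ := hok
  exact ⟨σ, k, h1, h3, h2.own, h2.total, h2.depth, h2.peak⟩

/-- Induction on the clique number. Calls keep `n`, `s` and `t`, so `M` and `Q` are the same on all
levels. With `T = (2Q)^(c-1)` bounding a call, an invocation takes at most `Q * (T + 1) ≤ 2Q * T`
steps. -/
theorem exec_main (hs : 1 ≤ s) (ht : 1 ≤ t) {m M Q : ℕ}
    (hm : m = 3 * h * ramsey (min s (n + 1)) (min t (n + 1)))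
    (hM : M = (n + h + 1) ^ (m + m + 1)) (hQ : Q = (main H).bound h M 0)
    (c : ℕ) : ∀ (G : SimpleGraph (Fin n)) (rev : Fin n → Fin h → ℝ), G.cliqueNum = c → 1 ≤ n →
      IndFree (SimpleGraph.pathGraph 6) G → IndFree (graphL s) G → IndFree (graphS t) G →
      ∃ σ k, Exec h (main H) (main H) (Store.load ⟨s, t, n, G, rev⟩) σ k ∧
        IsOptimum H ⟨s, t, n, G, rev⟩ (σ.answer n h) ∧ k.own ≤ Q ∧ k.peak ≤ Q ∧
        k.total ≤ (2 * Q) ^ c ∧ k.depth ≤ c := by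
  induction c using Nat.strong_induction_on with
  | _ c ih =>
  intro G rev hc hn hP hL hS
  -- The extra 1 in the exponent of `M` is for the case `m = 0`, where the loops over vertices and
  -- colours still have to fit.
  have hB1 : n + h + 1 ≤ M := hM ▸ Nat.le_self_pow (by omega) _
  have hc1 : 1 ≤ c := by
    rw [← hc]
    have hcl : G.IsClique ({⟨0, hn⟩} : Finset (Fin n)) := by simp
    simpa using hcl.card_le_cliqueNum
  have hQ1 : 1 ≤ Q := hQ ▸ Cmd.one_le_bound h M 0 (main H)
  by_cases hedge : ∀ u v, ¬ G.Adj u v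
  · obtain ⟨σ, k, h1, h2, h3, h4, h5, h6⟩ := exec_of_ok H (main_edgeless_ok (H := H)
      (I := ⟨s, t, n, G, rev⟩) (E := ⟨h, main H, M, 0, 0, 0⟩) hedge (show n ≤ M by omega)
      (show h ≤ M by omega))
    rw [← hQ] at h3 h4
    refine ⟨σ, k, h1, h2, h3, by omega, h4.trans ?_, by omega⟩
    exact le_trans (by omega) (Nat.le_self_pow (show c ≠ 0 by omega) (2 * Q))
  · push Not at hedge
    have hMB : (n + h + 1) ^ (m + m) ≤ M := hM ▸ Nat.pow_le_pow_right (by omega) (by omega)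
    have hn2 : 2 ≤ n + h + 1 := by omega
    have hMm : m + m ≤ M := (Nat.lt_pow_self hn2).le.trans hMB
    obtain ⟨σ, k, h1, h2, h3, h4, h5, h6⟩ := exec_of_ok H (main_ok (H := H)
      (I := ⟨s, t, n, G, rev⟩) (E := ⟨h, main H, M, (2 * Q) ^ (c - 1), c, Q⟩) hs ht hP hL hS hedge
      hm (show n + 1 ≤ M by omega) (show h ≤ M by omega) hMm hMB
      (fun G' hP' hL' hS' hlt rev' => by
        replace hlt : G'.cliqueNum < c := hc ▸ hlt
        obtain ⟨τ, l, g1, g2, g3, g4, g5, g6⟩ := ih _ hlt G' rev' rfl hn hP' hL' hS'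
        exact ⟨τ, l, g1, g3, g5.trans (Nat.pow_le_pow_right (by omega) (by omega)),
          show l.depth + 1 ≤ c by omega, g4, g2⟩))
    refine ⟨σ, k, h1, h2, hQ ▸ h3, h6, h4.trans ?_, h5⟩
    refine (Cmd.bound_le_mul h M _ (main H)).trans ?_
    rw [← hQ]
    have hpos : 1 ≤ (2 * Q) ^ (c - 1) := Nat.one_le_pow _ _ (by omega)
    calc Q * ((2 * Q) ^ (c - 1) + 1) ≤ Q * ((2 * Q) ^ (c - 1) + (2 * Q) ^ (c - 1)) :=
          Nat.mul_le_mul_left _ (by omega)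
      _ = (2 * Q) ^ (c - 1 + 1) := by ring
      _ = (2 * Q) ^ c := by rw [Nat.sub_add_cancel hc1]

/-- For `n ≥ 2` all constants are absorbed into powers of `n`: `2 ≤ n`, `K ≤ n ^ K` and `n + h + 1 ≤
n ^ (h + 3)`. The capped Ramsey number is replaced by the true one via `ramsey_mono`. -/
theorem exists_polynomial_bound : ∃ C, ∀ s t n m M : ℕ, 1 ≤ s → 1 ≤ t → 2 ≤ n →
    m = 3 * h * ramsey (min s (n + 1)) (min t (n + 1)) → M = (n + h + 1) ^ (m + m + 1) →
    2 * (main H).bound h M 0 ≤ n ^ (C * ramsey s t) := by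
  obtain ⟨K, e, hK⟩ := Cmd.exists_bound_le h (main H)
  refine ⟨1 + K + (h + 3) * (6 * h + 1) * e, fun s t n m M hs ht hn hm hM => ?_⟩
  have hR := one_le_ramsey (s := s) ht
  have hRm := ramsey_mono (s' := min s (n + 1)) (t' := min t (n + 1)) (s := s) (t := t) (by omega)
    (by omega) (min_le_left _ _) (min_le_left _ _)
  set R := ramsey s t
  have hpow : ∀ k, k ≤ n ^ k := fun k => (Nat.lt_pow_self (by omega)).le
  have hB : n + h + 1 ≤ n ^ (h + 3) := by
    calc n + h + 1 ≤ n * (h + 2) := by nlinarith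
      _ ≤ n * n ^ (h + 2) := Nat.mul_le_mul_left _ (hpow _)
      _ = n ^ (h + 3) := by ring
  have hmR : m + m + 1 ≤ (6 * h + 1) * R := by
    have := Nat.mul_le_mul_left (3 * h) hRm
    rw [← hm] at this
    nlinarith
  have hM1 : 1 ≤ M := hM ▸ Nat.one_le_pow _ _ (by omega)
  have hMn : M ≤ n ^ ((h + 3) * ((6 * h + 1) * R)) := by
    rw [hM, pow_mul]
    exact (Nat.pow_le_pow_right (by omega) hmR).trans (Nat.pow_le_pow_left hB _)
  calc 2 * (main H).bound h M 0 ≤ n * (n ^ K * (n ^ ((h + 3) * ((6 * h + 1) * R))) ^ e) :=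
        Nat.mul_le_mul hn ((hK M hM1).trans (Nat.mul_le_mul (hpow K) (Nat.pow_le_pow_left hMn e)))
    _ = n ^ (1 + K + (h + 3) * (6 * h + 1) * e * R) := by
        rw [← pow_mul]; ring
    _ ≤ n ^ ((1 + K + (h + 3) * (6 * h + 1) * e) * R) := by
        refine Nat.pow_le_pow_right (by omega) ?_
        nlinarith

end recursion

end MPHC

theorem mainTheorem9 {h : ℕ} (H : SimpleGraph (Fin h)) :
    ∃ (p : MPHC.Cmd) (C : ℕ),
      ∀ (s t n : ℕ) (G : SimpleGraph (Fin n)) (rev : Fin n → Fin h → ℝ),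
        1 ≤ s → 1 ≤ t →
        MPHC.IndFree (SimpleGraph.pathGraph 6) G →
        MPHC.IndFree (MPHC.graphL s) G →
        MPHC.IndFree (MPHC.graphS t) G →
        ∃ (φ : Fin n → Option (Fin h)) (k : MPHC.Cost),
          MPHC.Runs p ⟨s, t, n, G, rev⟩ φ k ∧
          MPHC.IsOptimum H ⟨s, t, n, G, rev⟩ φ ∧
          k.total ≤ C * max n 1 ^ (C * (MPHC.ramsey s t * G.cliqueNum)) ∧
          k.depth ≤ 2 * G.cliqueNum ∧
          max k.own k.peak ≤ C * max n 1 ^ (C * MPHC.ramsey s t) := by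
  obtain ⟨C₁, hC₁⟩ := MPHC.exists_polynomial_bound H
  set C₀ := (MPHC.Prog.main H).bound h (h + 1) 0 with hC₀
  refine ⟨MPHC.Prog.main H, C₀ + C₁ + 1, fun s t n G rev hs ht hP hL hS => ?_⟩
  -- For `n ≤ 1` the powers of `max n 1` equal 1, so a constant must bound the run: the graph is
  -- edgeless and all loops make at most `h + 1` iterations.
  rcases Nat.lt_or_ge n 2 with hn | hn
  · have hedge : ∀ u v, ¬ G.Adj u v := by
      intro u v huv
      exact huv.ne (Fin.ext (by omega))
    obtain ⟨σ, k, h1, h2, h3, h4, h5, h6⟩ := MPHC.exec_of_ok H (MPHC.main_edgeless_ok (H := H)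
      (I := ⟨s, t, n, G, rev⟩) (E := ⟨h, MPHC.Prog.main H, h + 1, 0, 0, 0⟩) hedge
      (show n ≤ h + 1 by omega) (show h ≤ h + 1 by omega))
    have hone : max n 1 = 1 := by omega
    refine ⟨_, k, ⟨σ, h1, rfl⟩, h2, ?_, by omega, ?_⟩
    · rw [hone, one_pow]
      omega
    · rw [hone, one_pow]
      omega
  · obtain ⟨σ, k, h1, h2, h3, h4, h5, h6⟩ := MPHC.exec_main H hs ht rfl rfl rfl G.cliqueNum G rev rfl
      (by omega) hP hL hS
    have hb := hC₁ s t n _ _ hs ht hn rfl rfl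
    have hmax : max n 1 = n := by omega
    have hle : n ^ (C₁ * MPHC.ramsey s t) ≤ n ^ ((C₀ + C₁ + 1) * MPHC.ramsey s t) :=
      Nat.pow_le_pow_right (by omega) (Nat.mul_le_mul_right _ (by omega))
    refine ⟨_, k, ⟨σ, h1, rfl⟩, h2, ?_, by omega, ?_⟩
    · rw [hmax]
      refine h5.trans (le_trans ?_ (Nat.le_mul_of_pos_left _ (by omega)))
      rw [← mul_assoc, pow_mul]
      exact Nat.pow_le_pow_left (hb.trans hle) _
    · rw [hmax]
      refine le_trans ?_ (Nat.le_mul_of_pos_left _ (by omega))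
      exact (max_le (by omega) (by omega)).trans (hb.trans hle)
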